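/- Let $X\subseteq\{1,2,3\}^{\mathbb N}$ be an irreducible one-sided shift of finite type given by a $3\times3$ transition matrix of zeros and ones, with shift map $\sigma_X$, and let $Y\subseteq\{1,2\}^{\mathbb N}$, with shift map $\sigma_Y$, be either the full shift or the shift of finite type with transition matrix $\begin{pmatrix}0&1\\1&1\end{pmatrix}$. (Irreducible means: for all words $u,v$ in the language of $X$ there is a word $w$ in the language such that $uwv$ is in the language.) Let $\pi:X\to Y$ be a factor map (continuous, surjective, $\pi\circ\sigma_X=\sigma_Y\circ\pi$) that is the one-block code given by $1\mapsto1$, $2\mapsto2$, $3\mapsto2$. Write $M(X,\sigma_X)$ and $M(Y,\sigma_Y)$ for the sets of shift-invariant Borel probability measures, and let $\mu\in M(X,\sigma_X)$ be the measure of maximal entropy, i.e. $h_\mu(\sigma_X)=\sup\{h_\nu(\sigma_X):\nu\in M(X,\sigma_X)\}$. Let $\pi\mu(B)=\mu(\pi^{-1}B)$. Let $\Phi=\{\log\phi_n\}_{n\ge1}$ be the sequence on $Y$ associated to the relative pressure function $P(\sigma_X,\pi,0)$: for $f\in C(X)$ the sequence $\{\log g_n\}_{n\ge 1}$ associated to $P(\sigma_X,\pi,f)$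 is given by $g_n(y)=\sup_{E_n(y)}\sum_{x\in E_n(y)}e^{(S_nf)(x)}$, where $S_nf=\sum_{i=0}^{n-1}f\circ\sigma_X^i$ and $E_n(y)$ runs over the sets consisting of exactly one point from each cylinder $[x_1\dots x_n]$ of $X$ with $\pi(x_1\dots x_n)=y_1\dots y_n$; so $\phi_n(y)$ is the number of words $x_1\dots x_n$ in the language of $X$ that $\pi$ maps to $y_1\dots y_n$. The sequence $\Phi$ is *almost additive* if there is $C>0$ with $e^{-C}\phi_n(y)\phi_m(\sigma_Y^ny)\le\phi_{n+m}(y)\le e^{C}\phi_n(y)\phi_m(\sigma_Y^ny)$ for all $y\in Y$ and $n,m\ge1$, and *weakly almost additive* if there are $C_n>0$ with $\lim_{n\to\infty}C_n/n=0$ such that these inequalities hold with $C_n$ in place of $C$. A measure $\nu\in M(Y,\sigma_Y)$ is an *invariant weak Gibbs measure* for $g:Y\to\mathbb R$ if there are $P\in\mathbb R$ and $C_n>0$ with $\lim_{n\to\infty}\frac1n\log C_n=0$ such that $$\frac1{C_n}\le\frac{\nu[y_1\dots y_n]}{e^{-nP}e^{(S_ng)(y)}}\le C_n\qquad\text{for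 all }y\in Y,\ n\ge1,$$ where $S_ng=\sum_{i=0}^{n-1}g\circ\sigma_Y^i$; it is an *invariant Gibbs measure* for $g$ if $C_n$ can be taken independent of $n$. Then $\Phi$ is almost additive on $Y$ if and only if there exists $\hat g\in C(Y)$ for which $\pi\mu$ is the unique invariant Gibbs measure. Moreover, if $\Phi$ is weakly almost additive on $Y$, then there exists $\hat g\in C(Y)$ for which $\pi\mu$ is the unique invariant weak Gibbs measure. -/

import Mathlib

open MeasureTheory Filter Topology

/-- A one-sided subshift over `k` symbols: a closed set of sequences, mapped into itself by the
left shift. The symbols `1, …, k` are represented by `0, …, k - 1 : Fin k`, and the coordinates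
`1, 2, …` of a point by `0, 1, …`. -/
structure Subshift (k : ℕ) where
  carrier : Set (ℕ → Fin k)
  isClosed : IsClosed carrier
  shift_mem : ∀ x ∈ carrier, (fun n => x (n + 1)) ∈ carrier

namespace Subshift

instance (k : ℕ) : CoeSort (Subshift k) Type where
  coe X := X.carrier

/-- The shift map `σ_X : X → X`. -/
def shift {k : ℕ} (X : Subshift k) (x : X) : X :=
  ⟨fun n => x.1 (n + 1), X.shift_mem x.1 x.2⟩

/-- The cylinder `[x_1 … x_n]` in `X` determined by the first `n` coordinates of `x ∈ X`. -/
def cylinder {k : ℕ} (X : Subshift k) (x : X) (n : ℕ) : Set X :=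
  {z | ∀ i < n, z.1 i = x.1 i}

/-- The language `B(X)`: all finite words that appear in points of `X`. -/
def language {k : ℕ} (X : Subshift k) : Set (List (Fin k)) :=
  {w | ∃ x : X, ∃ i : ℕ, w = List.ofFn (fun j : Fin w.length => x.1 (i + j))}

/-- Irreducibility of a subshift. -/
def IsIrreducible {k : ℕ} (X : Subshift k) : Prop :=
  ∀ u ∈ X.language, ∀ v ∈ X.language, ∃ w ∈ X.language, u ++ w ++ v ∈ X.language

/-- The one-sided shift of finite type `X_A` with transition matrix `A`. -/
def ofMatrix {k : ℕ} (A : Matrix (Fin k) (Fin k) ℕ) : Subshift k where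
  carrier := {x | ∀ n, A (x n) (x (n + 1)) = 1}
  isClosed := by
    rw [Set.ofPred_forall]
    refine isClosed_iInter fun n => ?_
    have h : Continuous fun x : ℕ → Fin k => (x n, x (n + 1)) := by fun_prop
    exact (isClosed_discrete {p : Fin k × Fin k | A p.1 p.2 = 1}).preimage h
  shift_mem := fun _ hx n => hx (n + 1)

/-- Factor maps between subshifts. -/
def IsFactorMap {k l : ℕ} {X : Subshift k} {Y : Subshift l} (π : X → Y) : Prop :=
  Continuous π ∧ Function.Surjective π ∧ ∀ x, π (X.shift x) = Y.shift (π x)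

/-- `π` is the one-block code induced by the map of symbols `φ`. -/
def IsOneBlockCode {k l : ℕ} {X : Subshift k} {Y : Subshift l}
    (φ : Fin k → Fin l) (π : X → Y) : Prop :=
  ∀ (x : X) (i : ℕ), (π x).1 i = φ (x.1 i)

/-- `M(X, σ_X)`: the shift-invariant Borel probability measures on `X`. -/
def IsInvariant {k : ℕ} (X : Subshift k) (μ : Measure X) : Prop :=
  IsProbabilityMeasure μ ∧ MeasurePreserving X.shift μ μ

end Subshift

section Entropy

/-- The Shannon entropy `-∑ μ(P_i) log μ(P_i)` of the finite partition with atoms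
`P_i = α⁻¹{i}`. -/
noncomputable def partitionEntropy {Ω ι : Type} [MeasurableSpace Ω] [Fintype ι]
    (μ : Measure Ω) (α : Ω → ι) : ℝ :=
  ∑ i, Real.negMulLog (μ.real (α ⁻¹' {i}))

/-- The entropy of `T` relative to the finite partition `α`: the limit (which exists when `T`
preserves the probability measure `μ`) of `H_μ(α ∨ T⁻¹α ∨ … ∨ T^{-(n-1)}α) / n`. -/
noncomputable def entropyOfPartition {Ω : Type} [MeasurableSpace Ω] (μ : Measure Ω) (T : Ω → Ω)
    {k : ℕ} (α : Ω → Fin k) : EReal :=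
  limsup (fun n : ℕ =>
    ((partitionEntropy μ (fun x (i : Fin n) => α (T^[i] x)) / n : ℝ) : EReal)) atTop

/-- The Kolmogorov–Sinai entropy `h_μ(T)`: the supremum over all finite measurable
partitions. -/
noncomputable def measureEntropy {Ω : Type} [MeasurableSpace Ω] (μ : Measure Ω) (T : Ω → Ω) :
    EReal :=
  ⨆ (k : ℕ) (α : Ω → Fin k) (_ : Measurable α), entropyOfPartition μ T α

end Entropy

namespace Subshift

/-- `μ ∈ M(X, σ_X)` is a measure of maximal entropy:
`h_μ(σ_X) = sup {h_ν(σ_X) : ν ∈ M(X, σ_X)}`. -/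
def IsMaximalEntropy {k : ℕ} (X : Subshift k) (μ : Measure X) : Prop :=
  X.IsInvariant μ ∧
    measureEntropy μ X.shift =
      ⨆ (ν : Measure X) (_ : X.IsInvariant ν), measureEntropy ν X.shift

/-- `E` consists of exactly one point from each cylinder `[x_1 … x_n]` of `X` with
`π(x_1 … x_n) = y_1 … y_n`, where `π` is a one-block code. -/
def IsFiberSection {k l : ℕ} {X : Subshift k} {Y : Subshift l} (π : X → Y)
    (n : ℕ) (y : Y) (E : Finset X) : Prop :=
  (∀ x ∈ E, π x ∈ Y.cylinder y n) ∧
    ∀ x : X, π x ∈ Y.cylinder y n → ∃! e : X, e ∈ E ∧ e ∈ X.cylinder x n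

/-- The functions `g_n` for which `{log g_n}` is the sequence on `Y` associated to the relative
pressure function `P(σ_X, π, f)`:
`g_n(y) = sup ∑_{x ∈ E} exp ((S_n f)(x))`, the supremum being over the sets `E` as above. -/
noncomputable def relPressureSeq {k l : ℕ} {X : Subshift k} {Y : Subshift l} (π : X → Y)
    (f : X → ℝ) (n : ℕ) (y : Y) : ℝ :=
  sSup {s : ℝ | ∃ E : Finset X, IsFiberSection π n y E ∧
    s = ∑ x ∈ E, Real.exp (birkhoffSum X.shift f n x)}

/-- The sequence `{log f_n}_{n ≥ 1}` is almost additive. -/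
def AlmostAdditive {k : ℕ} (X : Subshift k) (f : ℕ → X → ℝ) : Prop :=
  ∃ C : ℝ, 0 < C ∧ ∀ (x : X) (n m : ℕ), 1 ≤ n → 1 ≤ m →
    f (n + m) x ≤ Real.exp C * f n x * f m (X.shift^[n] x) ∧
    Real.exp (-C) * f n x * f m (X.shift^[n] x) ≤ f (n + m) x

/-- The sequence `{log f_n}_{n ≥ 1}` is weakly almost additive. -/
def WeaklyAlmostAdditive {k : ℕ} (X : Subshift k) (f : ℕ → X → ℝ) : Prop :=
  ∃ C : ℕ → ℝ, (∀ n, 1 ≤ n → 0 < C n) ∧ Tendsto (fun n : ℕ => C n / n) atTop (𝓝 0) ∧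
    ∀ (x : X) (n m : ℕ), 1 ≤ n → 1 ≤ m →
      f (n + m) x ≤ Real.exp (C n) * f n x * f m (X.shift^[n] x) ∧
      Real.exp (-C n) * f n x * f m (X.shift^[n] x) ≤ f (n + m) x

/-- `1 / C_n ≤ μ[x_1 … x_n] / exp (-n P + (S_n g)(x)) ≤ C_n` for all `x ∈ X` and `n ≥ 1`. -/
def GibbsBounds {k : ℕ} (X : Subshift k) (μ : Measure X) (g : X → ℝ) (P : ℝ) (C : ℕ → ℝ) :
    Prop :=
  ∀ (x : X) (n : ℕ), 1 ≤ n →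
    1 / C n ≤ μ.real (X.cylinder x n) /
      (Real.exp (-(n * P)) * Real.exp (birkhoffSum X.shift g n x)) ∧
    μ.real (X.cylinder x n) /
      (Real.exp (-(n * P)) * Real.exp (birkhoffSum X.shift g n x)) ≤ C n

/-- `μ` is an invariant Gibbs measure for `g`. -/
def IsInvariantGibbs {k : ℕ} (X : Subshift k) (μ : Measure X) (g : X → ℝ) : Prop :=
  X.IsInvariant μ ∧ ∃ P C : ℝ, 0 < C ∧ X.GibbsBounds μ g P (fun _ => C)

/-- `μ` is an invariant weak Gibbs measure for `g`. -/
def IsInvariantWeakGibbs {k : ℕ} (X : Subshift k) (μ : Measure X) (g : X → ℝ) : Prop :=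
  X.IsInvariant μ ∧ ∃ (P : ℝ) (C : ℕ → ℝ), (∀ n, 1 ≤ n → 0 < C n) ∧
    Tendsto (fun n : ℕ => Real.log (C n) / n) atTop (𝓝 0) ∧ X.GibbsBounds μ g P C

end Subshift

/-! The proof works with transition probabilities from a point z to its preimages iz. For a
continuous family q of such probabilities, positive on admissible pairs, Gibbs' inequality bounds
the entropy of every invariant ν by -∫ log q(x_0, σx) dν (`measureEntropy_le`). Let l be the Perron
eigenvalue of the transition matrix of X and w a positive left eigenvector. The family w_i / (l w_j)
has integrated logarithm -log l for every invariant measure, while the Parry measure has entropy at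
least log l. So for the measure μ of maximal entropy this family maximizes ∫ log q dμ, and a
first-order perturbation shows that μ has exactly these transition probabilities
(`measureReal_pull_of_maximal`). Hence μ is Markov, its cylinders of length n have mass l^{-n} up to
constant factors, and πμ[y_1…y_n] is comparable to l^{-n} φ_n(y). Almost additivity of Φ therefore
makes πμ quasi-Bernoulli. In the other direction, Gibbs bounds yield almost additivity because
Birkhoff sums are additive.

For the construction of ĝ, denote the symbols of Y by 0 and 1, as in `Fin 2`. The symbol 0 has a
single preimage, so πμ renews at 0 (`renewal`): the probability of prepending a symbol to y depends
only on the position a of the first 0 of y. If u_a is the mass of the points 1^a 0…, the symbol 1 is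
prepended with probability u_{a+1}/u_a. This extends continuously to 1^∞ once the ratios converge.
After rescaling by powers of l, u_a is a linear functional of the powers of a 2×2 matrix of zeros
and ones, so a short list of recurrences settles convergence; the transposition is the only matrix
that could produce oscillation, and the words 0 1^a 0 rule that out
(`exists_tendsto_runMass_ratio`). Let g be the logarithm of the resulting transition function. Then
exp(S_n g) is exactly a quotient of cylinder masses whenever the longer cylinder ends in 0, and the
quasi-Bernoulli property turns this into Gibbs bounds of pressure 0 (`exists_gibbsBounds`).

For uniqueness, a weak Gibbs measure ν for g has nonnegative pressure by comparison with πμ. Its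
entropy is then so large that the family behind g is maximizing for ν too, hence ν has the same
transition probabilities (`GibbsBounds.measureReal_pull`). These leave no mass at 1^∞ and determine
the measure (`eq_of_transitions`). -/

namespace Subshift

/-! ### Cylinders, words and the Borel structure of a subshift. -/

variable {k : ℕ} (Z : Subshift k)

instance : CompactSpace Z := isCompact_iff_compactSpace.mp Z.isClosed.isCompact

instance : BorelSpace Z := inferInstanceAs (BorelSpace Z.carrier)

lemma continuous_coord (i : ℕ) : Continuous fun z : Z => z.1 i :=
  (continuous_apply i).comp continuous_subtype_val

lemma continuous_shift : Continuous Z.shift :=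
  Continuous.subtype_mk (continuous_pi fun n => Z.continuous_coord (n + 1)) _

lemma measurable_shift : Measurable Z.shift := Z.continuous_shift.measurable

@[simp] lemma shift_coord (z : Z) (i : ℕ) : (Z.shift z).1 i = z.1 (i + 1) := rfl

@[simp] lemma iterate_shift_coord (n : ℕ) (z : Z) (i : ℕ) :
    (Z.shift^[n] z).1 i = z.1 (n + i) := by
  induction n generalizing z with
  | zero => simp
  | succ n ih => rw [Function.iterate_succ_apply, ih, shift_coord, show n + i + 1 = n + 1 + i by omega]

/-- The word formed by the first `n` symbols of a point. -/
def code (n : ℕ) (z : Z) : Fin n → Fin k := fun i => z.1 i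

lemma continuous_code (n : ℕ) : Continuous (Z.code n) :=
  continuous_pi fun i => Z.continuous_coord i

lemma measurable_code (n : ℕ) : Measurable (Z.code n) := (Z.continuous_code n).measurable

lemma code_eq_iff {n : ℕ} {z z' : Z} : Z.code n z = Z.code n z' ↔ ∀ i < n, z.1 i = z'.1 i := by
  constructor
  · intro h i hi
    exact congrFun h ⟨i, hi⟩
  · intro h
    ext1 i
    exact h i i.2

lemma cylinder_eq_preimage (z : Z) (n : ℕ) : Z.cylinder z n = Z.code n ⁻¹' {Z.code n z} := by
  ext x
  simp only [Set.mem_preimage, Set.mem_singleton_iff, code_eq_iff]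
  rfl

lemma isClopen_code_preimage (n : ℕ) (S : Set (Fin n → Fin k)) : IsClopen (Z.code n ⁻¹' S) :=
  (isClopen_discrete S).preimage (Z.continuous_code n)

lemma isClopen_cylinder (z : Z) (n : ℕ) : IsClopen (Z.cylinder z n) := by
  rw [cylinder_eq_preimage]; exact Z.isClopen_code_preimage n _

lemma measurableSet_cylinder (z : Z) (n : ℕ) : MeasurableSet (Z.cylinder z n) :=
  (Z.isClopen_cylinder z n).isOpen.measurableSet

lemma self_mem_cylinder (z : Z) (n : ℕ) : z ∈ Z.cylinder z n := fun _ _ => rfl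

lemma cylinder_eq_of_mem {z x : Z} {n : ℕ} (h : x ∈ Z.cylinder z n) :
    Z.cylinder x n = Z.cylinder z n := by
  ext y
  exact ⟨fun hy i hi => (hy i hi).trans (h i hi), fun hy i hi => (hy i hi).trans (h i hi).symm⟩

lemma cylinder_anti (z : Z) {n m : ℕ} (h : n ≤ m) : Z.cylinder z m ⊆ Z.cylinder z n :=
  fun _ hx i hi => hx i (hi.trans_le h)

@[simp] lemma cylinder_zero (z : Z) : Z.cylinder z 0 = Set.univ := by
  ext; simp [cylinder]

/-- The cylinder sets of a subshift. -/
def cylinders : Set (Set Z) := {s | ∃ z n, s = Z.cylinder z n}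

lemma isPiSystem_cylinders : IsPiSystem Z.cylinders := by
  rintro _ ⟨z, n, rfl⟩ _ ⟨y, m, rfl⟩ ⟨t, ht, ht'⟩
  refine ⟨t, max n m, ?_⟩
  rw [← Z.cylinder_eq_of_mem ht, ← Z.cylinder_eq_of_mem ht']
  ext x
  constructor
  · rintro ⟨h1, h2⟩ i hi
    rcases lt_max_iff.mp hi with h | h
    · exact h1 i h
    · exact h2 i h
  · intro h
    exact ⟨Z.cylinder_anti t (le_max_left _ _) h, Z.cylinder_anti t (le_max_right _ _) h⟩

lemma countable_cylinders : Z.cylinders.Countable := by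
  have h : Z.cylinders ⊆ Set.range (fun p : Σ n, Fin n → Fin k => Z.code p.1 ⁻¹' {p.2}) := by
    rintro _ ⟨z, n, rfl⟩
    exact ⟨⟨n, Z.code n z⟩, (Z.cylinder_eq_preimage z n).symm⟩
  exact (Set.countable_range _).mono h

lemma measurableSpace_eq_generateFrom :
    (inferInstance : MeasurableSpace Z) = MeasurableSpace.generateFrom Z.cylinders := by
  apply le_antisymm
  · have key : ∀ i : ℕ, ∀ s : Set (Fin k),
        MeasurableSet[MeasurableSpace.generateFrom Z.cylinders] {z : Z | z.1 i ∈ s} := by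
      intro i s
      have h : {z : Z | z.1 i ∈ s} = ⋃₀ {t ∈ Z.cylinders | t ⊆ {z : Z | z.1 i ∈ s}} := by
        ext z
        constructor
        · intro hz
          refine ⟨Z.cylinder z (i + 1), ⟨⟨z, i + 1, rfl⟩, ?_⟩, Z.self_mem_cylinder z _⟩
          intro x hx
          have := hx i (Nat.lt_succ_self i)
          simpa [this] using hz
        · rintro ⟨t, ⟨_, ht⟩, hzt⟩
          exact ht hzt
      rw [h]
      refine MeasurableSet.sUnion (Z.countable_cylinders.mono fun t ht => ht.1) ?_
      intro t ht
      exact MeasurableSpace.measurableSet_generateFrom ht.1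
    have hm : @Measurable _ _ (MeasurableSpace.generateFrom Z.cylinders) _
        (fun z : Z => z.1) := by
      refine (@measurable_pi_iff _ _ _ (MeasurableSpace.generateFrom Z.cylinders) _ _).mpr fun i => ?_
      intro s _
      exact key i s
    exact hm.comap_le
  · refine MeasurableSpace.generateFrom_le ?_
    rintro _ ⟨z, n, rfl⟩
    exact Z.measurableSet_cylinder z n

lemma measure_ext (μ ν : Measure Z) [IsFiniteMeasure μ] (huniv : μ Set.univ = ν Set.univ)
    (h : ∀ z n, μ (Z.cylinder z n) = ν (Z.cylinder z n)) : μ = ν := by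
  refine ext_of_generate_finite _ Z.measurableSpace_eq_generateFrom Z.isPiSystem_cylinders ?_ huniv
  rintro _ ⟨z, n, rfl⟩
  exact h z n

/-- The points that start with the symbol `i` and whose shift lies in `E`. -/
def pull (i : Fin k) (E : Set Z) : Set Z := {z | z.1 0 = i ∧ Z.shift z ∈ E}

lemma isClopen_symbol (n : ℕ) (i : Fin k) : IsClopen {z : Z | z.1 n = i} :=
  (isClopen_discrete {i}).preimage (Z.continuous_coord n)

lemma isClopen_pull (i : Fin k) {E : Set Z} (hE : IsClopen E) : IsClopen (Z.pull i E) :=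
  (Z.isClopen_symbol 0 i).inter (hE.preimage Z.continuous_shift)

/-- The points that start with the word `w` and from there on continue in `E`. -/
def pulls (w : List (Fin k)) (E : Set Z) : Set Z := w.foldr Z.pull E

@[simp] lemma pulls_nil (E : Set Z) : Z.pulls [] E = E := rfl

@[simp] lemma pulls_cons (i : Fin k) (w : List (Fin k)) (E : Set Z) :
    Z.pulls (i :: w) E = Z.pull i (Z.pulls w E) := rfl

lemma pulls_append (u v : List (Fin k)) (E : Set Z) :
    Z.pulls (u ++ v) E = Z.pulls u (Z.pulls v E) := List.foldr_append

lemma isClopen_pulls (w : List (Fin k)) {E : Set Z} (hE : IsClopen E) :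
    IsClopen (Z.pulls w E) := by
  induction w with
  | nil => exact hE
  | cons i w ih => exact Z.isClopen_pull i ih

lemma pull_mono (i : Fin k) {E F : Set Z} (h : E ⊆ F) : Z.pull i E ⊆ Z.pull i F :=
  fun _ hz => ⟨hz.1, h hz.2⟩

/-- The first `n` symbols of a point, as a list. -/
def pre (z : ℕ → Fin k) (n : ℕ) : List (Fin k) := List.ofFn fun i : Fin n => z i

lemma pre_succ (z : ℕ → Fin k) (n : ℕ) : pre z (n + 1) = z 0 :: pre (fun i => z (i + 1)) n := by
  simp [pre, List.ofFn_succ]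

lemma cylinder_succ (z : Z) (n : ℕ) :
    Z.cylinder z (n + 1) = Z.pull (z.1 0) (Z.cylinder (Z.shift z) n) := by
  ext x
  constructor
  · intro h
    exact ⟨h 0 (by omega), fun i hi => h (i + 1) (by omega)⟩
  · rintro ⟨h0, h⟩ i hi
    cases i with
    | zero => exact h0
    | succ i => exact h i (by omega)

lemma cylinder_eq_pulls (z : Z) (n : ℕ) : Z.cylinder z n = Z.pulls (pre z.1 n) Set.univ := by
  induction n generalizing z with
  | zero => simp [pre]
  | succ n ih => rw [cylinder_succ, pre_succ, pulls_cons, ih]; rfl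

lemma measure_ext_pulls (μ ν : Measure Z) [IsFiniteMeasure μ]
    (h : ∀ w, μ (Z.pulls w Set.univ) = ν (Z.pulls w Set.univ)) : μ = ν := by
  refine Z.measure_ext μ ν (h []) fun z n => ?_
  rw [cylinder_eq_pulls]; exact h _

/-- A continuous function on a subshift is nearly constant on long cylinders. -/
lemma exists_uniform_code (f : Z → ℝ) (hf : Continuous f) {ε : ℝ} (hε : 0 < ε) :
    ∃ n, ∀ m ≥ n, ∀ z z' : Z, Z.code m z = Z.code m z' → |f z - f z'| < ε := by
  have hloc : ∀ z : Z, ∃ n, ∀ x ∈ Z.cylinder z n, |f x - f z| < ε / 2 := by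
    intro z
    have hnb : {x : Z | |f x - f z| < ε / 2} ∈ 𝓝 z := by
      have : Tendsto (fun x => |f x - f z|) (𝓝 z) (𝓝 |f z - f z|) :=
        ((hf.sub continuous_const).abs).tendsto z
      rw [sub_self, abs_zero] at this
      exact this.eventually_lt_const (by positivity)
    rw [nhds_subtype, Filter.mem_comap] at hnb
    obtain ⟨t, ht, hts⟩ := hnb
    rw [nhds_pi, Filter.mem_pi] at ht
    obtain ⟨I, hI, s, hs, hst⟩ := ht
    obtain ⟨N, hN⟩ := hI.bddAbove
    refine ⟨N + 1, fun x hx => hts (hst ?_)⟩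
    intro i hi
    rw [hx i (Nat.lt_succ_of_le (hN hi))]
    exact mem_of_mem_nhds (hs i)
  choose N hN using hloc
  -- Finitely many cylinders of small oscillation cover the space; the longest of their lengths
  -- works everywhere.
  obtain ⟨t, ht⟩ := isCompact_univ.elim_finite_subcover (fun z : Z => Z.cylinder z (N z))
    (fun z => (Z.isClopen_cylinder z _).isOpen)
    (fun z _ => Set.mem_iUnion.mpr ⟨z, Z.self_mem_cylinder z _⟩)
  refine ⟨t.sup N, fun m hm z z' hzz => ?_⟩
  have := ht (Set.mem_univ z)
  simp only [Set.mem_iUnion] at this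
  obtain ⟨c, hc, hzc⟩ := this
  have hcm : N c ≤ m := (Finset.le_sup hc).trans hm
  have hz'c : z' ∈ Z.cylinder c (N c) := fun i hi =>
    (code_eq_iff Z |>.mp hzz i (hi.trans_le hcm)).symm.trans (hzc i hi)
  have h1 := hN c z hzc
  have h2 := hN c z' hz'c
  rw [abs_lt] at *
  constructor <;> linarith [h1.1, h1.2, h2.1, h2.2]

end Subshift

/-! ### Gibbs' inequality for finite partitions. -/

/-- The null atoms are finitely many, so their union is null. This keeps the convention `Real.log 0
= 0` out of the later identities for logarithms of products. -/
lemma ae_measureReal_fiber_pos {Ω ι : Type} [MeasurableSpace Ω] [Finite ι] {μ : Measure Ω}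
    [IsFiniteMeasure μ] {α : Ω → ι} :
    ∀ᵐ ω ∂μ, 0 < μ.real (α ⁻¹' {α ω}) := by
  have h : ∀ i, ∀ᵐ ω ∂μ, α ω = i → 0 < μ.real (α ⁻¹' {i}) := by
    intro i
    by_cases h0 : 0 < μ.real (α ⁻¹' {i})
    · exact Eventually.of_forall fun _ _ => h0
    · have h1 : μ (α ⁻¹' {i}) = 0 := by
        have : μ.real (α ⁻¹' {i}) = 0 := le_antisymm (not_lt.mp h0) measureReal_nonneg
        rwa [measureReal_eq_zero_iff] at this
      filter_upwards [measure_eq_zero_iff_ae_notMem.mp h1] with ω hω hi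
      exact absurd hi hω
  filter_upwards [ae_all_iff.mpr h] with ω hω
  exact hω _ rfl

section Gibbs

variable {Ω ι : Type} [MeasurableSpace Ω] [Fintype ι] [MeasurableSpace ι]
  [MeasurableSingletonClass ι] {μ : Measure Ω} {α : Ω → ι}

lemma integrable_comp_of_finite [IsFiniteMeasure μ] (hα : Measurable α) (F : ι → ℝ) :
    Integrable (fun ω => F (α ω)) μ :=
  (integrable_map_measure (Integrable.of_finite (f := F)).aestronglyMeasurable
    hα.aemeasurable).mp Integrable.of_finite

lemma integral_comp_of_finite [IsFiniteMeasure μ] (hα : Measurable α) (F : ι → ℝ) :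
    ∫ ω, F (α ω) ∂μ = ∑ i, μ.real (α ⁻¹' {i}) * F i := by
  rw [← integral_map (φ := α) (f := F) hα.aemeasurable
    (Integrable.of_finite (f := F)).aestronglyMeasurable,
    integral_fintype Integrable.of_finite]
  simp [Measure.real, Measure.map_apply hα (measurableSet_singleton _)]

lemma sum_measureReal_fiber [IsProbabilityMeasure μ] (hα : Measurable α) :
    ∑ i, μ.real (α ⁻¹' {i}) = 1 := by
  have := integral_comp_of_finite (μ := μ) hα (fun _ => (1 : ℝ))
  simpa using this.symm

lemma partitionEntropy_eq_integral [IsFiniteMeasure μ] (hα : Measurable α) :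
    partitionEntropy μ α = -∫ ω, Real.log (μ.real (α ⁻¹' {α ω})) ∂μ := by
  rw [integral_comp_of_finite hα (fun i => Real.log (μ.real (α ⁻¹' {i})))]
  simp [partitionEntropy, Real.negMulLog, Finset.sum_neg_distrib]

/-- Gibbs' inequality. -/
lemma partitionEntropy_le_neg_integral_log [IsProbabilityMeasure μ] (hα : Measurable α)
    (p : ι → ℝ) (hp : ∀ i, 0 ≤ p i) (hsum : ∑ i, p i ≤ 1)
    (hpos : ∀ i, 0 < μ.real (α ⁻¹' {i}) → 0 < p i) :
    partitionEntropy μ α ≤ -∫ ω, Real.log (p (α ω)) ∂μ := by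
  rw [integral_comp_of_finite hα (fun i => Real.log (p i)), partitionEntropy]
  -- This is log t ≤ t - 1 at t = p_i / μ_i; the error terms p_i - μ_i sum to at most zero.
  have h : ∀ i, Real.negMulLog (μ.real (α ⁻¹' {i})) ≤
      -(μ.real (α ⁻¹' {i}) * Real.log (p i)) + (p i - μ.real (α ⁻¹' {i})) := by
    intro i
    rcases (measureReal_nonneg (μ := μ) (s := α ⁻¹' {i})).eq_or_lt with h0 | h0
    · rw [← h0]; simpa using hp i
    · have hpi := hpos i h0
      set t := μ.real (α ⁻¹' {i})
      have h1 := Real.log_le_sub_one_of_pos (div_pos hpi h0)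
      rw [Real.log_div hpi.ne' h0.ne'] at h1
      have h2 := mul_le_mul_of_nonneg_left h1 h0.le
      have h3 : t * (p i / t - 1) = p i - t := by field_simp
      rw [Real.negMulLog]
      nlinarith
  calc _ ≤ ∑ i, (-(μ.real (α ⁻¹' {i}) * Real.log (p i)) + (p i - μ.real (α ⁻¹' {i}))) :=
        Finset.sum_le_sum fun i _ => h i
    _ ≤ _ := by
        rw [Finset.sum_add_distrib, Finset.sum_sub_distrib, Finset.sum_neg_distrib,
          sum_measureReal_fiber hα]
        linarith

end Gibbs

/-! ### Growth of the entropy of words under transition probabilities. -/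

namespace Subshift

variable {k : ℕ} {Z : Subshift k}

/-- Continuous families of transition probabilities from `z` to its preimages `i z`. -/
structure IsTransition (Z : Subshift k) (q : Fin k → Z → ℝ) : Prop where
  cont : ∀ i, Continuous (q i)
  nonneg : ∀ i z, 0 ≤ q i z
  sum_eq_one : ∀ z, ∑ i, q i z = 1
  pos : ∀ x : Z, 0 < q (x.1 0) (Z.shift x)

lemma IsTransition.le_one {q : Fin k → Z → ℝ} (hq : Z.IsTransition q) (i : Fin k) (z : Z) :
    q i z ≤ 1 := by
  rw [← hq.sum_eq_one z]
  exact Finset.single_le_sum (fun j _ => hq.nonneg j z) (Finset.mem_univ i)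

lemma IsTransition.continuous_log {q : Fin k → Z → ℝ} (hq : Z.IsTransition q) :
    Continuous fun x : Z => Real.log (q (x.1 0) (Z.shift x)) := by
  refine Continuous.log ?_ fun x => (hq.pos x).ne'
  have h : Continuous fun p : Fin k × Z => q p.1 p.2 :=
    continuous_prod_of_discrete_left.mpr hq.cont
  exact h.comp ((Z.continuous_coord 0).prodMk Z.continuous_shift)

lemma integrable_of_continuous {ν : Measure Z} [IsFiniteMeasure ν] {f : Z → ℝ}
    (hf : Continuous f) : Integrable f ν :=
  hf.integrable_of_hasCompactSupport (HasCompactSupport.of_compactSpace f)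

lemma code_succ (n : ℕ) (x : Z) :
    Z.code (n + 1) x = Fin.cons (x.1 0) (Z.code n (Z.shift x)) := by
  ext1 i
  refine Fin.cases ?_ (fun i => ?_) i
  · rfl
  · rfl

/-- Gibbs' inequality is applied to the law that draws the last n symbols from ν and then the first
symbol according to q, made into a function of those n symbols. -/
lemma partitionEntropy_code_succ_le {ν : Measure Z} (hν : Z.IsInvariant ν)
    {q : Fin k → Z → ℝ} (hq : Z.IsTransition q) {ε : ℝ} (hε : 0 < ε) :
    ∃ n₀, ∀ n ≥ n₀, partitionEntropy ν (Z.code (n + 1)) ≤ partitionEntropy ν (Z.code n) -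
      ∫ x, Real.log (q (x.1 0) (Z.shift x)) ∂ν + Real.log (1 + k * ε) := by
  have := hν.1
  choose N hN using fun i => Z.exists_uniform_code (q i) (hq.cont i) hε
  refine ⟨Finset.univ.sup N, fun n hn => ?_⟩
  have hK : 0 < 1 + k * ε := by positivity
  classical
  -- The value of q at a representative of the word v, raised by ε. Raising keeps q ≤ r, hence
  -- positivity, at the price of a total mass up to 1 + kε.
  let r : Fin k → (Fin n → Fin k) → ℝ := fun i v =>
    if h : ∃ z, Z.code n z = v then q i h.choose + ε else 0
  have hr0 : ∀ i v, 0 ≤ r i v := by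
    intro i v
    simp only [r]
    split_ifs with h
    · exact add_nonneg (hq.nonneg _ _) hε.le
    · exact le_rfl
  have hrsum : ∀ v, ∑ i, r i v ≤ 1 + k * ε := by
    intro v
    simp only [r]
    split_ifs with h
    · simp [Finset.sum_add_distrib, hq.sum_eq_one]
    · simpa using hK.le
  have hrq : ∀ i z, q i z ≤ r i (Z.code n z) := by
    intro i z
    have h : ∃ z', Z.code n z' = Z.code n z := ⟨z, rfl⟩
    simp only [r, dif_pos h]
    have := hN i n ((Finset.le_sup (Finset.mem_univ i)).trans hn) _ _ h.choose_spec
    rw [abs_lt] at this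
    linarith [this.1]
  let m : (Fin n → Fin k) → ℝ := fun v => ν.real (Z.code n ⁻¹' {v})
  let p : (Fin (n + 1) → Fin k) → ℝ := fun w => m (Fin.tail w) * r (w 0) (Fin.tail w) / (1 + k * ε)
  have hp0 : ∀ w, 0 ≤ p w := fun w =>
    div_nonneg (mul_nonneg measureReal_nonneg (hr0 _ _)) hK.le
  have hinv : ∀ v, ν.real (Z.shift ⁻¹' (Z.code n ⁻¹' {v})) = m v := fun v =>
    hν.2.measureReal_preimage
      (Z.measurable_code n (measurableSet_singleton v)).nullMeasurableSet
  have hpsum : ∑ w, p w ≤ 1 := by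
    rw [← (Fin.consEquiv fun _ => Fin k).sum_comp, Fintype.sum_prod_type_right]
    have ht : ∀ i (v : Fin n → Fin k), Fin.tail (Fin.consEquiv (fun _ => Fin k) (i, v)) = v :=
      fun _ _ => rfl
    simp only [p, ht, Fin.consEquiv_apply, Fin.cons_zero]
    calc _ = ∑ v, m v * (∑ i, r i v) / (1 + k * ε) := by
          simp [Finset.mul_sum, Finset.sum_div]
      _ ≤ ∑ v, m v := by
          refine Finset.sum_le_sum fun v _ => ?_
          rw [div_le_iff₀ hK]
          exact mul_le_mul_of_nonneg_left (hrsum v) measureReal_nonneg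
      _ = 1 := sum_measureReal_fiber (Z.measurable_code n)
  have hppos : ∀ w, 0 < ν.real (Z.code (n + 1) ⁻¹' {w}) → 0 < p w := by
    intro w hw
    have hsub : Z.code (n + 1) ⁻¹' {w} ⊆ Z.shift ⁻¹' (Z.code n ⁻¹' {Fin.tail w}) := by
      rintro x rfl
      simp [code_succ]
    have hm : 0 < m (Fin.tail w) := by
      rw [← hinv]
      exact hw.trans_le (measureReal_mono hsub)
    obtain ⟨x, hx⟩ : (Z.code (n + 1) ⁻¹' {w}).Nonempty := by
      by_contra h
      rw [Set.not_nonempty_iff_eq_empty.mp h] at hw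
      simp at hw
    have hx' : Z.code (n + 1) x = w := hx
    refine div_pos (mul_pos hm ?_) hK
    rw [← hx', code_succ]
    simp only [Fin.cons_zero, Fin.tail_cons]
    exact (hq.pos x).trans_le (hrq _ _)
  have hG := partitionEntropy_le_neg_integral_log (μ := ν) (Z.measurable_code (n + 1)) p hp0
    hpsum hppos
  refine hG.trans ?_
  -- By invariance the entropy of n-words can be read from the shifted point, that is, from the tail
  -- of the word of length n + 1.
  have hH : partitionEntropy ν (Z.code n) = -∫ x, Real.log (m (Z.code n (Z.shift x))) ∂ν := by
    rw [partitionEntropy_eq_integral (Z.measurable_code n)]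
    congr 1
    conv_lhs => rw [← hν.2.map_eq]
    rw [integral_map Z.measurable_shift.aemeasurable]
    · simp only [hν.2.map_eq]; rfl
    · exact (integrable_comp_of_finite (Z.measurable_code n)
        (fun v => Real.log ((Measure.map Z.shift ν).real (Z.code n ⁻¹' {v})))).aestronglyMeasurable
  have hi1 : Integrable (fun x => Real.log (m (Z.code n (Z.shift x)))) ν :=
    integrable_comp_of_finite ((Z.measurable_code n).comp Z.measurable_shift)
      (fun v => Real.log (m v))
  have hi2 : Integrable (fun x => Real.log (q (x.1 0) (Z.shift x))) ν :=
    integrable_of_continuous hq.continuous_log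
  have hi3 : Integrable (fun x => Real.log (m (Z.code n (Z.shift x))) +
      Real.log (q (x.1 0) (Z.shift x))) ν := hi1.add hi2
  have hkey : ∫ x, (Real.log (m (Z.code n (Z.shift x))) + Real.log (q (x.1 0) (Z.shift x)) -
      Real.log (1 + k * ε)) ∂ν ≤ ∫ x, Real.log (p (Z.code (n + 1) x)) ∂ν := by
    refine integral_mono_ae (hi3.sub (integrable_const _))
      (integrable_comp_of_finite (Z.measurable_code (n + 1)) fun w => Real.log (p w)) ?_
    have hae := hν.2.quasiMeasurePreserving.ae
      (ae_measureReal_fiber_pos (μ := ν) (α := Z.code n))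
    filter_upwards [hae] with x hx
    have hmx : 0 < m (Z.code n (Z.shift x)) := hx
    have hrx := (hq.pos x).trans_le (hrq (x.1 0) (Z.shift x))
    simp only [p, code_succ, Fin.cons_zero, Fin.tail_cons]
    rw [Real.log_div (mul_pos hmx hrx).ne' hK.ne', Real.log_mul hmx.ne' hrx.ne']
    gcongr
    · exact hq.pos x
    · exact hrq _ _
  rw [integral_sub hi3 (integrable_const _), integral_add hi1 hi2] at hkey
  simp only [integral_const, probReal_univ, smul_eq_mul, one_mul] at hkey
  linarith

lemma partitionEntropy_code_le {ν : Measure Z} (hν : Z.IsInvariant ν)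
    {q : Fin k → Z → ℝ} (hq : Z.IsTransition q) {ε : ℝ} (hε : 0 < ε) :
    ∃ C, ∀ n : ℕ, partitionEntropy ν (Z.code n) ≤
      n * (-∫ x, Real.log (q (x.1 0) (Z.shift x)) ∂ν + ε) + C := by
  set I := ∫ x, Real.log (q (x.1 0) (Z.shift x)) ∂ν
  obtain ⟨δ, hδ, hδε⟩ : ∃ δ > 0, Real.log (1 + k * δ) ≤ ε := by
    -- With this δ, log(1 + kδ) ≤ kδ ≤ ε.
    refine ⟨ε / (k + 1), by positivity, ?_⟩
    have h1 : (0 : ℝ) < 1 + k * (ε / (k + 1)) := by positivity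
    have h2 := Real.log_le_sub_one_of_pos h1
    have h3 : k * (ε / (k + 1)) ≤ ε := by
      rw [← mul_div_assoc, div_le_iff₀ (by positivity)]
      nlinarith
    linarith
  obtain ⟨n₀, hn₀⟩ := partitionEntropy_code_succ_le hν hq hδ
  -- C absorbs the finitely many lengths up to n₀, where the one-step bound is not available.
  obtain ⟨C, hC⟩ := (Set.finite_le_nat n₀).image
    (fun n : ℕ => partitionEntropy ν (Z.code n) - n * (-I + ε)) |>.bddAbove
  refine ⟨C, fun n => ?_⟩
  by_cases h : n ≤ n₀
  · have := hC ⟨n, h, rfl⟩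
    simp only at this
    linarith
  · have h' : n₀ ≤ n := by omega
    induction n, h' using Nat.le_induction with
    | base => omega
    | succ n hn ih =>
      have h1 := hn₀ n hn
      have h2 : partitionEntropy ν (Z.code n) ≤ n * (-I + ε) + C := by
        by_cases h3 : n ≤ n₀
        · have := hC ⟨n, h3, rfl⟩
          simp only at this
          linarith
        · exact ih h3
      push_cast
      linarith

end Subshift

/-! ### From words to arbitrary finite partitions. -/

namespace Subshift

variable {k : ℕ} {Z : Subshift k}

lemma code_iterate_shift {m n i : ℕ} (h : i + n ≤ m) (x : Z) :
    Z.code n (Z.shift^[i] x) =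
      fun j : Fin n => Z.code m x ⟨i + j, (Nat.add_lt_add_left j.2 i).trans_le h⟩ := by
  ext1 j
  simp [code]

/-- The sets that are determined by finitely many coordinates form an algebra. -/
lemma isSetAlgebra_code_preimage :
    IsSetAlgebra {s : Set Z | ∃ n, ∃ S : Set (Fin n → Fin k), s = Z.code n ⁻¹' S} where
  empty_mem := ⟨0, ∅, rfl⟩
  compl_mem := by
    rintro _ ⟨n, S, rfl⟩
    exact ⟨n, Sᶜ, rfl⟩
  union_mem := by
    rintro _ _ ⟨n, S, rfl⟩ ⟨m, T, rfl⟩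
    refine ⟨max n m, {v | (fun i : Fin n => v ⟨i, i.2.trans_le (le_max_left n m)⟩) ∈ S ∨
      (fun i : Fin m => v ⟨i, i.2.trans_le (le_max_right n m)⟩) ∈ T}, ?_⟩
    rfl

/-- The algebra of finitely determined sets generates the Borel sets, hence is dense in measure. A
set determined by n coordinates is also determined by any m ≥ n. -/
lemma exists_code_approx {ν : Measure Z} [IsFiniteMeasure ν] {s : Set Z} (hs : MeasurableSet s)
    {ε : ℝ} (hε : 0 < ε) :
    ∃ n, ∀ m ≥ n, ∃ S : Set (Fin m → Fin k), ν.real (symmDiff s (Z.code m ⁻¹' S)) < ε := by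
  have hgen : (inferInstance : MeasurableSpace Z) = MeasurableSpace.generateFrom
      {s : Set Z | ∃ n, ∃ S : Set (Fin n → Fin k), s = Z.code n ⁻¹' S} := by
    apply le_antisymm
    · rw [Z.measurableSpace_eq_generateFrom]
      refine MeasurableSpace.generateFrom_mono ?_
      rintro _ ⟨z, n, rfl⟩
      exact ⟨n, _, Z.cylinder_eq_preimage z n⟩
    · refine MeasurableSpace.generateFrom_le ?_
      rintro _ ⟨n, S, rfl⟩
      exact (Z.isClopen_code_preimage n S).isOpen.measurableSet
  have hd := Measure.MeasureDense.of_generateFrom_isSetAlgebra_finite (μ := ν)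
    isSetAlgebra_code_preimage hgen
  obtain ⟨_, ⟨n, S, rfl⟩, ht⟩ := hd.approx s hs (measure_ne_top ν s) ε hε
  refine ⟨n, fun m hm => ⟨{v | (fun i : Fin n => v ⟨i, i.2.trans_le hm⟩) ∈ S}, ?_⟩⟩
  have h1 : ν.real (symmDiff s (Z.code n ⁻¹' S)) < ε := by
    rw [Measure.real]
    exact ENNReal.toReal_lt_of_lt_ofReal ht
  exact h1

/-- Every finite measurable partition is approximated by one into unions of cylinders. -/
lemma exists_partition_approx {ν : Measure Z} [IsProbabilityMeasure ν] {l : ℕ} {α : Z → Fin l}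
    (hα : Measurable α) {ε : ℝ} (hε : 0 < ε) :
    ∃ n, ∃ f : (Fin n → Fin k) → Fin l, ν.real {x | α x ≠ f (Z.code n x)} < ε := by
  obtain ⟨z₀⟩ : Nonempty Z := by
    by_contra h
    have : IsEmpty Z := not_nonempty_iff.mp h
    have h1 := measure_univ (μ := ν)
    rw [Set.univ_eq_empty_iff.mpr this] at h1
    simp at h1
  have hl : (0 : ℝ) < l := by
    have := (α z₀).pos
    exact_mod_cast this
  choose N hN using fun i => exists_code_approx (ν := ν) (hα (measurableSet_singleton i))
    (div_pos hε hl)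
  set n := Finset.univ.sup N
  choose S hS using fun i => hN i n (Finset.le_sup (Finset.mem_univ i))
  classical
  -- Outside the symmetric differences exactly one i has the word in S i, namely the value of α;
  -- elsewhere the choice is arbitrary.
  refine ⟨n, fun v => if h : ∃ i, v ∈ S i then h.choose else α z₀, ?_⟩
  have hsub : {x | α x ≠ if h : ∃ i, Z.code n x ∈ S i then h.choose else α z₀} ⊆
      ⋃ i, symmDiff (α ⁻¹' {i}) (Z.code n ⁻¹' S i) := by
    intro x hx
    by_contra hcon
    simp only [Set.mem_iUnion, not_exists, Set.mem_symmDiff, not_or, not_and, not_not,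
      Set.mem_preimage, Set.mem_singleton_iff] at hcon
    apply hx
    have h : ∃ i, Z.code n x ∈ S i := ⟨α x, (hcon (α x)).1 rfl⟩
    rw [dif_pos h]
    exact (hcon _).2 h.choose_spec
  calc _ ≤ ν.real (⋃ i, symmDiff (α ⁻¹' {i}) (Z.code n ⁻¹' S i)) := measureReal_mono hsub
    _ ≤ ∑ i, ν.real (symmDiff (α ⁻¹' {i}) (Z.code n ⁻¹' S i)) := measureReal_iUnion_fintype_le _
    _ < ∑ i : Fin l, ε / l := Finset.sum_lt_sum_of_nonempty ⟨α z₀, Finset.mem_univ _⟩ fun i _ => hS i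
    _ = ε := by simp; field_simp

/-- The values of α along N steps are guessed from the word of length N + n and passed through a
channel with error probability about δ. Gibbs' inequality for the resulting law costs at most ε per
step, because the guess is rarely wrong. -/
lemma partitionEntropy_le_of_code {ν : Measure Z} (hν : Z.IsInvariant ν) {l : ℕ} {α : Z → Fin l}
    (hα : Measurable α) {ε : ℝ} (hε : 0 < ε) :
    ∃ n : ℕ, ∀ N : ℕ, partitionEntropy ν (fun x (i : Fin N) => α (Z.shift^[i] x)) ≤
      partitionEntropy ν (Z.code (N + n)) + N * ε := by
  have := hν.1
  obtain ⟨δ, hδ0, hδ1, hδ⟩ : ∃ δ : ℝ, 0 < δ ∧ δ < 1 ∧ -Real.log (1 - δ) ≤ ε / 2 := by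
    refine ⟨1 - Real.exp (-(ε / 2)), ?_, ?_, ?_⟩
    · have : Real.exp (-(ε / 2)) < 1 := Real.exp_lt_one_iff.mpr (by linarith)
      linarith
    · have := Real.exp_pos (-(ε / 2))
      linarith
    · simp
  -- L bounds the cost of a wrong guess. Allowing wrong guesses only on mass ε / (2(L + 1)) makes
  -- their mean cost at most ε/2; correct guesses cost the other ε/2.
  set L : ℝ := |Real.log (δ / l)|
  have hη : 0 < ε / (2 * (L + 1)) := by positivity
  obtain ⟨n, f, hf⟩ := exists_partition_approx (ν := ν) hα hη
  refine ⟨n, fun N => ?_⟩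
  have hαi : ∀ i : ℕ, Measurable fun x => α (Z.shift^[i] x) := fun i =>
    hα.comp (Z.measurable_shift.iterate i)
  have hαN : Measurable fun x (i : Fin N) => α (Z.shift^[i] x) :=
    measurable_pi_iff.mpr fun i => hαi i
  let κ : Fin l → Fin l → ℝ := fun b a => if a = b then 1 - δ else δ / l
  let m : (Fin (N + n) → Fin k) → ℝ := fun v => ν.real (Z.code (N + n) ⁻¹' {v})
  let F : (Fin (N + n) → Fin k) → Fin N → Fin l := fun v i =>
    f fun j : Fin n => v ⟨i + j, by omega⟩
  have hl : ∀ a : Fin l, (0 : ℝ) < l := fun a => by exact_mod_cast a.pos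
  have hκ0 : ∀ b a, 0 < κ b a := by
    intro b a
    have := hl a
    simp only [κ]
    split_ifs
    · linarith
    · positivity
  have hκsum : ∀ b, ∑ a, κ b a ≤ 1 := by
    intro b
    have hb := hl b
    have h1 : ∀ a, κ b a ≤ (if a = b then 1 - δ else 0) + δ / l := by
      intro a
      simp only [κ]
      have : 0 < δ / l := by positivity
      split_ifs <;> linarith
    calc _ ≤ ∑ a, ((if a = b then 1 - δ else 0) + δ / l) := Finset.sum_le_sum fun a _ => h1 a
      _ = 1 := by
        rw [Finset.sum_add_distrib]
        simp
        field_simp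
        ring
  -- The law of the channel output. Its value at the actual α-name is bounded below by the single
  -- term of the actual word.
  let p : (Fin N → Fin l) → ℝ := fun a => ∑ v, m v * ∏ i, κ (F v i) (a i)
  have hterm : ∀ v (a : Fin N → Fin l), 0 ≤ m v * ∏ i, κ (F v i) (a i) := fun v a =>
    mul_nonneg measureReal_nonneg (Finset.prod_nonneg fun i _ => (hκ0 _ _).le)
  have hp0 : ∀ a, 0 ≤ p a := fun a => Finset.sum_nonneg fun v _ => hterm v a
  have hpsum : ∑ a, p a ≤ 1 := by
    simp only [p]
    rw [Finset.sum_comm]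
    calc _ ≤ ∑ v, m v := by
          refine Finset.sum_le_sum fun v _ => ?_
          rw [← Finset.mul_sum]
          refine mul_le_of_le_one_right measureReal_nonneg ?_
          have := (Finset.prod_univ_sum (fun _ : Fin N => (Finset.univ : Finset (Fin l)))
            (fun i a => κ (F v i) a)).symm
          rw [Fintype.piFinset_univ] at this
          rw [this]
          exact Finset.prod_le_one (fun i _ => Finset.sum_nonneg fun a _ => (hκ0 _ _).le)
            fun i _ => hκsum _
      _ = 1 := sum_measureReal_fiber (Z.measurable_code _)
  have hple : ∀ x, m (Z.code (N + n) x) *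
      ∏ i : Fin N, κ (f (Z.code n (Z.shift^[i] x))) (α (Z.shift^[i] x)) ≤
      p (fun i => α (Z.shift^[i] x)) := by
    intro x
    have h1 : ∀ i : Fin N, f (Z.code n (Z.shift^[i] x)) = F (Z.code (N + n) x) i := by
      intro i
      rw [code_iterate_shift (m := N + n) (by omega)]
    simp only [h1]
    exact Finset.single_le_sum
      (f := fun v => m v * ∏ i : Fin N, κ (F v i) (α (Z.shift^[i] x)))
      (fun v _ => hterm v _) (Finset.mem_univ (Z.code (N + n) x))
  have hpp : ∀ᵐ x ∂ν, 0 < p (fun i : Fin N => α (Z.shift^[i] x)) := by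
    filter_upwards [ae_measureReal_fiber_pos (μ := ν) (α := Z.code (N + n))] with x hx
    exact (mul_pos hx (Finset.prod_pos fun i _ => hκ0 _ _)).trans_le (hple x)
  have hppos : ∀ a, 0 < ν.real ((fun x (i : Fin N) => α (Z.shift^[i] x)) ⁻¹' {a}) → 0 < p a := by
    intro a ha
    by_contra hcon
    have : ν ((fun x (i : Fin N) => α (Z.shift^[i] x)) ⁻¹' {a}) = 0 := by
      rw [measure_eq_zero_iff_ae_notMem]
      filter_upwards [hpp] with x hx hxa
      rw [Set.mem_preimage, Set.mem_singleton_iff] at hxa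
      rw [hxa] at hx
      exact hcon hx
    rw [Measure.real, this] at ha
    simp at ha
  refine (partitionEntropy_le_neg_integral_log hαN p hp0 hpsum hppos).trans ?_
  rw [partitionEntropy_eq_integral (Z.measurable_code _)]
  let D : Set Z := {x | α x ≠ f (Z.code n x)}
  have hD : MeasurableSet D := by
    have h1 : Measurable fun x => (α x, f (Z.code n x)) :=
      hα.prodMk ((measurable_of_finite f).comp (Z.measurable_code n))
    exact h1 (Set.toFinite {q : Fin l × Fin l | q.1 ≠ q.2}).measurableSet
  let G : Z → ℝ := fun x => -(ε / 2) - D.indicator (fun _ => L) x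
  have hGi : Integrable G ν := (integrable_const _).sub ((integrable_const _).indicator hD)
  have hGκ : ∀ x, G x ≤ Real.log (κ (f (Z.code n x)) (α x)) := by
    intro x
    simp only [G, κ]
    by_cases hx : α x = f (Z.code n x)
    · rw [if_pos hx, Set.indicator_of_notMem (by simpa [D] using hx)]
      linarith
    · rw [if_neg hx, Set.indicator_of_mem (by simpa [D] using hx)]
      have := neg_abs_le (Real.log (δ / l))
      linarith
  have hGint : -ε ≤ ∫ x, G x ∂ν := by
    simp only [G]
    rw [integral_sub (integrable_const _) ((integrable_const _).indicator hD),
      integral_indicator_const _ hD]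
    simp only [integral_const, probReal_univ, smul_eq_mul, one_mul]
    have h1 : ν.real D * L ≤ ε / (2 * (L + 1)) * (L + 1) :=
      mul_le_mul hf.le (by linarith) (abs_nonneg _) hη.le
    have h2 : ε / (2 * (L + 1)) * (L + 1) = ε / 2 := by
      have : L + 1 ≠ 0 := by positivity
      field_simp
    linarith
  -- Stationarity gives every time step the same expected cost.
  have hGsh : ∀ i : ℕ, Integrable (fun x => G (Z.shift^[i] x)) ν ∧
      ∫ x, G (Z.shift^[i] x) ∂ν = ∫ x, G x ∂ν := by
    intro i
    have hi := hν.2.iterate i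
    have hGi' : AEStronglyMeasurable G (Measure.map (Z.shift^[i]) ν) := by
      rw [hi.map_eq]; exact hGi.aestronglyMeasurable
    refine ⟨hi.integrable_comp_of_integrable hGi, ?_⟩
    rw [← integral_map hi.measurable.aemeasurable hGi', hi.map_eq]
  have hm : Integrable (fun x => Real.log (m (Z.code (N + n) x))) ν :=
    integrable_comp_of_finite (Z.measurable_code _) fun v => Real.log (m v)
  have hs : Integrable (fun x => ∑ i : Fin N, G (Z.shift^[i] x)) ν :=
    integrable_finsetSum _ fun i _ => (hGsh i).1
  have hkey : ∫ x, (Real.log (m (Z.code (N + n) x)) + ∑ i : Fin N, G (Z.shift^[i] x)) ∂ν ≤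
      ∫ x, Real.log (p (fun i => α (Z.shift^[i] x))) ∂ν := by
    refine integral_mono_ae (hm.add hs)
      (integrable_comp_of_finite hαN fun w => Real.log (p w)) ?_
    filter_upwards [ae_measureReal_fiber_pos (μ := ν) (α := Z.code (N + n))] with x hx
    have hprod : 0 < ∏ i : Fin N, κ (f (Z.code n (Z.shift^[i] x))) (α (Z.shift^[i] x)) :=
      Finset.prod_pos fun i _ => hκ0 _ _
    have hmx : 0 < m (Z.code (N + n) x) := hx
    calc _ ≤ Real.log (m (Z.code (N + n) x)) +
          ∑ i : Fin N, Real.log (κ (f (Z.code n (Z.shift^[i] x))) (α (Z.shift^[i] x))) := by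
          gcongr with i
          exact hGκ _
      _ = Real.log (m (Z.code (N + n) x) *
          ∏ i : Fin N, κ (f (Z.code n (Z.shift^[i] x))) (α (Z.shift^[i] x))) := by
          rw [Real.log_mul hmx.ne' hprod.ne', Real.log_prod fun i _ => (hκ0 _ _).ne']
      _ ≤ _ := Real.log_le_log (mul_pos hmx hprod) (hple x)
  rw [integral_add hm hs, integral_finsetSum _ fun (i : Fin N) _ => (hGsh i).1] at hkey
  simp only [fun i : Fin N => (hGsh i).2, Finset.sum_const, Finset.card_univ, Fintype.card_fin,
    nsmul_eq_mul] at hkey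
  have := mul_le_mul_of_nonneg_left hGint (Nat.cast_nonneg (α := ℝ) N)
  linarith

lemma limsup_div_le {a : ℕ → ℝ} {c : ℝ}
    (h : ∀ ε > 0, ∃ C, ∀ n : ℕ, a n ≤ n * (c + ε) + C) :
    limsup (fun n : ℕ => ((a n / n : ℝ) : EReal)) atTop ≤ (c : EReal) := by
  refine EReal.le_of_forall_lt_iff_le.mp fun z hz => ?_
  have hz' : c < z := EReal.coe_lt_coe_iff.mp hz
  obtain ⟨C, hC⟩ := h ((z - c) / 2) (by linarith)
  refine limsup_le_of_le (by isBoundedDefault) ?_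
  have hlim : Tendsto (fun n : ℕ => C / (n : ℝ)) atTop (𝓝 0) :=
    tendsto_const_div_atTop_nhds_zero_nat C
  filter_upwards [hlim.eventually_lt_const (show (0 : ℝ) < (z - c) / 2 by linarith),
    eventually_gt_atTop 0] with n hn hn0
  have hn0' : (0 : ℝ) < n := by exact_mod_cast hn0
  rw [EReal.coe_le_coe_iff, div_le_iff₀ hn0']
  rw [div_lt_iff₀ hn0'] at hn
  have := hC n
  linarith

/-- The entropy of an invariant measure is at most the integral of the information function of
any continuous family of transition probabilities. -/
lemma measureEntropy_le {ν : Measure Z} (hν : Z.IsInvariant ν)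
    {q : Fin k → Z → ℝ} (hq : Z.IsTransition q) :
    measureEntropy ν Z.shift ≤ ((-∫ x, Real.log (q (x.1 0) (Z.shift x)) ∂ν : ℝ) : EReal) := by
  refine iSup_le fun l => iSup_le fun α => iSup_le fun hα => limsup_div_le fun ε hε => ?_
  obtain ⟨n, hn⟩ := partitionEntropy_le_of_code hν hα (half_pos hε)
  obtain ⟨C, hC⟩ := partitionEntropy_code_le hν hq (half_pos hε)
  refine ⟨n * (-∫ x, Real.log (q (x.1 0) (Z.shift x)) ∂ν + ε / 2) + C, fun N => ?_⟩
  have h1 := hn N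
  have h2 := hC (N + n)
  push_cast at h2
  linarith

end Subshift

/-! ### Maximizing families of transition probabilities. -/

namespace Subshift

variable {k : ℕ} {Z : Subshift k}

lemma sub_two_mul_sq_le_log {t : ℝ} (ht : |t| ≤ 1 / 2) : t - 2 * t ^ 2 ≤ Real.log (1 + t) := by
  obtain ⟨h1, h2⟩ := abs_le.mp ht
  have h3 : 0 < 1 + t := by linarith
  refine le_trans ?_ (Real.one_sub_inv_le_log_of_pos h3)
  have h4 : 1 - (1 + t)⁻¹ = t / (1 + t) := by field_simp; ring
  rw [h4, le_div_iff₀ h3]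
  nlinarith [sq_nonneg t]

/-- An invariant measure that maximizes the integrated information function among all continuous
families of transition probabilities has these transition probabilities. -/
lemma measureReal_pull_of_maximal {ν : Measure Z} (hν : Z.IsInvariant ν)
    {q : Fin k → Z → ℝ} (hq : Z.IsTransition q)
    (hmax : ∀ q', Z.IsTransition q' → ∫ x, Real.log (q' (x.1 0) (Z.shift x)) ∂ν ≤
      ∫ x, Real.log (q (x.1 0) (Z.shift x)) ∂ν)
    (i : Fin k) {C : Set Z} (hC : IsClopen C) :
    ν.real (Z.pull i C) = ∫ z in C, q i z ∂ν := by
  have := hν.1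
  -- A direction with mean zero under q, so that q_j (1 + sφ_j) is again a family of transition
  -- probabilities for small s; it is continuous because C is clopen.
  let φ : Fin k → Z → ℝ := fun j => C.indicator fun z => (if j = i then 1 else 0) - q i z
  have hφc : ∀ j, Continuous (φ j) := fun j =>
    (continuous_const.sub (hq.cont i)).indicator (by simp [hC.frontier_eq])
  have hφ1 : ∀ j z, |φ j z| ≤ 1 := by
    intro j z
    have h0 := hq.nonneg i z
    have h1 := hq.le_one i z
    by_cases hz : z ∈ C
    · simp only [φ, Set.indicator_of_mem hz]
      split_ifs <;> rw [abs_le] <;> constructor <;> linarith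
    · simp [φ, Set.indicator_of_notMem hz]
  have hφs : ∀ z, ∑ j, q j z * φ j z = 0 := by
    intro z
    by_cases hz : z ∈ C
    · simp only [φ, Set.indicator_of_mem hz, mul_sub, mul_ite, mul_one, mul_zero,
        Finset.sum_sub_distrib, ← Finset.sum_mul, hq.sum_eq_one]
      simp
    · simp [φ, Set.indicator_of_notMem hz]
  have hΦc : Continuous fun x : Z => φ (x.1 0) (Z.shift x) := by
    have h : Continuous fun p : Fin k × Z => φ p.1 p.2 :=
      continuous_prod_of_discrete_left.mpr hφc
    exact h.comp ((Z.continuous_coord 0).prodMk Z.continuous_shift)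
  set J := ∫ x, φ (x.1 0) (Z.shift x) ∂ν with hJ
  have hint := integrable_of_continuous (ν := ν) hΦc
  have hJ1 : |J| ≤ 1 := by
    have := norm_integral_le_of_norm_le_const (μ := ν) (f := fun x : Z => φ (x.1 0) (Z.shift x))
      (Eventually.of_forall fun x => hφ1 _ _)
    simpa using this
  -- J is the first-order change of the maximized integral, and 2s² bounds the remainder of the
  -- logarithm.
  have hpert : ∀ s : ℝ, |s| ≤ 1 / 2 → s * J ≤ 2 * s ^ 2 := by
    intro s hs
    have hsφ : ∀ j z, |s * φ j z| ≤ 1 / 2 := by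
      intro j z
      rw [abs_mul]
      calc |s| * |φ j z| ≤ |s| * 1 := mul_le_mul_of_nonneg_left (hφ1 j z) (abs_nonneg s)
        _ ≤ _ := by linarith
    have hpos : ∀ j z, 0 < 1 + s * φ j z := fun j z => by
      have := (abs_le.mp (hsφ j z)).1
      linarith
    have hq' : Z.IsTransition fun j z => q j z * (1 + s * φ j z) :=
      { cont := fun j => (hq.cont j).mul (continuous_const.add (continuous_const.mul (hφc j)))
        nonneg := fun j z => mul_nonneg (hq.nonneg j z) (hpos j z).le
        sum_eq_one := fun z => by
          have h1 : ∀ j, q j z * (1 + s * φ j z) = q j z + s * (q j z * φ j z) := fun j => by ring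
          simp only [h1, Finset.sum_add_distrib, hq.sum_eq_one, ← Finset.mul_sum, hφs]
          simp
        pos := fun x => mul_pos (hq.pos x) (hpos _ _) }
    have h1 := hmax _ hq'
    have h2 : ∫ x, (Real.log (q (x.1 0) (Z.shift x)) +
        (s * φ (x.1 0) (Z.shift x) - 2 * s ^ 2)) ∂ν ≤
        ∫ x, Real.log (q (x.1 0) (Z.shift x) * (1 + s * φ (x.1 0) (Z.shift x))) ∂ν := by
      refine integral_mono ((integrable_of_continuous hq.continuous_log).add
        ((hint.const_mul s).sub (integrable_const _)))
        (integrable_of_continuous hq'.continuous_log) fun x => ?_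
      have h3 := sub_two_mul_sq_le_log (hsφ (x.1 0) (Z.shift x))
      have h4 : (s * φ (x.1 0) (Z.shift x)) ^ 2 ≤ s ^ 2 := by
        rw [mul_pow]
        refine mul_le_of_le_one_right (sq_nonneg s) ?_
        rw [sq_le_one_iff_abs_le_one]
        exact hφ1 _ _
      simp only
      rw [Real.log_mul (hq.pos x).ne' (hpos _ _).ne']
      linarith
    have h5 : Integrable (fun x => s * φ (x.1 0) (Z.shift x) - 2 * s ^ 2) ν :=
      (hint.const_mul s).sub (integrable_const _)
    rw [integral_add (integrable_of_continuous hq.continuous_log) h5,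
      integral_sub (hint.const_mul s) (integrable_const _), integral_const_mul] at h2
    simp only [integral_const, probReal_univ, smul_eq_mul, one_mul] at h2
    linarith
  have hJ0 : J = 0 := by
    -- At s = J/4 the bound reads J²/4 ≤ J²/8.
    have h1 := hpert (J / 4) (by rw [abs_div, abs_of_pos (by norm_num : (0 : ℝ) < 4)]; linarith)
    nlinarith [sq_nonneg J]
  have hCm := hC.isOpen.measurableSet
  have hpm : MeasurableSet (Z.pull i C) := (Z.isClopen_pull i hC).isOpen.measurableSet
  -- Integrated, this identifies J with the difference of the two sides of the claim.
  have hdecomp : ∀ x : Z, φ (x.1 0) (Z.shift x) =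
      (Z.pull i C).indicator (fun _ => (1 : ℝ)) x - C.indicator (q i) (Z.shift x) := by
    intro x
    by_cases hx : Z.shift x ∈ C
    · simp only [φ, Set.indicator_of_mem hx]
      congr 1
      simp [Set.indicator, pull, hx]
    · simp [φ, hx, pull]
  have hCi : Integrable (C.indicator (q i)) ν :=
    (integrable_of_continuous (hq.cont i)).indicator hCm
  have hsm : AEStronglyMeasurable (C.indicator (q i)) (Measure.map Z.shift ν) := by
    rw [hν.2.map_eq]; exact hCi.aestronglyMeasurable
  rw [hJ] at hJ0
  simp only [hdecomp] at hJ0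
  have hCs : Integrable (fun x => C.indicator (q i) (Z.shift x)) ν :=
    hν.2.integrable_comp_of_integrable hCi
  rw [integral_sub ((integrable_const _).indicator hpm) hCs,
    integral_indicator_const _ hpm, ← integral_map Z.measurable_shift.aemeasurable hsm,
    hν.2.map_eq, integral_indicator hCm] at hJ0
  simp only [smul_eq_mul, mul_one] at hJ0
  linarith

end Subshift

/-! ### Perron–Frobenius eigenvectors. -/

section Perron

open Matrix

variable {ι : Type*} [Fintype ι] [DecidableEq ι] {A : Matrix ι ι ℝ}

lemma Matrix.pow_mulVec_of_mulVec_eq {v : ι → ℝ} {l : ℝ} (hv : A *ᵥ v = l • v) (n : ℕ) :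
    (A ^ n) *ᵥ v = l ^ n • v := by
  induction n with
  | zero => simp
  | succ n ih => rw [pow_succ, ← mulVec_mulVec, hv, mulVec_smul, ih, smul_smul, pow_succ']

/-- A nonnegative eigenvector of an irreducible matrix is positive, and so is its eigenvalue. -/
lemma Matrix.pos_of_mulVec_eq (hA : ∀ i j, 0 ≤ A i j)
    (hirr : ∀ i j, ∃ n, 0 < (A ^ (n + 1)) i j) {v : ι → ℝ} (hv0 : ∀ i, 0 ≤ v i)
    {j : ι} (hvj : 0 < v j) {l : ℝ} (hv : A *ᵥ v = l • v) : 0 < l ∧ ∀ i, 0 < v i := by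
  have key : ∀ i, ∃ n, 0 < l ^ (n + 1) * v i := by
    intro i
    obtain ⟨n, hn⟩ := hirr i j
    refine ⟨n, ?_⟩
    have h1 := congrFun (pow_mulVec_of_mulVec_eq hv (n + 1)) i
    rw [Pi.smul_apply, smul_eq_mul] at h1
    rw [← h1]
    refine lt_of_lt_of_le (mul_pos hn hvj) ?_
    exact Finset.single_le_sum (f := fun k => (A ^ (n + 1)) i k * v k)
      (fun k _ => mul_nonneg (pow_apply_nonneg hA _ i k) (hv0 k)) (Finset.mem_univ j)
  have hl0 : 0 ≤ l := by
    have h1 := congrFun hv j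
    rw [Pi.smul_apply, smul_eq_mul] at h1
    have h2 : 0 ≤ (A *ᵥ v) j := Finset.sum_nonneg fun k _ => mul_nonneg (hA j k) (hv0 k)
    rw [h1] at h2
    exact nonneg_of_mul_nonneg_left h2 hvj
  constructor
  · obtain ⟨n, hn⟩ := key j
    refine hl0.lt_of_ne fun h => ?_
    rw [← h] at hn
    simp at hn
  · intro i
    obtain ⟨n, hn⟩ := key i
    refine (hv0 i).lt_of_ne fun h => ?_
    rw [← h] at hn
    simp at hn

/-- The existence part of the Perron–Frobenius theorem. -/
lemma Matrix.exists_pos_eigenvector [Nonempty ι] (hA : ∀ i j, 0 ≤ A i j)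
    (hirr : ∀ i j, ∃ n, 0 < (A ^ (n + 1)) i j) :
    ∃ l : ℝ, 0 < l ∧ ∃ v : ι → ℝ, (∀ i, 0 < v i) ∧ A *ᵥ v = l • v := by
  set K : ℝ := ∑ i, ∑ j, A i j with hK
  -- Collatz–Wielandt: the largest l with l v ≤ A v for some probability vector v is attained by
  -- compactness, and there equality must hold.
  let S : Set (ℝ × (ι → ℝ)) := (Set.Icc 0 K ×ˢ stdSimplex ℝ ι) ∩ {p | ∀ i, p.1 * p.2 i ≤ (A *ᵥ p.2) i}
  have hbound : ∀ l : ℝ, ∀ v ∈ stdSimplex ℝ ι, (∀ i, l * v i ≤ (A *ᵥ v) i) → l ≤ K := by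
    intro l v hv h
    calc l = ∑ i, l * v i := by rw [← Finset.mul_sum, hv.2, mul_one]
      _ ≤ ∑ i, (A *ᵥ v) i := Finset.sum_le_sum fun i _ => h i
      _ ≤ K := by
        refine Finset.sum_le_sum fun i _ => Finset.sum_le_sum fun j _ => ?_
        refine mul_le_of_le_one_right (hA i j) ?_
        rw [← hv.2]
        exact Finset.single_le_sum (fun k _ => hv.1 k) (Finset.mem_univ j)
  have hS : IsCompact S := by
    refine (isCompact_Icc.prod (isCompact_stdSimplex ℝ ι)).inter_right ?_
    simp only [Set.ofPred_forall]
    refine isClosed_iInter fun i => isClosed_le ?_ ?_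
    · fun_prop
    · have : Continuous fun p : ℝ × (ι → ℝ) => A *ᵥ p.2 :=
        Continuous.matrix_mulVec continuous_const continuous_snd
      exact (continuous_apply i).comp this
  have hSne : S.Nonempty := by
    obtain ⟨i₀⟩ := ‹Nonempty ι›
    refine ⟨(0, Pi.single i₀ 1), ⟨⟨le_rfl, ?_⟩, single_mem_stdSimplex ℝ i₀⟩, ?_⟩
    · exact Finset.sum_nonneg fun i _ => Finset.sum_nonneg fun j _ => hA i j
    · intro i
      simpa using hA i i₀
  obtain ⟨⟨l, v⟩, ⟨⟨hl, hv⟩, hlv⟩, hmax⟩ := hS.exists_isMaxOn hSne continuous_fst.continuousOn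
  simp only [Set.mem_ofPred_eq] at hlv
  obtain ⟨j, hj⟩ : ∃ j, 0 < v j := by
    by_contra! h
    have h1 : ∑ i, v i ≤ 0 := Finset.sum_nonpos fun i _ => h i
    rw [hv.2] at h1
    linarith
  have heq : A *ᵥ v = l • v := by
    by_contra hne
    obtain ⟨i₀, hi₀⟩ : ∃ i, l * v i < (A *ᵥ v) i := by
      by_contra! h
      exact hne (funext fun i => le_antisymm (h i) (hlv i))
    choose N hN using hirr
    obtain ⟨M, hM⟩ : ∃ M, ∀ i j, N i j < M :=
      ⟨Finset.univ.sup (fun i => Finset.univ.sup (N i)) + 1, fun i j => Nat.lt_succ_of_le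
        ((Finset.le_sup (f := N i) (Finset.mem_univ j)).trans
          (Finset.le_sup (f := fun i => Finset.univ.sup (N i)) (Finset.mem_univ i)))⟩
    -- Q has positive entries and commutes with A. Applied to A v - l v it turns strict inequality
    -- in one coordinate into strict inequality in all, so l could be increased.
    let Q : Matrix ι ι ℝ := ∑ n ∈ Finset.range M, A ^ (n + 1)
    have hQ : ∀ i j, 0 < Q i j := by
      intro i j
      simp only [Q, Matrix.sum_apply]
      exact Finset.sum_pos' (fun n _ => pow_apply_nonneg hA _ i j)
        ⟨N i j, Finset.mem_range.mpr (hM i j), hN i j⟩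
    have hQA : A * Q = Q * A :=
      Commute.sum_right (Finset.range M) (fun n => A ^ (n + 1)) A
        fun n _ => (Commute.refl A).pow_right (n + 1)
    have hQpos : ∀ u : ι → ℝ, (∀ i, 0 ≤ u i) → ∀ j, 0 < u j → ∀ i, 0 < (Q *ᵥ u) i := by
      intro u hu j hj i
      exact Finset.sum_pos' (fun k _ => mul_nonneg (hQ i k).le (hu k))
        ⟨j, Finset.mem_univ j, mul_pos (hQ i j) hj⟩
    let w := Q *ᵥ v
    let d := A *ᵥ v - l • v
    have hw : ∀ i, 0 < w i := hQpos v hv.1 j hj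
    have hd : ∀ i, 0 < (Q *ᵥ d) i := hQpos d
      (fun i => sub_nonneg.mpr (hlv i)) i₀ (sub_pos.mpr hi₀)
    have hQd : Q *ᵥ d = A *ᵥ w - l • w := by
      simp only [d, w]
      rw [mulVec_sub, mulVec_smul, mulVec_mulVec, mulVec_mulVec, hQA]
    obtain ⟨ε, hε, hεw⟩ : ∃ ε : ℝ, 0 < ε ∧ ∀ i, ε * w i ≤ (Q *ᵥ d) i := by
      have h1 : ∀ i, ∀ᶠ ε : ℝ in 𝓝[>] 0, ε * w i < (Q *ᵥ d) i := by
        intro i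
        have h2 : Tendsto (fun ε : ℝ => ε * w i) (𝓝 0) (𝓝 (0 * w i)) :=
          tendsto_id.mul_const (w i)
        rw [zero_mul] at h2
        exact (h2.mono_left nhdsWithin_le_nhds).eventually_lt_const (hd i)
      obtain ⟨ε, h2, h3⟩ := ((eventually_all.mpr h1).and self_mem_nhdsWithin).exists
      exact ⟨ε, h3, fun i => (h2 i).le⟩
    have hs : 0 < ∑ i, w i := Finset.sum_pos (fun i _ => hw i) ⟨j, Finset.mem_univ j⟩
    have hw' : (∑ i, w i)⁻¹ • w ∈ stdSimplex ℝ ι := by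
      refine ⟨fun i => (mul_pos (inv_pos.mpr hs) (hw i)).le, ?_⟩
      simp only [Pi.smul_apply, smul_eq_mul]
      rw [← Finset.mul_sum, inv_mul_cancel₀ hs.ne']
    have hineq : ∀ i, (l + ε) * ((∑ i, w i)⁻¹ • w) i ≤ (A *ᵥ ((∑ i, w i)⁻¹ • w)) i := by
      intro i
      have h1 := hεw i
      rw [hQd] at h1
      rw [mulVec_smul]
      simp only [Pi.smul_apply, Pi.sub_apply, smul_eq_mul] at h1 ⊢
      rw [mul_left_comm]
      refine mul_le_mul_of_nonneg_left ?_ (inv_pos.mpr hs).le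
      linarith
    have hmem : (l + ε, (∑ i, w i)⁻¹ • w) ∈ S :=
      ⟨⟨⟨add_nonneg hl.1 hε.le, hbound _ _ hw' hineq⟩, hw'⟩, hineq⟩
    have := hmax hmem
    simp only [Set.mem_ofPred_eq] at this
    linarith
  obtain ⟨h1, h2⟩ := pos_of_mulVec_eq hA hirr hv.1 hj heq
  exact ⟨l, h1, v, h2, heq⟩

/-- The left and right eigenvalues agree because u A v can be evaluated from either side and the
pairing of u and v is positive. -/
lemma Matrix.exists_pos_eigenvectors [Nonempty ι] (hA : ∀ i j, 0 ≤ A i j)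
    (hirr : ∀ i j, ∃ n, 0 < (A ^ (n + 1)) i j) :
    ∃ l : ℝ, 0 < l ∧ ∃ u v : ι → ℝ, (∀ i, 0 < u i) ∧ (∀ i, 0 < v i) ∧
      (∀ j, ∑ i, u i * A i j = l * u j) ∧ (∀ i, ∑ j, A i j * v j = l * v i) := by
  obtain ⟨l, hl, v, hv, hAv⟩ := exists_pos_eigenvector hA hirr
  obtain ⟨l', -, u, hu, hAu⟩ := exists_pos_eigenvector (A := Aᵀ) (fun i j => hA j i)
    (fun i j => by
      obtain ⟨n, hn⟩ := hirr j i
      exact ⟨n, by rwa [← transpose_pow, transpose_apply]⟩)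
  have h1 : ∀ i, ∑ j, A i j * v j = l * v i := fun i => congrFun hAv i
  have h2 : ∀ j, ∑ i, u i * A i j = l' * u j := fun j => by
    rw [← smul_eq_mul, ← Pi.smul_apply, ← hAu]
    exact Finset.sum_congr rfl fun i _ => mul_comm _ _
  have hll : l' = l := by
    have h3 : l' * ∑ j, u j * v j = l * ∑ j, u j * v j := by
      calc _ = ∑ j, (∑ i, u i * A i j) * v j := by
            rw [Finset.mul_sum]
            exact Finset.sum_congr rfl fun j _ => by rw [h2]; ring
        _ = ∑ i, u i * ∑ j, A i j * v j := by
            simp only [Finset.sum_mul, Finset.mul_sum]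
            rw [Finset.sum_comm]
            exact Finset.sum_congr rfl fun j _ => Finset.sum_congr rfl fun i _ => by ring
        _ = _ := by
            rw [Finset.mul_sum]
            exact Finset.sum_congr rfl fun j _ => by rw [h1]; ring
    obtain ⟨i₀⟩ := ‹Nonempty ι›
    exact mul_right_cancel₀ (Finset.sum_pos (fun j _ => mul_pos (hu j) (hv j))
      ⟨i₀, Finset.mem_univ i₀⟩).ne' h3
  exact ⟨l, hl, u, v, hu, hv, fun j => by rw [h2, hll], h1⟩

end Perron

/-! ### Subshifts of finite type and their occurring symbols. -/

namespace Subshift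

variable {k : ℕ}

lemma measureReal_shift_preimage {Z : Subshift k} (ν : Measure Z) [IsFiniteMeasure ν] {E : Set Z}
    (hE : MeasurableSet E) : ν.real (Z.shift ⁻¹' E) = ∑ i, ν.real (Z.pull i E) := by
  have h : Z.shift ⁻¹' E = ⋃ i, Z.pull i E := by
    ext x
    simp [pull]
  rw [h, measureReal_iUnion_fintype]
  · intro i j hij
    refine Set.disjoint_left.mpr fun x hx hx' => hij ?_
    exact hx.1.symm.trans hx'.1
  · intro i
    exact (Z.isClopen_symbol 0 i).isOpen.measurableSet.inter (Z.measurable_shift hE)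

variable {A : Matrix (Fin k) (Fin k) ℕ}

/-- The symbols that occur in points of a subshift. -/
abbrev Symbols (Z : Subshift k) : Type := {i : Fin k // ∃ z : Z, z.1 0 = i}

noncomputable instance (Z : Subshift k) : Fintype Z.Symbols := Fintype.ofFinite _

/-- A coordinate of a point, as an occurring symbol. -/
def coord {Z : Subshift k} (z : Z) (n : ℕ) : Z.Symbols := ⟨z.1 n, Z.shift^[n] z, by simp⟩

/-- The point of a subshift of finite type obtained by prepending an admissible symbol. -/
def consPoint (x : ofMatrix A) (i : Fin k) (h : A i (x.1 0) = 1) : ofMatrix A :=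
  ⟨fun n => Nat.casesOn n i x.1, fun n => by
    cases n with
    | zero => exact h
    | succ n => exact x.2 n⟩

@[simp] lemma shift_consPoint (x : ofMatrix A) (i : Fin k) (h : A i (x.1 0) = 1) :
    (ofMatrix A).shift (consPoint x i h) = x := rfl

lemma exists_symbol_of_transition {i j : Fin k} (hj : ∃ x : ofMatrix A, x.1 0 = j)
    (h : A i j = 1) : ∃ x : ofMatrix A, x.1 0 = i := by
  obtain ⟨x, rfl⟩ := hj
  exact ⟨consPoint x i h, rfl⟩

lemma transition_eq_one (x : ofMatrix A) (n : ℕ) : A (x.1 n) (x.1 (n + 1)) = 1 := x.2 n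

lemma pull_cylinder_of_transition (x : ofMatrix A) (n : ℕ) (i : Fin k) (h : A i (x.1 0) = 1) :
    (ofMatrix A).pull i ((ofMatrix A).cylinder x n) =
      (ofMatrix A).cylinder (consPoint x i h) (n + 1) := by
  rw [cylinder_succ]; rfl

lemma pull_eq_empty_of_not_transition {i j : Fin k} (h : A i j ≠ 1) {E : Set (ofMatrix A)}
    (hE : ∀ x ∈ E, x.1 0 = j) : (ofMatrix A).pull i E = ∅ := by
  refine Set.eq_empty_of_forall_notMem fun x hx => h ?_
  have h1 := transition_eq_one x 0
  have h2 := hE _ hx.2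
  rw [shift_coord] at h2
  rwa [h2, hx.1] at h1

/-- The transition matrix between the occurring symbols. -/
noncomputable def transitionMatrix (A : Matrix (Fin k) (Fin k) ℕ) :
    Matrix (ofMatrix A).Symbols (ofMatrix A).Symbols ℝ :=
  fun i j => if A i.1 j.1 = 1 then 1 else 0

lemma transitionMatrix_apply (i j : (ofMatrix A).Symbols) :
    transitionMatrix A i j = if A i.1 j.1 = 1 then 1 else 0 := rfl

lemma transitionMatrix_nonneg (i j : (ofMatrix A).Symbols) : 0 ≤ transitionMatrix A i j := by
  rw [transitionMatrix_apply]; split_ifs <;> norm_num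

lemma transitionMatrix_pow_pos (x : ofMatrix A) (p n : ℕ) :
    0 < (transitionMatrix A ^ n) (coord x p) (coord x (p + n)) := by
  induction n with
  | zero => simp
  | succ n ih =>
    rw [pow_succ, Matrix.mul_apply]
    refine Finset.sum_pos' (fun j _ => mul_nonneg (Matrix.pow_apply_nonneg
      transitionMatrix_nonneg n _ _) (transitionMatrix_nonneg _ _))
      ⟨coord x (p + n), Finset.mem_univ _, mul_pos ih ?_⟩
    have h := transition_eq_one x (p + n)
    rw [transitionMatrix_apply, if_pos]
    · norm_num
    · exact h

lemma singleton_mem_language {Z : Subshift k} (i : Z.Symbols) : [i.1] ∈ Z.language := by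
  obtain ⟨i, x, rfl⟩ := i
  exact ⟨x, 0, by simp⟩

/-- A word i w j of the language is an admissible path with |w| + 1 steps, also when w is empty. -/
lemma transitionMatrix_irreducible (hX : (ofMatrix A).IsIrreducible)
    (i j : (ofMatrix A).Symbols) : ∃ n, 0 < (transitionMatrix A ^ (n + 1)) i j := by
  obtain ⟨w, -, x, p, hx⟩ := hX _ (singleton_mem_language i) _ (singleton_mem_language j)
  refine ⟨w.length, ?_⟩
  have hlen : ([i.1] ++ w ++ [j.1]).length = w.length + 2 := by simp
  have hget : ∀ q (hq : q < ([i.1] ++ w ++ [j.1]).length),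
      ([i.1] ++ w ++ [j.1])[q] = x.1 (p + q) := by
    intro q hq
    have := List.getElem_of_eq hx hq
    rw [this, List.getElem_ofFn]
  have h0 : x.1 p = i.1 := by
    have := hget 0 (by omega)
    simpa using this.symm
  have h1 : x.1 (p + (w.length + 1)) = j.1 := by
    have := hget (w.length + 1) (by omega)
    rw [← this]
    simp
  have h2 : coord x p = i := Subtype.ext h0
  have h3 : coord x (p + (w.length + 1)) = j := Subtype.ext h1
  have := transitionMatrix_pow_pos x p (w.length + 1)
  rwa [h2, h3] at this

end Subshift

/-! ### The Parry measure. -/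

namespace Subshift

variable {k : ℕ} {A : Matrix (Fin k) (Fin k) ℕ}

section Parry

/-- The admissible successors of a symbol. -/
abbrev Successors (A : Matrix (Fin k) (Fin k) ℕ) (a : (ofMatrix A).Symbols) : Type :=
  {b : (ofMatrix A).Symbols // A a.1 b.1 = 1}

noncomputable instance (a : (ofMatrix A).Symbols) : Fintype (Successors A a) := Fintype.ofFinite _

/-- The path from `a` that is obtained by choosing a successor of each symbol at each time. -/
def choicePath (a : (ofMatrix A).Symbols) (ω : (p : ℕ × (ofMatrix A).Symbols) → Successors A p.2) :
    ℕ → (ofMatrix A).Symbols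
  | 0 => a
  | n + 1 => (ω (n, choicePath a ω n)).1

/-- The path of `choicePath` as a point of the subshift. -/
def choicePoint (a : (ofMatrix A).Symbols)
    (ω : (p : ℕ × (ofMatrix A).Symbols) → Successors A p.2) : ofMatrix A :=
  ⟨fun n => (choicePath a ω n).1, fun n => (ω (n, choicePath a ω n)).2⟩

lemma measurable_choicePath (a : (ofMatrix A).Symbols) (n : ℕ) :
    Measurable fun ω => choicePath a ω n := by
  induction n with
  | zero => exact measurable_const
  | succ n ih =>
    refine measurable_to_countable' fun b => ?_
    have h : (fun ω => choicePath a ω (n + 1)) ⁻¹' {b} = ⋃ c,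
        ((fun ω => choicePath a ω n) ⁻¹' {c}) ∩ {ω | (ω (n, c)).1 = b} := by
      ext ω
      simp [choicePath]
    rw [h]
    refine MeasurableSet.iUnion fun c => (ih (measurableSet_singleton c)).inter ?_
    have h1 : Measurable fun ω : (p : ℕ × (ofMatrix A).Symbols) → Successors A p.2 =>
        (ω (n, c)).1 := measurable_subtype_coe.comp (measurable_pi_apply (n, c))
    exact h1 (measurableSet_singleton b)

lemma measurable_choicePoint (a : (ofMatrix A).Symbols) :
    Measurable (choicePoint a) :=
  Measurable.subtype_mk (measurable_pi_iff.mpr fun n =>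
    measurable_subtype_coe.comp (measurable_choicePath a n))

variable {l : ℝ} {v : (ofMatrix A).Symbols → ℝ}

lemma sum_successors (hl : 0 < l) (hv : ∀ i, 0 < v i)
    (hAv : ∀ i, ∑ j, transitionMatrix A i j * v j = l * v i) (a : (ofMatrix A).Symbols) :
    ∑ b : Successors A a, ENNReal.ofReal (v b.1 / (l * v a)) = 1 := by
  rw [← ENNReal.ofReal_sum_of_nonneg
    fun b _ => div_nonneg (hv _).le (mul_pos hl (hv a)).le, ← Finset.sum_div,
    ← ENNReal.ofReal_one]
  congr 1
  rw [div_eq_one_iff_eq (mul_pos hl (hv a)).ne', ← hAv]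
  simp only [transitionMatrix_apply, ite_mul, one_mul, zero_mul]
  rw [← Finset.sum_filter]
  exact (Finset.sum_subtype _ (by simp) v).symm

/-- The transition probabilities of the Markov chain of maximal entropy. -/
noncomputable def successorPMF (hl : 0 < l) (hv : ∀ i, 0 < v i)
    (hAv : ∀ i, ∑ j, transitionMatrix A i j * v j = l * v i) (a : (ofMatrix A).Symbols) :
    PMF (Successors A a) :=
  PMF.ofFintype (fun b => ENNReal.ofReal (v b.1 / (l * v a))) (sum_successors hl hv hAv a)

/-- The measure on the choices of successors, independent at different times and symbols. -/
noncomputable def choiceMeasure (hl : 0 < l) (hv : ∀ i, 0 < v i)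
    (hAv : ∀ i, ∑ j, transitionMatrix A i j * v j = l * v i) :
    Measure ((p : ℕ × (ofMatrix A).Symbols) → Successors A p.2) :=
  Measure.infinitePi fun p => (successorPMF hl hv hAv p.2).toMeasure

instance (hl : 0 < l) (hv : ∀ i, 0 < v i)
    (hAv : ∀ i, ∑ j, transitionMatrix A i j * v j = l * v i) :
    IsProbabilityMeasure (choiceMeasure hl hv hAv) := by
  unfold choiceMeasure; infer_instance

/-- The cylinder only constrains the choices made at the pairs (i, x_i) with i < n. They are
independent, and the product of their probabilities telescopes. -/
lemma choiceMeasure_cylinder (hl : 0 < l) (hv : ∀ i, 0 < v i)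
    (hAv : ∀ i, ∑ j, transitionMatrix A i j * v j = l * v i) (x : ofMatrix A) (n : ℕ) :
    choiceMeasure hl hv hAv (choicePoint (coord x 0) ⁻¹' (ofMatrix A).cylinder x (n + 1)) =
      ENNReal.ofReal (v (coord x n) / (l ^ n * v (coord x 0))) := by
  classical
  let s : Finset (ℕ × (ofMatrix A).Symbols) := (Finset.range n).image fun i => (i, coord x i)
  let t : (p : ℕ × (ofMatrix A).Symbols) → Set (Successors A p.2) :=
    fun p => {b | b.1 = coord x (p.1 + 1)}
  have hset : choicePoint (coord x 0) ⁻¹' (ofMatrix A).cylinder x (n + 1) = Set.pi s t := by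
    ext ω
    have h1 : ω ∈ choicePoint (coord x 0) ⁻¹' (ofMatrix A).cylinder x (n + 1) ↔
        ∀ i < n + 1, choicePath (coord x 0) ω i = coord x i := by
      simp only [Set.mem_preimage, cylinder, Set.mem_ofPred_eq]
      exact forall₂_congr fun i _ => ⟨fun h => Subtype.ext h, fun h => congrArg Subtype.val h⟩
    rw [h1]
    simp only [s, Finset.coe_image, Finset.coe_range, Set.mem_pi, Set.mem_image, Set.mem_Iio,
      forall_exists_index, and_imp, forall_apply_eq_imp_iff₂, t, Set.mem_ofPred_eq]
    constructor
    · intro h i hi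
      have h2 := h i (by omega)
      have h3 := h (i + 1) (by omega)
      rw [choicePath, h2] at h3
      exact h3
    · intro h i hi
      induction i with
      | zero => rfl
      | succ i ih =>
        rw [choicePath, ih (by omega)]
        exact h i (by omega)
  have hprod : ∀ n, ∏ i ∈ Finset.range n, v (coord x (i + 1)) / (l * v (coord x i)) =
      v (coord x n) / (l ^ n * v (coord x 0)) := by
    intro n
    have h0 := (hv (coord x 0)).ne'
    induction n with
    | zero => simp [div_self h0]
    | succ n ih =>
      rw [Finset.prod_range_succ, ih]
      have h1 := (hv (coord x n)).ne'
      field_simp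
      ring
  rw [hset, choiceMeasure, Measure.infinitePi_pi]
  · rw [Finset.prod_image (fun i _ j _ hij => (Prod.ext_iff.mp hij).1)]
    have hfac : ∀ i, (successorPMF hl hv hAv (coord x i)).toMeasure (t (i, coord x i)) =
        ENNReal.ofReal (v (coord x (i + 1)) / (l * v (coord x i))) := by
      intro i
      have h1 : t (i, coord x i) = {⟨coord x (i + 1), transition_eq_one x i⟩} := by
        ext b
        simp only [t, Set.mem_ofPred_eq, Set.mem_singleton_iff, Subtype.ext_iff]
      rw [h1, PMF.toMeasure_apply_singleton _ _ (measurableSet_singleton _)]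
      rfl
    simp only [hfac]
    rw [← ENNReal.ofReal_prod_of_nonneg
      fun i _ => div_nonneg (hv _).le (mul_pos hl (hv _)).le]
    congr 1
    exact hprod n
  · intro p _
    exact (Set.toFinite _).measurableSet

variable {u : (ofMatrix A).Symbols → ℝ}

/-- The Markov measure of maximal entropy, from the eigenvectors of the transition matrix. -/
noncomputable def parryMeasure (u : (ofMatrix A).Symbols → ℝ) (hl : 0 < l) (hv : ∀ i, 0 < v i)
    (hAv : ∀ i, ∑ j, transitionMatrix A i j * v j = l * v i) : Measure (ofMatrix A) :=
  ∑ a, ENNReal.ofReal (u a * v a / ∑ b, u b * v b) •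
    (choiceMeasure hl hv hAv).map (choicePoint a)

lemma isProbabilityMeasure_parryMeasure [Nonempty (ofMatrix A).Symbols] (hl : 0 < l)
    (hu : ∀ i, 0 < u i) (hv : ∀ i, 0 < v i)
    (hAv : ∀ i, ∑ j, transitionMatrix A i j * v j = l * v i) :
    IsProbabilityMeasure (parryMeasure u hl hv hAv) := by
  constructor
  have hs : 0 < ∑ b, u b * v b :=
    Finset.sum_pos (fun b _ => mul_pos (hu b) (hv b)) Finset.univ_nonempty
  have h1 : ∀ a, (choiceMeasure hl hv hAv).map (choicePoint a) Set.univ = 1 := fun a =>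
    (Measure.isProbabilityMeasure_map (measurable_choicePoint a).aemeasurable).measure_univ
  simp only [parryMeasure, Measure.coe_finsetSum, Finset.sum_apply, Measure.smul_apply, h1,
    smul_eq_mul, mul_one]
  rw [← ENNReal.ofReal_sum_of_nonneg
    fun b _ => div_nonneg (mul_pos (hu b) (hv b)).le hs.le, ← Finset.sum_div, div_self hs.ne',
    ENNReal.ofReal_one]

lemma parryMeasure_cylinder [Nonempty (ofMatrix A).Symbols] (hl : 0 < l)
    (hu : ∀ i, 0 < u i) (hv : ∀ i, 0 < v i)
    (hAv : ∀ i, ∑ j, transitionMatrix A i j * v j = l * v i) (x : ofMatrix A) (n : ℕ) :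
    (parryMeasure u hl hv hAv).real ((ofMatrix A).cylinder x (n + 1)) =
      u (coord x 0) * v (coord x n) / (l ^ n * ∑ b, u b * v b) := by
  have hs : 0 < ∑ b, u b * v b :=
    Finset.sum_pos (fun b _ => mul_pos (hu b) (hv b)) Finset.univ_nonempty
  have hcyl := (ofMatrix A).measurableSet_cylinder x (n + 1)
  have hother : ∀ a, a ≠ coord x 0 →
      (choiceMeasure hl hv hAv).map (choicePoint a) ((ofMatrix A).cylinder x (n + 1)) = 0 := by
    intro a ha
    rw [Measure.map_apply (measurable_choicePoint a) hcyl]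
    convert measure_empty (μ := choiceMeasure hl hv hAv)
    refine Set.eq_empty_of_forall_notMem fun ω hω => ha ?_
    exact Subtype.ext (hω 0 (by omega))
  rw [Measure.real, parryMeasure, Measure.finsetSum_apply, Finset.sum_eq_single (coord x 0)]
  · rw [Measure.smul_apply, Measure.map_apply (measurable_choicePoint _) hcyl,
      choiceMeasure_cylinder, smul_eq_mul, ← ENNReal.ofReal_mul
        (div_nonneg (mul_pos (hu _) (hv _)).le hs.le), ENNReal.toReal_ofReal]
    · have h0 := (hv (coord x 0)).ne'
      field_simp
    · exact mul_nonneg (div_nonneg (mul_pos (hu _) (hv _)).le hs.le)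
        (div_nonneg (hv _).le (mul_pos (pow_pos hl n) (hv _)).le)
  · intro a _ ha
    rw [Measure.smul_apply, hother a ha, smul_zero]
  · intro h
    exact absurd (Finset.mem_univ _) h

/-- On cylinders, summing over the prepended symbol is the left eigenvector equation for u. -/
lemma isInvariant_parryMeasure [Nonempty (ofMatrix A).Symbols] (hl : 0 < l)
    (hu : ∀ i, 0 < u i) (hv : ∀ i, 0 < v i)
    (huA : ∀ j, ∑ i, u i * transitionMatrix A i j = l * u j)
    (hAv : ∀ i, ∑ j, transitionMatrix A i j * v j = l * v i) :
    (ofMatrix A).IsInvariant (parryMeasure u hl hv hAv) := by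
  have hprob := isProbabilityMeasure_parryMeasure hl hu hv hAv
  refine ⟨hprob, (ofMatrix A).measurable_shift, ?_⟩
  have hmap := Measure.isProbabilityMeasure_map (μ := parryMeasure u hl hv hAv)
    (ofMatrix A).measurable_shift.aemeasurable
  refine (ofMatrix A).measure_ext _ _ (by simp) fun x n => ?_
  have hcyl := (ofMatrix A).measurableSet_cylinder x n
  rw [Measure.map_apply (ofMatrix A).measurable_shift hcyl, ← measureReal_eq_measureReal_iff]
  cases n with
  | zero => simp
  | succ n =>
    rw [measureReal_shift_preimage _ hcyl, parryMeasure_cylinder hl hu hv hAv]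
    have hpull : ∀ i : Fin k, (parryMeasure u hl hv hAv).real
        ((ofMatrix A).pull i ((ofMatrix A).cylinder x (n + 1))) =
        if h : A i (x.1 0) = 1 then u ⟨i, consPoint x i h, rfl⟩ *
          (v (coord x n) / (l ^ (n + 1) * ∑ b, u b * v b)) else 0 := by
      intro i
      split_ifs with h
      · rw [pull_cylinder_of_transition x _ i h, parryMeasure_cylinder hl hu hv hAv, mul_div_assoc]
        rfl
      · rw [pull_eq_empty_of_not_transition h fun y (hy : y ∈ (ofMatrix A).cylinder x (n + 1)) =>
          hy 0 (by omega)]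
        simp
    simp only [hpull]
    have hsum : ∑ i : Fin k, (if h : A i (x.1 0) = 1 then u ⟨i, consPoint x i h, rfl⟩ *
          (v (coord x n) / (l ^ (n + 1) * ∑ b, u b * v b)) else 0) =
        (∑ i, u i * transitionMatrix A i (coord x 0)) *
          (v (coord x n) / (l ^ (n + 1) * ∑ b, u b * v b)) := by
      rw [Finset.sum_mul]
      symm
      refine Finset.sum_of_injOn (fun i : (ofMatrix A).Symbols => i.1)
        (fun i _ j _ h => Subtype.ext h) (fun _ _ => Finset.mem_coe.mpr (Finset.mem_univ _)) ?_ ?_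
      · intro i _ hi
        rw [dif_neg]
        intro h
        exact hi ⟨⟨i, consPoint x i h, rfl⟩, Finset.mem_coe.mpr (Finset.mem_univ _), rfl⟩
      · intro i _
        rw [transitionMatrix_apply]
        by_cases h : A i.1 (x.1 0) = 1
        · rw [dif_pos h, if_pos (show A i.1 (coord x 0).1 = 1 from h), mul_one]
        · rw [dif_neg h, if_neg (show ¬A i.1 (coord x 0).1 = 1 from h), mul_zero, zero_mul]
    rw [hsum, huA]
    field_simp
    ring

lemma iterate_shift_zero_eq_code {Z : Subshift k} (n : ℕ) :
    (fun (x : Z) (i : Fin n) => (Z.shift^[i] x).1 0) = Z.code n := by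
  ext x i
  simp [code]

/-- Every cylinder of length n + 1 has mass at most a constant times l^{-n}, so already the
partition by the first symbol has entropy at least log l. -/
lemma log_le_measureEntropy_parryMeasure [Nonempty (ofMatrix A).Symbols] (hl : 0 < l)
    (hu : ∀ i, 0 < u i) (hv : ∀ i, 0 < v i)
    (hAv : ∀ i, ∑ j, transitionMatrix A i j * v j = l * v i) :
    ((Real.log l : ℝ) : EReal) ≤
      measureEntropy (parryMeasure u hl hv hAv) (ofMatrix A).shift := by
  have hprob := isProbabilityMeasure_parryMeasure hl hu hv hAv
  set m := parryMeasure u hl hv hAv with hm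
  have hs : 0 < ∑ b, u b * v b :=
    Finset.sum_pos (fun b _ => mul_pos (hu b) (hv b)) Finset.univ_nonempty
  obtain ⟨C, hC⟩ : ∃ C : ℝ, ∀ a b, Real.log (u a * v b / ∑ b, u b * v b) ≤ C := by
    obtain ⟨C, hC⟩ := (Set.finite_range fun p : (ofMatrix A).Symbols × (ofMatrix A).Symbols =>
      Real.log (u p.1 * v p.2 / ∑ b, u b * v b)).bddAbove
    exact ⟨C, fun a b => hC ⟨(a, b), rfl⟩⟩
  have hH : ∀ n : ℕ, n * Real.log l - C ≤ partitionEntropy m ((ofMatrix A).code (n + 1)) := by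
    intro n
    rw [partitionEntropy_eq_integral ((ofMatrix A).measurable_code _), le_neg]
    have hi := integrable_comp_of_finite (μ := m) ((ofMatrix A).measurable_code (n + 1))
      (fun w => Real.log (m.real ((ofMatrix A).code (n + 1) ⁻¹' {w})))
    have h1 := integral_mono hi (integrable_const (-(n * Real.log l - C))) fun x => by
      rw [← cylinder_eq_preimage, hm, parryMeasure_cylinder hl hu hv hAv, mul_comm (l ^ n),
        ← div_div, Real.log_div (div_pos (mul_pos (hu _) (hv _)) hs).ne' (pow_pos hl n).ne',
        Real.log_pow]
      linarith [hC (coord x 0) (coord x n)]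
    simpa using h1
  refine le_trans ?_ (le_iSup_of_le k (le_iSup_of_le (fun x : ofMatrix A => x.1 0)
    (le_iSup_of_le ((ofMatrix A).continuous_coord 0).measurable le_rfl)))
  rw [entropyOfPartition]
  simp only [iterate_shift_zero_eq_code]
  refine EReal.ge_of_forall_gt_iff_ge.mp fun z hz => ?_
  have hz' : z < Real.log l := EReal.coe_lt_coe_iff.mp hz
  refine le_limsup_of_frequently_le (Eventually.frequently ?_) (by isBoundedDefault)
  have hlim : Tendsto (fun n : ℕ => (Real.log l + C) / (n : ℝ)) atTop (𝓝 0) :=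
    tendsto_const_div_atTop_nhds_zero_nat _
  filter_upwards [hlim.eventually_lt_const (show (0 : ℝ) < Real.log l - z by linarith),
    eventually_gt_atTop 0] with n hn hn0
  have hn0' : (0 : ℝ) < n := by exact_mod_cast hn0
  rw [EReal.coe_le_coe_iff, le_div_iff₀ hn0']
  rw [div_lt_iff₀ hn0'] at hn
  obtain ⟨p, rfl⟩ := Nat.exists_eq_succ_of_ne_zero hn0.ne'
  have := hH p
  rw [Nat.succ_eq_add_one] at *
  push_cast at *
  linarith

end Parry

end Subshift

/-! ### The measure of maximal entropy is Markov. -/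

lemma exists_pos_bounds {ι : Type*} [Finite ι] (f : ι → ℝ) (hf : ∀ i, 0 < f i) :
    ∃ c C : ℝ, 0 < c ∧ 0 < C ∧ ∀ i, c ≤ f i ∧ f i ≤ C := by
  obtain ⟨C, hC⟩ := (Set.finite_range f).bddAbove
  obtain ⟨D, hD⟩ := (Set.finite_range fun i => (f i)⁻¹).bddAbove
  refine ⟨(max D 1)⁻¹, max C 1, by positivity, by positivity, fun i => ⟨?_, ?_⟩⟩
  · rw [inv_le_comm₀ (by positivity) (hf i)]
    exact (hD ⟨i, rfl⟩).trans (le_max_left _ _)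
  · exact (hC ⟨i, rfl⟩).trans (le_max_left _ _)

namespace Subshift

variable {k : ℕ} {A : Matrix (Fin k) (Fin k) ℕ}

/-- The backward transition probabilities of the measure of maximal entropy. -/
noncomputable def backward (A : Matrix (Fin k) (Fin k) ℕ) (l : ℝ) (w : Fin k → ℝ)
    (i j : Fin k) : ℝ := if A i j = 1 then w i / (l * w j) else 0

lemma isTransition_backward {l : ℝ} (hl : 0 < l) {w : Fin k → ℝ} (hw : ∀ i, 0 < w i)
    (hsum : ∀ x : ofMatrix A, ∑ i, (if A i (x.1 0) = 1 then w i else 0) = l * w (x.1 0)) :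
    (ofMatrix A).IsTransition fun i z => backward A l w i (z.1 0) where
  cont i := (continuous_of_discreteTopology (f := backward A l w i)).comp
    ((ofMatrix A).continuous_coord 0)
  nonneg i z := by
    rw [backward]
    split_ifs
    · exact div_nonneg (hw _).le (mul_pos hl (hw _)).le
    · exact le_rfl
  sum_eq_one z := by
    have h : ∀ i, backward A l w i (z.1 0) =
        (if A i (z.1 0) = 1 then w i else 0) / (l * w (z.1 0)) := by
      intro i
      rw [backward]
      split_ifs <;> simp
    simp only [h]
    rw [← Finset.sum_div, hsum, div_self (mul_pos hl (hw _)).ne']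
  pos x := by
    rw [backward, if_pos]
    · exact div_pos (hw _) (mul_pos hl (hw _))
    · exact transition_eq_one x 0

/-- The part of the logarithm that depends on w is a coboundary, so invariance removes it. -/
lemma integral_log_backward {μ : Measure (ofMatrix A)} (hμ : (ofMatrix A).IsInvariant μ)
    {l : ℝ} (hl : 0 < l) {w : Fin k → ℝ} (hw : ∀ i, 0 < w i) :
    ∫ x, Real.log (backward A l w (x.1 0) (((ofMatrix A).shift x).1 0)) ∂μ = -Real.log l := by
  have := hμ.1
  have h : ∀ x : ofMatrix A, Real.log (backward A l w (x.1 0) (((ofMatrix A).shift x).1 0)) =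
      (Real.log (w (x.1 0)) - Real.log (w (((ofMatrix A).shift x).1 0))) - Real.log l := by
    intro x
    rw [backward, if_pos (show A (x.1 0) (((ofMatrix A).shift x).1 0) = 1 from
      transition_eq_one x 0), Real.log_div (hw _).ne' (mul_pos hl (hw _)).ne',
      Real.log_mul hl.ne' (hw _).ne']
    ring
  have hc : Continuous fun x : ofMatrix A => Real.log (w (x.1 0)) :=
    (continuous_of_discreteTopology (f := fun i => Real.log (w i))).comp
      ((ofMatrix A).continuous_coord 0)
  have hi := integrable_of_continuous (ν := μ) hc
  have hi' : Integrable (fun x => Real.log (w (((ofMatrix A).shift x).1 0))) μ :=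
    integrable_of_continuous (hc.comp (ofMatrix A).continuous_shift)
  have heq : ∫ x, Real.log (w (((ofMatrix A).shift x).1 0)) ∂μ =
      ∫ x, Real.log (w (x.1 0)) ∂μ := by
    conv_rhs => rw [← hμ.2.map_eq]
    rw [integral_map (ofMatrix A).measurable_shift.aemeasurable hc.aestronglyMeasurable]
  have hi3 : Integrable (fun x : ofMatrix A => Real.log (w (x.1 0)) -
      Real.log (w (((ofMatrix A).shift x).1 0))) μ := hi.sub hi'
  simp only [h]
  rw [integral_sub hi3 (integrable_const _), integral_sub hi hi', heq]
  simp

/-- The data that determine the measure of maximal entropy: an eigenvalue `l` and a positive left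
eigenvector `w` of the transition matrix. -/
structure IsMarkovData (A : Matrix (Fin k) (Fin k) ℕ) (l : ℝ) (w : Fin k → ℝ) : Prop where
  pos : 0 < l
  pos_vec : ∀ i, 0 < w i
  sum_eq : ∀ x : ofMatrix A, ∑ i, (if A i (x.1 0) = 1 then w i else 0) = l * w (x.1 0)

lemma exists_isMarkovData (hX : (ofMatrix A).IsIrreducible) [Nonempty (ofMatrix A).Symbols] :
    ∃ l w, IsMarkovData A l w ∧ ∃ ν, (ofMatrix A).IsInvariant ν ∧
      ((Real.log l : ℝ) : EReal) ≤ measureEntropy ν (ofMatrix A).shift := by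
  classical
  obtain ⟨l, hl, u, v, hu, hv, huA, hAv⟩ := Matrix.exists_pos_eigenvectors
    (A := transitionMatrix A) transitionMatrix_nonneg (transitionMatrix_irreducible hX)
  -- The value 1 only keeps w positive: a symbol that may precede an occurring symbol occurs itself.
  refine ⟨l, fun i => if h : ∃ z : ofMatrix A, z.1 0 = i then u ⟨i, h⟩ else 1, ⟨hl, ?_, ?_⟩,
    parryMeasure u hl hv hAv, isInvariant_parryMeasure hl hu hv huA hAv,
    log_le_measureEntropy_parryMeasure hl hu hv hAv⟩
  · intro i
    split_ifs
    · exact hu _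
    · exact one_pos
  · intro x
    have hx : ∃ z : ofMatrix A, z.1 0 = x.1 0 := ⟨x, rfl⟩
    rw [dif_pos hx, ← huA]
    symm
    refine Finset.sum_of_injOn (fun i : (ofMatrix A).Symbols => i.1)
      (fun i _ j _ h => Subtype.ext h) (fun _ _ => Finset.mem_coe.mpr (Finset.mem_univ _)) ?_ ?_
    · intro i _ hi
      rw [if_neg]
      intro h
      exact hi ⟨⟨i, consPoint x i h, rfl⟩, Finset.mem_coe.mpr (Finset.mem_univ _), rfl⟩
    · intro i _
      rw [transitionMatrix_apply, dif_pos i.2]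
      split_ifs <;> simp

/-- A measure of maximal entropy has the backward transition probabilities. -/
lemma measureReal_pull_of_isMaximalEntropy (hX : (ofMatrix A).IsIrreducible)
    {μ : Measure (ofMatrix A)} (hμ : (ofMatrix A).IsMaximalEntropy μ) :
    ∃ l w, IsMarkovData A l w ∧ ∀ i C, IsClopen C → μ.real ((ofMatrix A).pull i C) =
      ∑ j, backward A l w i j * μ.real (C ∩ {x | x.1 0 = j}) := by
  have := hμ.1.1
  have hne : Nonempty (ofMatrix A).Symbols := by
    obtain ⟨x⟩ := nonempty_of_isProbabilityMeasure μ
    exact ⟨coord x 0⟩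
  obtain ⟨l, w, hlw, ν, hν, hlν⟩ := exists_isMarkovData hX
  have hq := isTransition_backward hlw.pos hlw.pos_vec hlw.sum_eq
  refine ⟨l, w, hlw, fun i C hC => ?_⟩
  rw [measureReal_pull_of_maximal hμ.1 hq ?_ i hC]
  · rw [integral_comp_of_finite (μ := μ.restrict C) ((ofMatrix A).continuous_coord 0).measurable
      (backward A l w i)]
    refine Finset.sum_congr rfl fun j _ => ?_
    rw [mul_comm, measureReal_restrict_apply
      (((ofMatrix A).continuous_coord 0).measurable (measurableSet_singleton j)), Set.inter_comm]
    rfl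
  · intro q' hq'
    -- Maximality follows from log l ≤ h_ν ≤ h_μ ≤ -∫ log q' dμ, with ν the Parry measure.
    rw [integral_log_backward hμ.1 hlw.pos hlw.pos_vec]
    have h1 := measureEntropy_le hμ.1 hq'
    rw [hμ.2] at h1
    have h2 : ((Real.log l : ℝ) : EReal) ≤ _ := hlν.trans ((le_iSup₂_of_le ν hν le_rfl).trans h1)
    rw [EReal.coe_le_coe_iff] at h2
    linarith

/-- Iterating the transitions gives μ[x_0…x_n] = w(x_0) p(x_n) / (l^n w(x_n)), where p(j) is the
mass of the symbol j. The vector p/w is a nonnegative nonzero right eigenvector, hence positive by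
irreducibility, so only finitely many positive constants occur. -/
lemma measureReal_cylinder_bounds (hX : (ofMatrix A).IsIrreducible)
    {μ : Measure (ofMatrix A)} [IsProbabilityMeasure μ] {l : ℝ} {w : Fin k → ℝ}
    (hlw : IsMarkovData A l w)
    (hμ : ∀ i C, IsClopen C → μ.real ((ofMatrix A).pull i C) =
      ∑ j, backward A l w i j * μ.real (C ∩ {x | x.1 0 = j})) :
    ∃ c C : ℝ, 0 < c ∧ 0 < C ∧ ∀ (x : ofMatrix A) (n : ℕ), 1 ≤ n →
      c ≤ l ^ n * μ.real ((ofMatrix A).cylinder x n) ∧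
      l ^ n * μ.real ((ofMatrix A).cylinder x n) ≤ C := by
  classical
  have hl := hlw.pos
  have hw := hlw.pos_vec
  let p : Fin k → ℝ := fun j => μ.real {x : ofMatrix A | x.1 0 = j}
  have hcyl : ∀ (n : ℕ) (x : ofMatrix A), μ.real ((ofMatrix A).cylinder x (n + 1)) =
      w (x.1 0) / (l ^ n * w (x.1 n)) * p (x.1 n) := by
    intro n
    induction n with
    | zero =>
      intro x
      have h1 : (ofMatrix A).cylinder x (0 + 1) = {z | z.1 0 = x.1 0} := by
        ext z; simp [cylinder]
      rw [h1, pow_zero, one_mul, div_self (hw _).ne', one_mul]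
    | succ n ih =>
      intro x
      rw [cylinder_succ, hμ _ _ ((ofMatrix A).isClopen_cylinder _ _),
        Finset.sum_eq_single (x.1 1)]
      · have h1 : (ofMatrix A).cylinder ((ofMatrix A).shift x) (n + 1) ∩ {z | z.1 0 = x.1 1} =
            (ofMatrix A).cylinder ((ofMatrix A).shift x) (n + 1) :=
          Set.inter_eq_left.mpr fun z hz => hz 0 (by omega)
        rw [h1, ih, backward, if_pos (transition_eq_one x 0)]
        simp only [shift_coord, zero_add]
        have h2 := (hw (x.1 1)).ne'
        have h3 := (hw (x.1 (n + 1))).ne'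
        field_simp
        ring
      · intro j _ hj
        have h1 : (ofMatrix A).cylinder ((ofMatrix A).shift x) (n + 1) ∩ {z | z.1 0 = j} = ∅ := by
          refine Set.eq_empty_of_forall_notMem fun z hz => hj ?_
          exact hz.2.symm.trans (hz.1 0 (by omega))
        rw [h1, measureReal_empty, mul_zero]
      · intro h
        exact absurd (Finset.mem_univ _) h
  have hp0 : ∀ j, (¬∃ z : ofMatrix A, z.1 0 = j) → p j = 0 := by
    intro j hj
    have h1 : {x : ofMatrix A | x.1 0 = j} = ∅ :=
      Set.eq_empty_of_forall_notMem fun x hx => hj ⟨x, hx⟩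
    simp only [p, h1, measureReal_empty]
  let ρ : (ofMatrix A).Symbols → ℝ := fun i => p i.1 / w i.1
  have hρ : (transitionMatrix A).mulVec ρ = l • ρ := by
    funext i
    have h1 : p i.1 = ∑ j, backward A l w i.1 j * p j := by
      have h2 := hμ i.1 Set.univ isClopen_univ
      have h3 : (ofMatrix A).pull i.1 Set.univ = {x | x.1 0 = i.1} := by
        ext x; simp [pull]
      rw [h3] at h2
      simpa using h2
    have h4 : ∑ j, backward A l w i.1 j * p j =
        ∑ j : (ofMatrix A).Symbols, backward A l w i.1 j.1 * p j.1 := by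
      symm
      refine Finset.sum_of_injOn (fun i : (ofMatrix A).Symbols => i.1)
        (fun i _ j _ h => Subtype.ext h) (fun _ _ => Finset.mem_coe.mpr (Finset.mem_univ _)) ?_ ?_
      · intro j _ hj
        rw [hp0 j, mul_zero]
        intro h
        exact hj ⟨⟨j, h⟩, Finset.mem_coe.mpr (Finset.mem_univ _), rfl⟩
      · intro j _
        rfl
    rw [Pi.smul_apply, smul_eq_mul, Matrix.mulVec, dotProduct]
    simp only [ρ]
    rw [h1, h4, Finset.sum_div, Finset.mul_sum]
    refine Finset.sum_congr rfl fun j _ => ?_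
    rw [transitionMatrix_apply, backward]
    have h5 := (hw i.1).ne'
    have h6 := (hw j.1).ne'
    split_ifs
    · field_simp
    · simp
  obtain ⟨j, hj⟩ : ∃ j : (ofMatrix A).Symbols, 0 < ρ j := by
    by_contra! h
    have h1 : ∀ j, p j = 0 := by
      intro j
      by_cases hj : ∃ z : ofMatrix A, z.1 0 = j
      · refine le_antisymm ?_ measureReal_nonneg
        have := h ⟨j, hj⟩
        simp only [ρ] at this
        rw [div_le_iff₀ (hw j), zero_mul] at this
        exact this
      · exact hp0 j hj
    have h2 := sum_measureReal_fiber (μ := μ) ((ofMatrix A).continuous_coord 0).measurable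
    have h3 : ∑ j, p j = 1 := h2
    simp [h1] at h3
  have hρ0 : ∀ i, 0 ≤ ρ i := fun i => div_nonneg measureReal_nonneg (hw _).le
  have hρpos := (Matrix.pos_of_mulVec_eq transitionMatrix_nonneg (transitionMatrix_irreducible hX)
    hρ0 hj hρ).2
  obtain ⟨c, C, hc, hC, h⟩ := exists_pos_bounds
    (fun q : Fin k × (ofMatrix A).Symbols => l * w q.1 * ρ q.2)
    (fun q => mul_pos (mul_pos hl (hw _)) (hρpos _))
  refine ⟨c, C, hc, hC, fun x n hn => ?_⟩
  obtain ⟨n, rfl⟩ := Nat.exists_eq_succ_of_ne_zero (by omega : n ≠ 0)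
  -- The extra factor l appears because n + 1 symbols involve only n transitions.
  have h1 : l ^ (n + 1) * μ.real ((ofMatrix A).cylinder x (n + 1)) =
      l * w (x.1 0) * ρ (coord x n) := by
    rw [hcyl]
    simp only [ρ, coord]
    have h5 := (hw (x.1 n)).ne'
    field_simp
    ring
  rw [Nat.succ_eq_add_one, h1]
  exact h (x.1 0, coord x n)

end Subshift

/-! ### Relative pressure and the masses of image cylinders. -/

namespace Subshift

variable {k d : ℕ} {X : Subshift k} {Y : Subshift d} {π : X → Y} {φ : Fin k → Fin d}

lemma IsOneBlockCode.image_mem_cylinder (hcode : IsOneBlockCode φ π) {x z : X} {n : ℕ}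
    (h : z ∈ X.cylinder x n) : π z ∈ Y.cylinder (π x) n := fun i hi => by
  rw [hcode, hcode, h i hi]

lemma exists_isFiberSection (π : X → Y) (n : ℕ) (y : Y) : ∃ E, IsFiberSection π n y E := by
  obtain ⟨E, hE, hbij⟩ := Set.exists_subset_bijOn {x | π x ∈ Y.cylinder y n} (X.code n)
  have hfin : E.Finite := Set.Finite.of_injOn (f := X.code n) (t := Set.univ)
    (fun _ _ => Set.mem_univ _) hbij.injOn Set.finite_univ
  refine ⟨hfin.toFinset, fun x hx => hE (hfin.mem_toFinset.mp hx), fun x hx => ?_⟩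
  obtain ⟨e, he, hex⟩ := hbij.surjOn ⟨x, hx, rfl⟩
  refine ⟨e, ⟨hfin.mem_toFinset.mpr he, (X.code_eq_iff).mp hex⟩, ?_⟩
  rintro e' ⟨he', hex'⟩
  exact hbij.injOn (hfin.mem_toFinset.mp he') he (((X.code_eq_iff).mpr hex').trans hex.symm)

/-- The preimage of a cylinder is the disjoint union of the cylinders through the points of a
section. -/
lemma IsFiberSection.measureReal_map_cylinder (hcode : IsOneBlockCode φ π) (hπ : Measurable π)
    (μ : Measure X) [IsFiniteMeasure μ] {n : ℕ} {y : Y} {E : Finset X}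
    (hE : IsFiberSection π n y E) :
    (μ.map π).real (Y.cylinder y n) = ∑ e ∈ E, μ.real (X.cylinder e n) := by
  have hpre : π ⁻¹' Y.cylinder y n = ⋃ e ∈ E, X.cylinder e n := by
    ext x
    simp only [Set.mem_preimage, Set.mem_iUnion, exists_prop]
    constructor
    · intro hx
      obtain ⟨e, ⟨he, hex⟩, -⟩ := hE.2 x hx
      exact ⟨e, he, fun i hi => (hex i hi).symm⟩
    · rintro ⟨e, he, hxe⟩
      rw [← Y.cylinder_eq_of_mem (hE.1 e he)]
      exact hcode.image_mem_cylinder hxe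
  rw [map_measureReal_apply hπ (Y.measurableSet_cylinder y n), hpre,
    measureReal_biUnion_finset _ fun e _ => X.measurableSet_cylinder e n]
  intro e he e' he' hne
  refine Set.disjoint_left.mpr fun z hz hz' => hne ?_
  obtain ⟨e₀, -, huniq⟩ := hE.2 e (hE.1 e he)
  exact (huniq e ⟨he, X.self_mem_cylinder e n⟩).trans
    (huniq e' ⟨he', fun i hi => (hz' i hi).symm.trans (hz i hi)⟩).symm

/-- The sequence associated to the relative pressure function of zero is comparable to the
measures of cylinders under the image of a measure with comparable cylinders. -/
lemma relPressureSeq_bounds (hcode : IsOneBlockCode φ π) (hπ : Measurable π)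
    {μ : Measure X} [IsFiniteMeasure μ] {l c C : ℝ} (hc : 0 < c)
    (hμ : ∀ (x : X) (n : ℕ), 1 ≤ n → c ≤ l ^ n * μ.real (X.cylinder x n) ∧
      l ^ n * μ.real (X.cylinder x n) ≤ C) (y : Y) {n : ℕ} (hn : 1 ≤ n) :
    c * relPressureSeq π (fun _ => 0) n y ≤ l ^ n * (μ.map π).real (Y.cylinder y n) ∧
      l ^ n * (μ.map π).real (Y.cylinder y n) ≤ C * relPressureSeq π (fun _ => 0) n y := by
  have hsum : ∀ E : Finset X, ∑ x ∈ E, Real.exp (birkhoffSum X.shift (fun _ => (0 : ℝ)) n x) =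
      E.card := by
    intro E
    simp [birkhoffSum]
  have hset : relPressureSeq π (fun _ => 0) n y =
      sSup {s : ℝ | ∃ E : Finset X, IsFiberSection π n y E ∧ s = E.card} := by
    simp only [relPressureSeq, hsum]
  have hE : ∀ E, IsFiberSection π n y E →
      c * E.card ≤ l ^ n * (μ.map π).real (Y.cylinder y n) ∧
      l ^ n * (μ.map π).real (Y.cylinder y n) ≤ C * E.card := by
    intro E hE
    rw [hE.measureReal_map_cylinder hcode hπ μ, Finset.mul_sum, mul_comm c, mul_comm C,
      ← nsmul_eq_mul, ← nsmul_eq_mul]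
    exact ⟨Finset.card_nsmul_le_sum _ _ _ fun e _ => (hμ e n hn).1,
      Finset.sum_le_card_nsmul _ _ _ fun e _ => (hμ e n hn).2⟩
  have hub : ∀ s ∈ {s : ℝ | ∃ E : Finset X, IsFiberSection π n y E ∧ s = E.card},
      s ≤ l ^ n * (μ.map π).real (Y.cylinder y n) / c := by
    rintro s ⟨E, h, rfl⟩
    rw [le_div_iff₀ hc, mul_comm]
    exact (hE E h).1
  obtain ⟨E, hEs⟩ := exists_isFiberSection π n y
  rw [hset]
  constructor
  · rw [mul_comm, ← le_div_iff₀ hc]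
    exact csSup_le ⟨_, E, hEs, rfl⟩ hub
  -- The sign of C is only known from a point of E. If E is empty, the lower bound forces every
  -- section to be empty, and the supremum is 0.
  · rcases E.eq_empty_or_nonempty with h0 | ⟨e, he⟩
    · have h1 := hE E hEs
      rw [h0] at h1
      have h2 : {s : ℝ | ∃ E : Finset X, IsFiberSection π n y E ∧ s = E.card} = {0} := by
        ext s
        constructor
        · rintro ⟨F, hF, rfl⟩
          have h3 := (hE F hF).1.trans h1.2
          have h4 : (0 : ℝ) ≤ F.card := Nat.cast_nonneg _
          simp only [Finset.card_empty, Nat.cast_zero, mul_zero] at h3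
          exact le_antisymm (by nlinarith) h4
        · rintro rfl
          exact ⟨E, hEs, by simp [h0]⟩
      rw [h2, csSup_singleton]
      simpa using h1.2
    · have hC : 0 ≤ C := hc.le.trans ((hμ e n hn).1.trans (hμ e n hn).2)
      exact (hE E hEs).2.trans
        (mul_le_mul_of_nonneg_left (le_csSup ⟨_, hub⟩ ⟨E, hEs, rfl⟩) hC)

/-- The measures of cylinders are multiplicative up to the factors `D n`. -/
def QuasiBernoulli (Y : Subshift d) (m : Measure Y) (D : ℕ → ℝ) : Prop :=
  ∀ (y : Y) (n p : ℕ), 1 ≤ n → 1 ≤ p →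
    m.real (Y.cylinder y (n + p)) ≤
      D n * (m.real (Y.cylinder y n) * m.real (Y.cylinder (Y.shift^[n] y) p)) ∧
    m.real (Y.cylinder y n) * m.real (Y.cylinder (Y.shift^[n] y) p) ≤
      D n * m.real (Y.cylinder y (n + p))

/-- Replacing f by cylinder masses costs C once and 1/c twice in the upper inequality, C twice and
1/c once in the lower one; the powers of l cancel. -/
lemma quasiBernoulli_of_bounds {m : Measure Y} {f : ℕ → Y → ℝ} {l c C : ℝ} (hl : 0 < l)
    (hc : 0 < c) (hC : 0 < C)
    (hf : ∀ (y : Y) (n : ℕ), 1 ≤ n → c * f n y ≤ l ^ n * m.real (Y.cylinder y n) ∧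
      l ^ n * m.real (Y.cylinder y n) ≤ C * f n y)
    {B : ℕ → ℝ} (hB : ∀ (y : Y) (n p : ℕ), 1 ≤ n → 1 ≤ p →
      f (n + p) y ≤ Real.exp (B n) * f n y * f p (Y.shift^[n] y) ∧
      Real.exp (-B n) * f n y * f p (Y.shift^[n] y) ≤ f (n + p) y) :
    Y.QuasiBernoulli m fun n => max (C / c ^ 2) (C ^ 2 / c) * Real.exp (B n) := by
  intro y n p hn hp
  obtain ⟨h1, h2⟩ := hB y n p hn hp
  obtain ⟨a1, a2⟩ := hf y n hn
  obtain ⟨b1, b2⟩ := hf (Y.shift^[n] y) p hp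
  obtain ⟨e1, e2⟩ := hf y (n + p) (by omega)
  rw [pow_add] at e1 e2
  have m1 : 0 ≤ m.real (Y.cylinder y n) := measureReal_nonneg
  have m2 : 0 ≤ m.real (Y.cylinder (Y.shift^[n] y) p) := measureReal_nonneg
  have m3 : 0 ≤ m.real (Y.cylinder y (n + p)) := measureReal_nonneg
  set M1 := m.real (Y.cylinder y n)
  set M2 := m.real (Y.cylinder (Y.shift^[n] y) p)
  set M3 := m.real (Y.cylinder y (n + p))
  set F1 := f n y
  set F2 := f p (Y.shift^[n] y)
  set F3 := f (n + p) y
  have hln := pow_pos hl n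
  have hlp := pow_pos hl p
  have hE := Real.exp_pos (B n)
  have f1 : F1 ≤ l ^ n * M1 / c := by rw [le_div_iff₀ hc]; linarith
  have f2 : F2 ≤ l ^ p * M2 / c := by rw [le_div_iff₀ hc]; linarith
  have f10 : 0 ≤ F1 := nonneg_of_mul_nonneg_right ((mul_nonneg hln.le m1).trans a2) hC
  have f20 : 0 ≤ F2 := nonneg_of_mul_nonneg_right ((mul_nonneg hlp.le m2).trans b2) hC
  constructor
  · have h3 : l ^ n * l ^ p * M3 ≤
        l ^ n * l ^ p * (C / c ^ 2 * Real.exp (B n) * (M1 * M2)) := by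
      calc _ ≤ C * F3 := e2
        _ ≤ C * (Real.exp (B n) * F1 * F2) := by gcongr
        _ = C * Real.exp (B n) * (F1 * F2) := by ring
        _ ≤ C * Real.exp (B n) * ((l ^ n * M1 / c) * (l ^ p * M2 / c)) := by gcongr
        _ = _ := by field_simp
    refine (le_of_mul_le_mul_left h3 (mul_pos hln hlp)).trans ?_
    exact mul_le_mul_of_nonneg_right (mul_le_mul_of_nonneg_right (le_max_left _ _) hE.le)
      (mul_nonneg m1 m2)
  · have h4 : F1 * F2 ≤ Real.exp (B n) * F3 := by
      have h5 := mul_le_mul_of_nonneg_left h2 hE.le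
      rw [Real.exp_neg] at h5
      calc F1 * F2 = Real.exp (B n) * ((Real.exp (B n))⁻¹ * F1 * F2) := by field_simp
        _ ≤ _ := h5
    have f3 : F3 ≤ l ^ n * l ^ p * M3 / c := by rw [le_div_iff₀ hc]; linarith
    have h3 : l ^ n * l ^ p * (M1 * M2) ≤
        l ^ n * l ^ p * (C ^ 2 / c * Real.exp (B n) * M3) := by
      calc _ = (l ^ n * M1) * (l ^ p * M2) := by ring
        _ ≤ (C * F1) * (C * F2) := by gcongr
        _ = C ^ 2 * (F1 * F2) := by ring
        _ ≤ C ^ 2 * (Real.exp (B n) * (l ^ n * l ^ p * M3 / c)) := by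
          exact mul_le_mul_of_nonneg_left (h4.trans (mul_le_mul_of_nonneg_left f3 hE.le))
            (sq_nonneg C)
        _ = _ := by field_simp
    refine (le_of_mul_le_mul_left h3 (mul_pos hln hlp)).trans ?_
    exact mul_le_mul_of_nonneg_right (mul_le_mul_of_nonneg_right (le_max_right _ _) hE.le)
      m3

/-- A sequence comparable to the cylinders of a Gibbs measure is almost additive. -/
lemma almostAdditive_of_gibbsBounds {m : Measure Y} {f : ℕ → Y → ℝ} {l c C : ℝ} (hl : 0 < l)
    (hc : 0 < c) (hC : 0 < C)
    (hf : ∀ (y : Y) (n : ℕ), 1 ≤ n → c * f n y ≤ l ^ n * m.real (Y.cylinder y n) ∧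
      l ^ n * m.real (Y.cylinder y n) ≤ C * f n y)
    {g : Y → ℝ} {P G : ℝ} (hG : 0 < G) (hg : Y.GibbsBounds m g P fun _ => G) :
    Y.AlmostAdditive f := by
  -- e is exactly multiplicative along orbits and comparable to f, so f inherits multiplicativity up
  -- to a constant.
  let e : ℕ → Y → ℝ := fun n y =>
    l ^ n * (Real.exp (-(n * P)) * Real.exp (birkhoffSum Y.shift g n y))
  have he0 : ∀ n y, 0 < e n y := fun n y => by positivity
  have hadd : ∀ n p y, e (n + p) y = e n y * e p (Y.shift^[n] y) := by
    intro n p y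
    simp only [e]
    rw [birkhoffSum_add, pow_add, ← Real.exp_add, ← Real.exp_add, ← Real.exp_add]
    have h : -(((n + p : ℕ) : ℝ) * P) + (birkhoffSum Y.shift g n y +
        birkhoffSum Y.shift g p (Y.shift^[n] y)) = (-(n * P) + birkhoffSum Y.shift g n y) +
        (-(p * P) + birkhoffSum Y.shift g p (Y.shift^[n] y)) := by
      push_cast; ring
    rw [h, Real.exp_add]
    ring
  have hfe : ∀ (y : Y) (n : ℕ), 1 ≤ n → f n y ≤ G / c * e n y ∧ e n y ≤ G * C * f n y := by
    intro y n hn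
    obtain ⟨h1, h2⟩ := hg y n hn
    obtain ⟨h3, h4⟩ := hf y n hn
    have hden : 0 < Real.exp (-(n * P)) * Real.exp (birkhoffSum Y.shift g n y) := by positivity
    rw [le_div_iff₀ hden, div_mul_eq_mul_div, one_mul, div_le_iff₀ hG] at h1
    rw [div_le_iff₀ hden] at h2
    have hln := pow_pos hl n
    constructor
    · rw [div_mul_eq_mul_div, le_div_iff₀ hc, mul_comm]
      refine h3.trans ?_
      calc _ ≤ l ^ n * (G * (Real.exp (-(n * P)) * Real.exp (birkhoffSum Y.shift g n y))) := by
            gcongr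
        _ = _ := by simp only [e]; ring
    · calc e n y ≤ l ^ n * (m.real (Y.cylinder y n) * G) := by
            simp only [e]
            gcongr
        _ = G * (l ^ n * m.real (Y.cylinder y n)) := by ring
        _ ≤ G * (C * f n y) := by gcongr
        _ = _ := by ring
  have hf0 : ∀ (y : Y) (n : ℕ), 1 ≤ n → 0 ≤ f n y := fun y n hn =>
    nonneg_of_mul_nonneg_right ((he0 n y).le.trans (hfe y n hn).2) (mul_pos hG hC)
  let U : ℝ := max (G / c * (G * C) ^ 2) ((G / c) ^ 2 * (G * C))
  have hU : 0 < U := lt_max_of_lt_left (by positivity)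
  refine ⟨max (Real.log U) 1, by positivity, fun y n p hn hp => ?_⟩
  have hexp : U ≤ Real.exp (max (Real.log U) 1) := by
    rw [← Real.log_le_iff_le_exp hU]
    exact le_max_left _ _
  obtain ⟨a1, a2⟩ := hfe y n hn
  obtain ⟨b1, b2⟩ := hfe (Y.shift^[n] y) p hp
  obtain ⟨d1, d2⟩ := hfe y (n + p) (by omega)
  have a0 := hf0 y n hn
  have b0 := hf0 (Y.shift^[n] y) p hp
  have d0 := hf0 y (n + p) (by omega)
  have ea := he0 n y
  have eb := he0 p (Y.shift^[n] y)
  rw [hadd] at d1 d2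
  constructor
  · calc f (n + p) y ≤ G / c * (e n y * e p (Y.shift^[n] y)) := d1
      _ ≤ G / c * ((G * C * f n y) * (G * C * f p (Y.shift^[n] y))) := by gcongr
      _ = G / c * (G * C) ^ 2 * (f n y * f p (Y.shift^[n] y)) := by ring
      _ ≤ Real.exp (max (Real.log U) 1) * (f n y * f p (Y.shift^[n] y)) := by
        gcongr
        exact (le_max_left _ _).trans hexp
      _ = _ := by ring
  · rw [Real.exp_neg, mul_assoc, inv_mul_le_iff₀ (Real.exp_pos _)]
    calc f n y * f p (Y.shift^[n] y) ≤
          (G / c * e n y) * (G / c * e p (Y.shift^[n] y)) := by gcongr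
      _ = (G / c) ^ 2 * (e n y * e p (Y.shift^[n] y)) := by ring
      _ ≤ (G / c) ^ 2 * (G * C * f (n + p) y) := by gcongr
      _ = (G / c) ^ 2 * (G * C) * f (n + p) y := by ring
      _ ≤ _ := by
        gcongr
        exact (le_max_right _ _).trans hexp

end Subshift

/-! ### Weak Gibbs measures, pressure and transition probabilities. -/

namespace Subshift

section WeakGibbs

variable {k : ℕ} {Z : Subshift k}

lemma continuous_birkhoffSum {g : Z → ℝ} (hg : Continuous g) (n : ℕ) :
    Continuous (birkhoffSum Z.shift g n) :=
  continuous_finsetSum _ fun i _ => hg.comp (Z.continuous_shift.iterate i)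

lemma integral_birkhoffSum {ν : Measure Z} (hν : Z.IsInvariant ν) {g : Z → ℝ} (hg : Continuous g)
    (n : ℕ) : ∫ x, birkhoffSum Z.shift g n x ∂ν = n * ∫ x, g x ∂ν := by
  have := hν.1
  have h : ∀ i : ℕ, ∫ x, g (Z.shift^[i] x) ∂ν = ∫ x, g x ∂ν := by
    intro i
    have hi := hν.2.iterate i
    rw [← integral_map hi.measurable.aemeasurable hg.aestronglyMeasurable, hi.map_eq]
  simp only [birkhoffSum]
  have hi : ∀ i : ℕ, Integrable (fun x => g (Z.shift^[i] x)) ν := fun i =>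
    integrable_of_continuous (hg.comp (Z.continuous_shift.iterate i))
  rw [integral_finsetSum _ fun i _ => hi i]
  simp [h]

lemma GibbsBounds.bounds {ν : Measure Z} {g : Z → ℝ} {P : ℝ} {C : ℕ → ℝ}
    (hC : ∀ n, 1 ≤ n → 0 < C n) (h : Z.GibbsBounds ν g P C) (x : Z) {n : ℕ} (hn : 1 ≤ n) :
    Real.exp (-(n * P) + birkhoffSum Z.shift g n x) ≤ C n * ν.real (Z.cylinder x n) ∧
      ν.real (Z.cylinder x n) ≤ C n * Real.exp (-(n * P) + birkhoffSum Z.shift g n x) := by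
  obtain ⟨h1, h2⟩ := h x n hn
  rw [← Real.exp_add] at h1 h2
  have he := Real.exp_pos (-(n * P) + birkhoffSum Z.shift g n x)
  rw [le_div_iff₀ he, div_mul_eq_mul_div, one_mul, div_le_iff₀ (hC n hn)] at h1
  rw [div_le_iff₀ he] at h2
  exact ⟨by linarith, h2⟩

/-- The pressure of a weak Gibbs measure does not exceed that of another one for the same
function. -/
lemma GibbsBounds.pressure_le {m ν : Measure Z} [IsProbabilityMeasure m] [IsProbabilityMeasure ν]
    {g : Z → ℝ} {P P' : ℝ} {C C' : ℕ → ℝ}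
    (hC : ∀ n, 1 ≤ n → 0 < C n) (hC' : ∀ n, 1 ≤ n → 0 < C' n)
    (hlim : Tendsto (fun n : ℕ => Real.log (C n) / n) atTop (𝓝 0))
    (hlim' : Tendsto (fun n : ℕ => Real.log (C' n) / n) atTop (𝓝 0))
    (h : Z.GibbsBounds m g P C) (h' : Z.GibbsBounds ν g P' C') : P ≤ P' := by
  have hkey : ∀ n : ℕ, 1 ≤ n → -(Real.log (C n) / n + Real.log (C' n) / n) ≤ P' - P := by
    intro n hn
    have hn' : (0 : ℝ) < n := by exact_mod_cast hn
    have hCn := hC n hn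
    have hCn' := hC' n hn
    -- K dominates m by ν on each cylinder of length n; summing over all words gives 1 ≤ K, which is
    -- sharpened to P ≤ P' as n grows.
    let K : ℝ := C n * C' n * Real.exp (n * (P' - P))
    have hle : ∀ v : Fin n → Fin k, m.real (Z.code n ⁻¹' {v}) ≤ K * ν.real (Z.code n ⁻¹' {v}) := by
      intro v
      rcases (Z.code n ⁻¹' {v}).eq_empty_or_nonempty with h0 | ⟨x, hx⟩
      · simp [h0]
      · rw [Set.mem_preimage, Set.mem_singleton_iff] at hx
        rw [← hx, ← cylinder_eq_preimage]
        obtain ⟨-, h1⟩ := h.bounds hC x hn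
        obtain ⟨h2, -⟩ := h'.bounds hC' x hn
        calc _ ≤ C n * Real.exp (-(n * P) + birkhoffSum Z.shift g n x) := h1
          _ = C n * (Real.exp (n * (P' - P)) *
              Real.exp (-(n * P') + birkhoffSum Z.shift g n x)) := by
            rw [← Real.exp_add]; congr 2; ring
          _ ≤ C n * (Real.exp (n * (P' - P)) * (C' n * ν.real (Z.cylinder x n))) := by gcongr
          _ = _ := by simp only [K]; ring
    have h1 : (1 : ℝ) ≤ K := by
      have h2 := Finset.sum_le_sum fun v (_ : v ∈ Finset.univ) => hle v
      rw [← Finset.mul_sum, sum_measureReal_fiber (Z.measurable_code n),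
        sum_measureReal_fiber (Z.measurable_code n), mul_one] at h2
      exact h2
    have h3 := Real.log_nonneg h1
    rw [Real.log_mul (mul_pos hCn hCn').ne' (Real.exp_pos _).ne', Real.log_exp,
      Real.log_mul hCn.ne' hCn'.ne'] at h3
    rw [← add_div, neg_le, le_div_iff₀ hn']
    linarith
  have h1 := (hlim.add hlim').neg
  rw [add_zero, neg_zero] at h1
  have h2 := le_of_tendsto h1 (by
    filter_upwards [eventually_ge_atTop 1] with n hn using hkey n hn)
  linarith

/-- An invariant weak Gibbs measure of nonnegative pressure for the logarithm of a family of
transition probabilities has these transition probabilities. -/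
lemma GibbsBounds.measureReal_pull {ν : Measure Z} (hν : Z.IsInvariant ν)
    {q : Fin k → Z → ℝ} (hq : Z.IsTransition q) {P : ℝ} {C : ℕ → ℝ} (hP : 0 ≤ P)
    (hC : ∀ n, 1 ≤ n → 0 < C n)
    (hlim : Tendsto (fun n : ℕ => Real.log (C n) / n) atTop (𝓝 0))
    (h : Z.GibbsBounds ν (fun x => Real.log (q (x.1 0) (Z.shift x))) P C)
    (i : Fin k) {E : Set Z} (hE : IsClopen E) :
    ν.real (Z.pull i E) = ∫ z in E, q i z ∂ν := by
  have := hν.1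
  refine measureReal_pull_of_maximal hν hq (fun q' hq' => ?_) i hE
  set g : Z → ℝ := fun x => Real.log (q (x.1 0) (Z.shift x)) with hg
  set I := ∫ x, g x ∂ν
  -- The upper Gibbs bound makes the entropy of words large, whereas any q' bounds it above by n(-I'
  -- + ε) plus a constant. Dividing by n leaves P + I' ≤ I + ε, and P ≥ 0.
  have hent : ∀ n : ℕ, 1 ≤ n → n * P - n * I - Real.log (C n) ≤
      partitionEntropy ν (Z.code n) := by
    intro n hn
    rw [partitionEntropy_eq_integral (Z.measurable_code n), le_neg]
    have hi := integrable_comp_of_finite (μ := ν) (Z.measurable_code n)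
      (fun w => Real.log (ν.real (Z.code n ⁻¹' {w})))
    have hs : Integrable (birkhoffSum Z.shift g n) ν :=
      integrable_of_continuous (continuous_birkhoffSum hq.continuous_log n)
    have hs' : Integrable (fun x => birkhoffSum Z.shift g n x + (Real.log (C n) - n * P)) ν :=
      hs.add (integrable_const _)
    have h1 := integral_mono hi hs' fun x => by
      obtain ⟨h2, h3⟩ := h.bounds hC x hn
      have hpos : 0 < ν.real (Z.cylinder x n) :=
        pos_of_mul_pos_right ((Real.exp_pos _).trans_le h2) (hC n hn).le
      have h4 := Real.log_le_log hpos h3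
      rw [Real.log_mul (hC n hn).ne' (Real.exp_pos _).ne', Real.log_exp] at h4
      rw [← cylinder_eq_preimage]
      linarith
    rw [integral_add hs (integrable_const _), integral_birkhoffSum hν hq.continuous_log] at h1
    simp only [integral_const, probReal_univ, smul_eq_mul, one_mul] at h1
    change _ ≤ n * I + _ at h1
    linarith
  set I' := ∫ x, Real.log (q' (x.1 0) (Z.shift x)) ∂ν
  refine le_of_forall_pos_le_add fun ε hε => ?_
  obtain ⟨D, hD⟩ := partitionEntropy_code_le hν hq' hε
  have hlim2 : Tendsto (fun n : ℕ => I + ε + (Real.log (C n) / n + D / n)) atTop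
      (𝓝 (I + ε + (0 + 0))) :=
    tendsto_const_nhds.add (hlim.add (tendsto_const_div_atTop_nhds_zero_nat D))
  rw [add_zero, add_zero] at hlim2
  refine ge_of_tendsto hlim2 ?_
  filter_upwards [eventually_ge_atTop 1] with n hn
  have hn' : (0 : ℝ) < n := by exact_mod_cast hn
  have h1 := hent n hn
  have h2 := hD n
  rw [← add_div, ← sub_le_iff_le_add', le_div_iff₀ hn']
  have h3 := mul_nonneg hn'.le hP
  linarith

end WeakGibbs

end Subshift

/-! ### Uniqueness from transitions that depend on the first zero. -/

namespace Subshift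

section Pulls

variable {k : ℕ} {Z : Subshift k}

lemma mem_pulls_replicate (a : ℕ) (i : Fin k) (E : Set Z) (z : Z) :
    z ∈ Z.pulls (List.replicate a i) E ↔ (∀ j < a, z.1 j = i) ∧ Z.shift^[a] z ∈ E := by
  induction a generalizing z with
  | zero => simp
  | succ a ih =>
    rw [List.replicate_succ, pulls_cons, pull, Set.mem_ofPred_eq, ih, Function.iterate_succ_apply,
      ← and_assoc]
    refine and_congr_left fun _ => ⟨?_, ?_⟩
    · rintro ⟨h0, h⟩ j hj
      cases j with
      | zero => exact h0
      | succ j => exact h j (by omega)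
    · intro h
      exact ⟨h 0 (by omega), fun j hj => h (j + 1) (by omega)⟩

lemma measureReal_pulls_append_le {ν : Measure Z} (hν : Z.IsInvariant ν) (w : List (Fin k))
    {E : Set Z} (hE : MeasurableSet E) : ν.real (Z.pulls w E) ≤ ν.real E := by
  have := hν.1
  have hm : ∀ w, MeasurableSet (Z.pulls w E) := by
    intro w
    induction w with
    | nil => exact hE
    | cons i w ih =>
      exact (Z.isClopen_symbol 0 i).isOpen.measurableSet.inter (Z.measurable_shift ih)
  induction w with
  | nil => exact le_rfl
  | cons i w ih =>
    refine le_trans ?_ ih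
    rw [← hν.2.measureReal_preimage (hm w).nullMeasurableSet]
    exact measureReal_mono fun x hx => hx.2

lemma measureReal_pulls_eq_sum {ν : Measure Z} [IsFiniteMeasure ν] (w : List (Fin k)) :
    ν.real (Z.pulls w Set.univ) = ∑ i, ν.real (Z.pulls (w ++ [i]) Set.univ) := by
  have hpull : ∀ i, Z.pull i Set.univ = {z | z.1 0 = i} := fun i => by ext z; simp [pull]
  have h : Z.pulls w Set.univ = ⋃ i, Z.pulls (w ++ [i]) Set.univ := by
    induction w with
    | nil =>
      ext z
      simp [hpull]
    | cons i w ih =>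
      rw [pulls_cons, ih]
      ext z
      simp [pull]
  rw [h, measureReal_iUnion_fintype]
  · intro i j hij
    refine Set.disjoint_left.mpr ?_
    clear h
    induction w with
    | nil =>
      intro z hz hz'
      exact hij (hz.1.symm.trans hz'.1)
    | cons a w ih => exact fun z hz hz' => ih hz.2 hz'.2
  · exact fun i => (Z.isClopen_pulls _ isClopen_univ).isOpen.measurableSet

end Pulls

section TwoSymbols

variable {Y : Subshift 2}

/-- The cylinder of the symbol `0`. -/
def zeroSet (Y : Subshift 2) : Set Y := {y | y.1 0 = 0}

lemma isClopen_zeroSet : IsClopen Y.zeroSet := Y.isClopen_symbol 0 0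

lemma pulls_zero_univ (w : List (Fin 2)) : Y.pulls (w ++ [0]) Set.univ = Y.pulls w Y.zeroSet := by
  rw [pulls_append]
  congr 1
  ext z
  simp [pull, zeroSet]

/-- Only the initial run of ones of the word w0 matters: a prepended 0 resets it, a prepended 1
lengthens it. -/
lemma exists_pulls_subset_replicate (w : List (Fin 2)) :
    ∃ a, Y.pulls w Y.zeroSet ⊆ Y.pulls (List.replicate a 1) Y.zeroSet := by
  induction w with
  | nil => exact ⟨0, subset_rfl⟩
  | cons i w ih =>
    obtain ⟨a, ha⟩ := ih
    fin_cases i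
    · exact ⟨0, fun z hz => hz.1⟩
    · exact ⟨a + 1, by
        rw [List.replicate_succ, pulls_cons, pulls_cons]
        exact Y.pull_mono _ ha⟩

/-- Invariant measures whose transition probabilities depend only on the first occurrence of `0`
have no mass at the fixed point `1 1 1 …`. -/
lemma tendsto_measureReal_replicate {ν : Measure Y} (hν : Y.IsInvariant ν)
    {q : Fin 2 → Y → ℝ} (hq : Y.IsTransition q) {δ : ℝ} (hδ0 : 0 < δ) (hδ1 : δ < 1)
    (hδ : ∀ z : Y, z.1 0 = 1 → δ ≤ q 0 z)
    (hpull : ∀ i E, IsClopen E → ν.real (Y.pull i E) = ∫ z in E, q i z ∂ν) :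
    Tendsto (fun n => ν.real (Y.pulls (List.replicate n 1) Set.univ)) atTop (𝓝 0) := by
  have := hν.1
  set T : ℕ → ℝ := fun n => ν.real (Y.pulls (List.replicate n 1) Set.univ) with hT
  have hclopen : ∀ n, IsClopen (Y.pulls (List.replicate n 1) Set.univ) := fun n =>
    Y.isClopen_pulls _ isClopen_univ
  -- At least the fraction δ of the mass of 1^{n+1} is preceded by 0.
  have hstep : ∀ n, T (n + 2) ≤ (1 - δ) * T (n + 1) := by
    intro n
    have h1 := measureReal_shift_preimage ν (hclopen (n + 1)).isOpen.measurableSet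
    rw [hν.2.measureReal_preimage (hclopen (n + 1)).isOpen.measurableSet.nullMeasurableSet,
      Fin.sum_univ_two, hpull 0 _ (hclopen (n + 1)), ← pulls_cons, ← List.replicate_succ] at h1
    have h2 : ∫ z in Y.pulls (List.replicate (n + 1) 1) Set.univ, δ ∂ν ≤
        ∫ z in Y.pulls (List.replicate (n + 1) 1) Set.univ, q 0 z ∂ν := by
      refine setIntegral_mono_on (integrable_const _).integrableOn
        (integrable_of_continuous (hq.cont 0)).integrableOn
        (hclopen (n + 1)).isOpen.measurableSet fun z hz => ?_
      exact hδ z (((mem_pulls_replicate _ _ _ _).mp hz).1 0 (by omega))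
    rw [setIntegral_const, smul_eq_mul] at h2
    simp only [hT]
    linarith
  have hbound : ∀ n, T (n + 1) ≤ (1 - δ) ^ n * T 1 := by
    intro n
    induction n with
    | zero => simp
    | succ n ih =>
      calc _ ≤ (1 - δ) * T (n + 1) := hstep n
        _ ≤ (1 - δ) * ((1 - δ) ^ n * T 1) := mul_le_mul_of_nonneg_left ih (by linarith)
        _ = _ := by ring
  rw [← tendsto_add_atTop_iff_nat 1]
  have h1 : Tendsto (fun n => (1 - δ) ^ n * T 1) atTop (𝓝 (0 * T 1)) :=
    (tendsto_pow_atTop_nhds_zero_of_lt_one (by linarith) (by linarith)).mul_const _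
  rw [zero_mul] at h1
  exact squeeze_zero (fun n => measureReal_nonneg) hbound h1

/-- Uniqueness of invariant measures whose transition probabilities depend only on the first
occurrence of `0`. -/
lemma eq_of_transitions {ν m : Measure Y} (hν : Y.IsInvariant ν) (hm : Y.IsInvariant m)
    {q : Fin 2 → Y → ℝ} (hq : Y.IsTransition q) {δ : ℝ} (hδ0 : 0 < δ) (hδ1 : δ < 1)
    (hδ : ∀ z : Y, z.1 0 = 1 → δ ≤ q 0 z)
    (hconst : ∀ i a, ∃ c, ∀ z ∈ Y.pulls (List.replicate a 1) Y.zeroSet, q i z = c)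
    (hpν : ∀ i E, IsClopen E → ν.real (Y.pull i E) = ∫ z in E, q i z ∂ν)
    (hpm : ∀ i E, IsClopen E → m.real (Y.pull i E) = ∫ z in E, q i z ∂m)
    (hm0 : 0 < m.real Y.zeroSet) : ν = m := by
  have := hν.1
  have := hm.1
  -- Both measures multiply by the same constant whenever a symbol is prepended, since q is constant
  -- on sets with a fixed initial run.
  have hzero : ∀ w, ν.real (Y.pulls w Y.zeroSet) * m.real Y.zeroSet =
      m.real (Y.pulls w Y.zeroSet) * ν.real Y.zeroSet := by
    intro w
    induction w with
    | nil => exact mul_comm _ _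
    | cons i w ih =>
      obtain ⟨a, ha⟩ := exists_pulls_subset_replicate (Y := Y) w
      obtain ⟨c, hc⟩ := hconst i a
      have hE := Y.isClopen_pulls w isClopen_zeroSet
      rw [pulls_cons, hpν i _ hE, hpm i _ hE,
        setIntegral_congr_fun hE.isOpen.measurableSet fun z hz => hc z (ha hz),
        setIntegral_congr_fun hE.isOpen.measurableSet fun z hz => hc z (ha hz),
        setIntegral_const, setIntegral_const, smul_eq_mul, smul_eq_mul]
      linear_combination c * ih
  -- The cylinder of w is split by the next symbol K times. The branches ending in 0 cancel by
  -- `hzero`, leaving w 1^K, whose mass vanishes in the limit.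
  have happ : ∀ (K : ℕ) (w : List (Fin 2)),
      ν.real (Y.pulls w Set.univ) * m.real Y.zeroSet -
        m.real (Y.pulls w Set.univ) * ν.real Y.zeroSet =
      ν.real (Y.pulls (w ++ List.replicate K 1) Set.univ) * m.real Y.zeroSet -
        m.real (Y.pulls (w ++ List.replicate K 1) Set.univ) * ν.real Y.zeroSet := by
    intro K
    induction K with
    | zero => simp
    | succ K ih =>
      intro w
      rw [measureReal_pulls_eq_sum (ν := ν) w, measureReal_pulls_eq_sum (ν := m) w,
        Fin.sum_univ_two, Fin.sum_univ_two, pulls_zero_univ]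
      have h1 := ih (w ++ [1])
      have h2 := hzero w
      rw [List.append_assoc, List.singleton_append, ← List.replicate_succ] at h1
      linear_combination h1 + h2
  have hlim : ∀ (η : Measure Y), Y.IsInvariant η →
      (∀ i E, IsClopen E → η.real (Y.pull i E) = ∫ z in E, q i z ∂η) → ∀ w,
      Tendsto (fun K => η.real (Y.pulls (w ++ List.replicate K 1) Set.univ)) atTop (𝓝 0) := by
    intro η hη hp w
    refine squeeze_zero (fun _ => measureReal_nonneg) (fun K => ?_)
      (tendsto_measureReal_replicate hη hq hδ0 hδ1 hδ hp)
    rw [pulls_append]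
    exact measureReal_pulls_append_le hη w
      (Y.isClopen_pulls _ isClopen_univ).isOpen.measurableSet
  have heq : ∀ w, ν.real (Y.pulls w Set.univ) * m.real Y.zeroSet =
      m.real (Y.pulls w Set.univ) * ν.real Y.zeroSet := by
    intro w
    have h1 := ((hlim ν hν hpν w).mul_const (m.real Y.zeroSet)).sub
      ((hlim m hm hpm w).mul_const (ν.real Y.zeroSet))
    rw [zero_mul, zero_mul, sub_zero] at h1
    have h2 : Tendsto (fun _ : ℕ => ν.real (Y.pulls w Set.univ) * m.real Y.zeroSet -
        m.real (Y.pulls w Set.univ) * ν.real Y.zeroSet) atTop (𝓝 0) :=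
      h1.congr fun K => (happ K w).symm
    exact sub_eq_zero.mp (tendsto_const_nhds_iff.mp h2)
  -- The empty word fixes the factor of proportionality, both total masses being 1.
  have h0 : m.real Y.zeroSet = ν.real Y.zeroSet := by
    have := heq []
    simpa using this
  refine Y.measure_ext_pulls ν m fun w => ?_
  rw [← measureReal_eq_measureReal_iff]
  have := heq w
  rw [← h0] at this
  exact mul_right_cancel₀ hm0.ne' this

end TwoSymbols

end Subshift

/-! ### Functions of the position of the first zero. -/

namespace Subshift

section FirstZero

variable {Y : Subshift 2}

open Classical in
/-- The function with value `r a` at the points where `0` occurs first at position `a`, and with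
value `θ` at the fixed point `1 1 1 …`. -/
noncomputable def firstZeroFun (Y : Subshift 2) (r : ℕ → ℝ) (θ : ℝ) (y : Y) : ℝ :=
  if h : ∃ n, y.1 n = 0 then r (Nat.find h) else θ

lemma eq_one_of_ne_zero {i : Fin 2} (h : i ≠ 0) : i = 1 := by omega

lemma firstZeroFun_of_mem {r : ℕ → ℝ} {θ : ℝ} {a : ℕ} {y : Y}
    (hy : y ∈ Y.pulls (List.replicate a 1) Y.zeroSet) : firstZeroFun Y r θ y = r a := by
  classical
  rw [mem_pulls_replicate] at hy
  have h0 : y.1 a = 0 := by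
    have := hy.2
    rwa [zeroSet, Set.mem_ofPred_eq, iterate_shift_coord, add_zero] at this
  have h : ∃ n, y.1 n = 0 := ⟨a, h0⟩
  rw [firstZeroFun, dif_pos h, (Nat.find_eq_iff h).mpr ⟨h0, fun n hn => ?_⟩]
  rw [hy.1 n hn]
  decide

lemma firstZeroFun_of_forall {r : ℕ → ℝ} {θ : ℝ} {y : Y} (hy : ∀ n, y.1 n = 1) :
    firstZeroFun Y r θ y = θ := by
  rw [firstZeroFun, dif_neg]
  rintro ⟨n, hn⟩
  rw [hy n] at hn
  exact absurd hn (by decide)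

lemma exists_mem_pulls_replicate {y : Y} {n : ℕ} (h : y.1 n = 0) :
    ∃ a ≤ n, y ∈ Y.pulls (List.replicate a 1) Y.zeroSet := by
  classical
  have h' : ∃ n, y.1 n = 0 := ⟨n, h⟩
  refine ⟨Nat.find h', Nat.find_min' h' h, (mem_pulls_replicate _ _ _ _).mpr ⟨fun j hj => ?_, ?_⟩⟩
  · exact eq_one_of_ne_zero (Nat.find_min h' hj)
  · rw [zeroSet, Set.mem_ofPred_eq, iterate_shift_coord, add_zero]
    exact Nat.find_spec h'

lemma firstZeroFun_cases (y : Y) :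
    (∃ a, y ∈ Y.pulls (List.replicate a 1) Y.zeroSet) ∨ ∀ n, y.1 n = 1 := by
  by_cases h : ∃ n, y.1 n = 0
  · obtain ⟨n, hn⟩ := h
    obtain ⟨a, -, ha⟩ := exists_mem_pulls_replicate hn
    exact Or.inl ⟨a, ha⟩
  · push Not at h
    exact Or.inr fun n => eq_one_of_ne_zero (h n)

/-- The function is locally constant away from 1^∞, and agreeing with 1^∞ on N symbols forces the
first zero to position N or later. -/
lemma continuous_firstZeroFun {r : ℕ → ℝ} {θ : ℝ} (hr : Tendsto r atTop (𝓝 θ)) :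
    Continuous (firstZeroFun Y r θ) := by
  refine continuous_iff_continuousAt.mpr fun y => ?_
  rcases firstZeroFun_cases y with ⟨a, ha⟩ | hy
  · have hnb : Y.pulls (List.replicate a 1) Y.zeroSet ∈ 𝓝 y :=
      (Y.isClopen_pulls _ isClopen_zeroSet).isOpen.mem_nhds ha
    refine ContinuousAt.congr (f := fun _ => r a) continuousAt_const ?_
    filter_upwards [hnb] with z hz
    rw [firstZeroFun_of_mem hz]
  · rw [ContinuousAt, firstZeroFun_of_forall hy, Metric.tendsto_nhds]
    intro ε hε
    obtain ⟨N, hN⟩ := Metric.tendsto_atTop.mp hr ε hε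
    filter_upwards [(Y.isClopen_cylinder y N).isOpen.mem_nhds (Y.self_mem_cylinder y N)] with z hz
    rcases firstZeroFun_cases z with ⟨a, ha⟩ | hz'
    · rw [firstZeroFun_of_mem ha]
      refine hN a ?_
      by_contra! hlt
      have h1 := ((mem_pulls_replicate _ _ _ _).mp ha).2
      rw [zeroSet, Set.mem_ofPred_eq, iterate_shift_coord, add_zero, hz a hlt, hy] at h1
      exact absurd h1 (by decide)
    · rw [firstZeroFun_of_forall hz', dist_self]
      exact hε

end FirstZero

section Points

variable {B : Matrix (Fin 2) (Fin 2) ℕ}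

/-- All transitions except possibly the one from `0` to itself are allowed. -/
structure AllowsRuns (B : Matrix (Fin 2) (Fin 2) ℕ) : Prop where
  zero_one : B 0 1 = 1
  one_zero : B 1 0 = 1
  one_one : B 1 1 = 1

lemma AllowsRuns.eq_one (h : AllowsRuns B) {i j : Fin 2} (hij : i = 1 ∨ j = 1) : B i j = 1 := by
  have h1 := h.zero_one
  have h2 := h.one_zero
  have h3 := h.one_one
  fin_cases i <;> fin_cases j <;> simp_all

/-- The point `1 … 1 0 1 1 …`. -/
def runPoint (h : AllowsRuns B) (a : ℕ) : ofMatrix B :=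
  ⟨fun n => if n = a then 0 else 1, fun n => h.eq_one (by
    by_cases hn : n = a
    · exact Or.inr (if_neg (by omega))
    · exact Or.inl (if_neg hn))⟩

lemma cylinder_runPoint (h : AllowsRuns B) (a : ℕ) :
    (ofMatrix B).cylinder (runPoint h a) (a + 1) =
      (ofMatrix B).pulls (List.replicate a 1) (ofMatrix B).zeroSet := by
  ext z
  rw [mem_pulls_replicate, zeroSet, Set.mem_ofPred_eq, iterate_shift_coord, add_zero]
  constructor
  · intro hz
    refine ⟨fun j hj => ?_, ?_⟩
    · rw [hz j (by omega)]
      simp [runPoint, hj.ne]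
    · rw [hz a (by omega)]
      simp [runPoint]
  · rintro ⟨h1, h2⟩ j hj
    rcases Nat.lt_succ_iff_lt_or_eq.mp hj with h3 | rfl
    · rw [h1 j h3]
      simp [runPoint, h3.ne]
    · rw [h2]
      simp [runPoint]

/-- As n < p, the new zero has ones on both sides, so the possibly forbidden word 00 does not arise.
-/
lemma update_mem (h : AllowsRuns B) (y : ofMatrix B) {n : ℕ} (hy : ∀ i ≥ n, y.1 i = 1)
    {p : ℕ} (hp : n < p) : Function.update y.1 p 0 ∈ (ofMatrix B).carrier := by
  intro i
  simp only [Function.update_apply]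
  by_cases h1 : n ≤ i
  · refine h.eq_one ?_
    rw [hy i h1, hy (i + 1) (by omega)]
    by_cases h2 : i = p
    · exact Or.inr (if_neg (by omega))
    · exact Or.inl (if_neg h2)
  · rw [if_neg (by omega), if_neg (by omega)]
    exact y.2 i

end Points

end Subshift

/-! ### Gibbs property of quasi-Bernoulli measures that renew at 0. -/

namespace Subshift

/-- The two-symbol family of transition probabilities with `q 1 = Q`. -/
def pairFun {Y : Subshift 2} (Q : Y → ℝ) (i : Fin 2) (z : Y) : ℝ := if i = 0 then 1 - Q z else Q z

section

variable {B : Matrix (Fin 2) (Fin 2) ℕ} {m : Measure (ofMatrix B)} {D : ℕ → ℝ}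

/-- The mass of the points in which `0` occurs first at position `a`. -/
noncomputable def runMass (m : Measure (ofMatrix B)) (a : ℕ) : ℝ :=
  m.real ((ofMatrix B).pulls (List.replicate a 1) (ofMatrix B).zeroSet)

lemma runMass_pos (h : AllowsRuns B) (hpos : ∀ y n, 1 ≤ n → 0 < m.real ((ofMatrix B).cylinder y n))
    (a : ℕ) : 0 < runMass m a := by
  rw [runMass, ← cylinder_runPoint h]
  exact hpos _ _ (by omega)

lemma isClopen_run (a : ℕ) :
    IsClopen ((ofMatrix B).pulls (List.replicate a 1) (ofMatrix B).zeroSet) :=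
  (ofMatrix B).isClopen_pulls _ isClopen_zeroSet

lemma measureReal_pull_zero_run (hm : (ofMatrix B).IsInvariant m) (a : ℕ) :
    m.real ((ofMatrix B).pull 0 ((ofMatrix B).pulls (List.replicate a 1) (ofMatrix B).zeroSet)) =
      runMass m a - runMass m (a + 1) := by
  have := hm.1
  have h1 := measureReal_shift_preimage m (isClopen_run (B := B) a).isOpen.measurableSet
  rw [hm.2.measureReal_preimage (isClopen_run a).isOpen.measurableSet.nullMeasurableSet,
    Fin.sum_univ_two] at h1
  simp only [runMass, List.replicate_succ, pulls_cons]
  linarith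

lemma cylinder_one {k : ℕ} {Z : Subshift k} (z : Z) : Z.cylinder z 1 = {x | x.1 0 = z.1 0} := by
  ext x; simp [cylinder]

/-- The word 1·1^a 0, split after its first symbol, bounds the ratios of the run masses away from 0.
-/
lemma QuasiBernoulli.le_runMass_succ (h : AllowsRuns B) (hqb : (ofMatrix B).QuasiBernoulli m D)
    (a : ℕ) : m.real {z : ofMatrix B | z.1 0 = 1} * runMass m a ≤ D 1 * runMass m (a + 1) := by
  have h1 := (hqb (runPoint h (a + 1)) 1 (a + 1) le_rfl (by omega)).2
  have h2 : (ofMatrix B).shift^[1] (runPoint h (a + 1)) = runPoint h a := by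
    apply Subtype.ext
    funext i
    simp [runPoint, shift]
  rw [h2, cylinder_runPoint, add_comm 1, cylinder_runPoint, cylinder_one] at h1
  exact h1

/-- The word 0·1^{a+1} 0, split after its first symbol, bounds the ratios away from 1. The run is
nonempty because 00 may be forbidden. -/
lemma QuasiBernoulli.le_runMass_sub (h : AllowsRuns B) (hm : (ofMatrix B).IsInvariant m)
    (hqb : (ofMatrix B).QuasiBernoulli m D) (a : ℕ) :
    m.real (ofMatrix B).zeroSet * runMass m (a + 1) ≤
      D 1 * (runMass m (a + 1) - runMass m (a + 2)) := by
  have h01 : B 0 ((runPoint h (a + 1)).1 0) = 1 := h.zero_one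
  have h1 := (hqb (consPoint (runPoint h (a + 1)) 0 h01) 1 (a + 2) le_rfl (by omega)).2
  rw [Function.iterate_one, shift_consPoint, cylinder_runPoint, cylinder_one, add_comm 1,
    ← pull_cylinder_of_transition, cylinder_runPoint,
    measureReal_pull_zero_run hm] at h1
  exact h1

/-- The one-step comparison between the transition probabilities and the measure of cylinders. -/
lemma pairFun_mul_measureReal_cylinder (hm : (ofMatrix B).IsInvariant m)
    (hpos : ∀ a, 0 < runMass m a) {θ : ℝ}
    (hren : ∀ w E, IsClopen E → E ⊆ (ofMatrix B).zeroSet →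
      m.real ((ofMatrix B).pulls w E) * m.real (ofMatrix B).zeroSet =
        m.real ((ofMatrix B).pulls w (ofMatrix B).zeroSet) * m.real E)
    (y : ofMatrix B) {p : ℕ} (hy : y.1 (p + 1) = 0) :
    pairFun (firstZeroFun (ofMatrix B) (fun a => runMass m (a + 1) / runMass m a) θ)
        (y.1 0) ((ofMatrix B).shift y) *
      m.real ((ofMatrix B).cylinder ((ofMatrix B).shift y) (p + 1)) =
      m.real ((ofMatrix B).cylinder y (p + 2)) := by
  set z := (ofMatrix B).shift y
  have hz : z.1 p = 0 := hy
  obtain ⟨a, hap, ha⟩ := exists_mem_pulls_replicate hz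
  have hzmem := (mem_pulls_replicate _ _ _ _).mp ha
  -- The part of the cylinder from its first zero on. The renewal property cancels E, so only the
  -- initial run enters the quotient.
  let E := (ofMatrix B).cylinder ((ofMatrix B).shift^[a] z) (p + 1 - a)
  have hE : IsClopen E := (ofMatrix B).isClopen_cylinder _ _
  have hE0 : E ⊆ (ofMatrix B).zeroSet := by
    intro x hx
    have h1 := hx 0 (by omega)
    rw [zeroSet, Set.mem_ofPred_eq, h1]
    exact hzmem.2
  have hcyl : (ofMatrix B).cylinder z (p + 1) = (ofMatrix B).pulls (List.replicate a 1) E := by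
    ext x
    rw [mem_pulls_replicate]
    constructor
    · intro hx
      refine ⟨fun j hj => (hx j (by omega)).trans (hzmem.1 j hj), fun j hj => ?_⟩
      rw [iterate_shift_coord, iterate_shift_coord]
      exact hx _ (by omega)
    · rintro ⟨h1, h2⟩ j hj
      by_cases hja : j < a
      · rw [h1 j hja, hzmem.1 j hja]
      · have h3 := h2 (j - a) (by omega)
        rw [iterate_shift_coord, iterate_shift_coord, Nat.add_sub_cancel' (by omega)] at h3
        exact h3
  have hcyl2 : (ofMatrix B).cylinder y (p + 2) =
      (ofMatrix B).pulls (y.1 0 :: List.replicate a 1) E := by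
    rw [cylinder_succ, pulls_cons, ← hcyl]
  have h1 := hren (List.replicate a 1) E hE hE0
  have h2 := hren (y.1 0 :: List.replicate a 1) E hE hE0
  have hua := hpos a
  have hq : pairFun (firstZeroFun (ofMatrix B) (fun a => runMass m (a + 1) / runMass m a) θ)
      (y.1 0) z * runMass m a =
      m.real ((ofMatrix B).pulls (y.1 0 :: List.replicate a 1) (ofMatrix B).zeroSet) := by
    rw [pairFun, firstZeroFun_of_mem ha]
    split_ifs with h0
    · rw [h0, pulls_cons, measureReal_pull_zero_run hm]
      field_simp
    · rw [eq_one_of_ne_zero h0, ← List.replicate_succ]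
      rw [div_mul_cancel₀ _ hua.ne']
      rfl
  have hm0 : 0 < m.real (ofMatrix B).zeroSet := hpos 0
  rw [hcyl, hcyl2]
  refine mul_right_cancel₀ hm0.ne' ?_
  rw [mul_assoc, h1, h2, ← hq]
  simp only [runMass]
  ring

/-- A quasi-Bernoulli measure on a two-symbol shift that renews at the symbol `0` is the unique
weak Gibbs measure of a continuous function, provided the masses of the runs have convergent
ratios. -/
theorem exists_gibbsBounds (h : AllowsRuns B) (hm : (ofMatrix B).IsInvariant m)
    (hpos : ∀ y n, 1 ≤ n → 0 < m.real ((ofMatrix B).cylinder y n))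
    (hren : ∀ w E, IsClopen E → E ⊆ (ofMatrix B).zeroSet →
      m.real ((ofMatrix B).pulls w E) * m.real (ofMatrix B).zeroSet =
        m.real ((ofMatrix B).pulls w (ofMatrix B).zeroSet) * m.real E)
    (hD : ∀ n, 1 ≤ n → 0 < D n) (hqb : (ofMatrix B).QuasiBernoulli m D)
    {θ : ℝ} (hlim : Tendsto (fun a => runMass m (a + 1) / runMass m a) atTop (𝓝 θ)) :
    ∃ g : C(ofMatrix B, ℝ), (ofMatrix B).GibbsBounds m g 0 D ∧
      (Tendsto (fun n : ℕ => Real.log (D n) / n) atTop (𝓝 0) →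
        ∀ ν, (ofMatrix B).IsInvariantWeakGibbs ν g → ν = m) := by
  have := hm.1
  have hu := runMass_pos h hpos
  have hD1 := hD 1 le_rfl
  have hm0 : 0 < m.real (ofMatrix B).zeroSet := hu 0
  have hm1 : 0 < m.real {z : ofMatrix B | z.1 0 = 1} := by
    have h1 := hpos (runPoint h 1) 1 le_rfl
    rw [cylinder_one] at h1
    exact h1
  set r : ℕ → ℝ := fun a => runMass m (a + 1) / runMass m a with hr
  let δ₁ := m.real {z : ofMatrix B | z.1 0 = 1} / D 1
  let δ₀ := m.real (ofMatrix B).zeroSet / D 1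
  have hδ₁ : 0 < δ₁ := div_pos hm1 hD1
  have hδ₀ : 0 < δ₀ := div_pos hm0 hD1
  have hr1 : ∀ a, δ₁ ≤ r a := by
    intro a
    simp only [δ₁, hr]
    rw [div_le_div_iff₀ hD1 (hu a), mul_comm (runMass m (a + 1))]
    exact hqb.le_runMass_succ h a
  -- Index 0 is left out: r 0 = 1 when 00 is forbidden.
  have hr0 : ∀ a, r (a + 1) ≤ 1 - δ₀ := by
    intro a
    have h1 := hqb.le_runMass_sub h hm a
    have h2 : 1 - r (a + 1) = (runMass m (a + 1) - runMass m (a + 2)) / runMass m (a + 1) := by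
      simp only [hr]
      rw [sub_div, div_self (hu (a + 1)).ne']
    have h3 : δ₀ ≤ 1 - r (a + 1) := by
      rw [h2]
      simp only [δ₀]
      rw [div_le_div_iff₀ hD1 (hu (a + 1)), mul_comm _ (D 1)]
      exact h1
    linarith
  have hθ1 : δ₁ ≤ θ := ge_of_tendsto' hlim hr1
  have hθ0 : θ ≤ 1 - δ₀ := le_of_tendsto' ((tendsto_add_atTop_iff_nat 1).mpr hlim) hr0
  set Q := firstZeroFun (ofMatrix B) r θ with hQ
  have hQ1 : ∀ z, δ₁ ≤ Q z := by
    intro z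
    rcases firstZeroFun_cases z with ⟨a, ha⟩ | hz
    · rw [hQ, firstZeroFun_of_mem ha]
      exact hr1 a
    · rw [hQ, firstZeroFun_of_forall hz]
      exact hθ1
  have hQ0 : ∀ z : ofMatrix B, z.1 0 = 1 → δ₀ ≤ 1 - Q z := by
    intro z hz0
    rcases firstZeroFun_cases z with ⟨a, ha⟩ | hz
    · rw [hQ, firstZeroFun_of_mem ha]
      cases a with
      | zero =>
        have h1 : z.1 0 = 0 := ha
        rw [hz0] at h1
        exact absurd h1 (by decide)
      | succ a => linarith [hr0 a]
    · rw [hQ, firstZeroFun_of_forall hz]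
      linarith
  -- Positivity is only asked along points of the shift, so x itself supplies a cylinder of positive
  -- mass, even if its shift starts with 0.
  have hQpos : ∀ x : ofMatrix B, x.1 0 = 0 → 0 < 1 - Q ((ofMatrix B).shift x) := by
    intro x hx
    rcases firstZeroFun_cases ((ofMatrix B).shift x) with ⟨a, ha⟩ | hz
    · rw [hQ, firstZeroFun_of_mem ha]
      have h1 : (ofMatrix B).cylinder x (a + 2) ⊆ (ofMatrix B).pull 0
          ((ofMatrix B).pulls (List.replicate a 1) (ofMatrix B).zeroSet) := by
        rw [cylinder_succ, hx]
        refine (ofMatrix B).pull_mono 0 fun y hy => ?_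
        rw [mem_pulls_replicate, zeroSet, Set.mem_ofPred_eq, iterate_shift_coord, add_zero] at ha ⊢
        refine ⟨fun j hj => (hy j (by omega)).trans (ha.1 j hj), ?_⟩
        rw [hy a (by omega)]
        exact ha.2
      have h2 := (hpos x (a + 2) (by omega)).trans_le (measureReal_mono h1)
      rw [measureReal_pull_zero_run hm] at h2
      rw [sub_pos, hr]
      simp only
      rw [div_lt_one (hu a)]
      linarith
    · exact hδ₀.trans_le (hQ0 _ (hz 0))
  have hQle : ∀ z, Q z ≤ 1 := by
    intro z
    rcases firstZeroFun_cases z with ⟨a, ha⟩ | hz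
    · rw [hQ, firstZeroFun_of_mem ha, hr]
      simp only
      rw [div_le_one (hu a)]
      have h1 : 0 ≤ runMass m a - runMass m (a + 1) := by
        rw [← measureReal_pull_zero_run hm]
        exact measureReal_nonneg
      linarith
    · linarith [hQ0 z (hz 0)]
  have hQc : Continuous Q := continuous_firstZeroFun hlim
  have hq : (ofMatrix B).IsTransition (pairFun Q) :=
    { cont := fun i => by
        unfold pairFun
        split_ifs
        · exact continuous_const.sub hQc
        · exact hQc
      nonneg := fun i z => by
        rw [pairFun]
        split_ifs
        · linarith [hQle z]
        · linarith [hQ1 z]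
      sum_eq_one := fun z => by simp [pairFun]
      pos := fun x => by
        rw [pairFun]
        split_ifs with hx
        · exact hQpos x hx
        · linarith [hQ1 ((ofMatrix B).shift x)] }
  let g : C(ofMatrix B, ℝ) :=
    ⟨fun y => Real.log (pairFun Q (y.1 0) ((ofMatrix B).shift y)), hq.continuous_log⟩
  -- The one-step identity telescopes without error because every cylinder involved ends in 0.
  have hstep : ∀ (n p : ℕ) (y : ofMatrix B), y.1 (n + p) = 0 →
      Real.exp (birkhoffSum (ofMatrix B).shift g n y) *
        m.real ((ofMatrix B).cylinder ((ofMatrix B).shift^[n] y) (p + 1)) =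
      m.real ((ofMatrix B).cylinder y (n + (p + 1))) := by
    intro n p
    induction n with
    | zero => intro y _; simp
    | succ n ih =>
      intro y hy
      have h1 : ((ofMatrix B).shift y).1 (n + p) = 0 := by
        rw [shift_coord, show n + p + 1 = n + 1 + p by omega]
        exact hy
      rw [birkhoffSum_succ', Real.exp_add, Function.iterate_succ_apply, mul_assoc, ih _ h1]
      have h2 : Real.exp (g y) = pairFun Q (y.1 0) ((ofMatrix B).shift y) :=
        Real.exp_log (hq.pos y)
      rw [h2]
      have h3 : y.1 (n + p + 1) = 0 := h1
      have h4 := pairFun_mul_measureReal_cylinder (θ := θ) hm hu hren y h3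
      rw [show n + 1 + (p + 1) = n + p + 2 by omega, ← h4]
      rfl
  have hbounds : ∀ (y : ofMatrix B) (n : ℕ), 1 ≤ n →
      Real.exp (birkhoffSum (ofMatrix B).shift g n y) ≤
        D n * m.real ((ofMatrix B).cylinder y n) ∧
      m.real ((ofMatrix B).cylinder y n) ≤
        D n * Real.exp (birkhoffSum (ofMatrix B).shift g n y) := by
    intro y n hn
    have hzero : ∀ (y : ofMatrix B) (p : ℕ), y.1 (n + p) = 0 →
        Real.exp (birkhoffSum (ofMatrix B).shift g n y) ≤
          D n * m.real ((ofMatrix B).cylinder y n) ∧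
        m.real ((ofMatrix B).cylinder y n) ≤
          D n * Real.exp (birkhoffSum (ofMatrix B).shift g n y) := by
      intro y p hp
      have h1 := hstep n p y hp
      obtain ⟨h2, h3⟩ := hqb y n (p + 1) hn (by omega)
      have h4 := hpos ((ofMatrix B).shift^[n] y) (p + 1) (by omega)
      rw [← h1, ← mul_assoc] at h2 h3
      exact ⟨le_of_mul_le_mul_right h2 h4, le_of_mul_le_mul_right h3 h4⟩
    by_cases hex : ∃ p, y.1 (n + p) = 0
    · obtain ⟨p, hp⟩ := hex
      exact hzero y p hp
    · push Not at hex
      have hy1 : ∀ i ≥ n, y.1 i = 1 := by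
        intro i hi
        obtain ⟨p, rfl⟩ := Nat.exists_eq_add_of_le hi
        exact eq_one_of_ne_zero (hex p)
      -- A point that is constantly 1 from n on is approximated by points with one later zero. They
      -- share its n-cylinder, so the bounds pass to the limit by continuity of g.
      let yM : ℕ → ofMatrix B := fun M =>
        ⟨Function.update y.1 (n + (M + 1)) 0, update_mem h y hy1 (by omega)⟩
      have hyM : Tendsto yM atTop (𝓝 y) := by
        rw [tendsto_subtype_rng, tendsto_pi_nhds]
        intro i
        refine tendsto_const_nhds.congr' ?_
        filter_upwards [eventually_ge_atTop i] with M hM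
        simp only [yM]
        rw [Function.update_of_ne (by omega)]
      have hcyl : ∀ M, (ofMatrix B).cylinder (yM M) n = (ofMatrix B).cylinder y n := by
        intro M
        refine (ofMatrix B).cylinder_eq_of_mem fun i hi => ?_
        simp only [yM]
        rw [Function.update_of_ne (by omega)]
      have hS : Tendsto (fun M => Real.exp (birkhoffSum (ofMatrix B).shift g n (yM M))) atTop
          (𝓝 (Real.exp (birkhoffSum (ofMatrix B).shift g n y))) :=
        ((Real.continuous_exp.comp (continuous_birkhoffSum g.continuous n)).tendsto y).comp hyM
      have hb : ∀ M, _ ∧ _ := fun M => hzero (yM M) (M + 1) (by simp [yM])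
      simp only [hcyl] at hb
      exact ⟨le_of_tendsto' hS fun M => (hb M).1, ge_of_tendsto' (hS.const_mul (D n))
        fun M => (hb M).2⟩
  have hGibbs : (ofMatrix B).GibbsBounds m g 0 D := by
    intro y n hn
    obtain ⟨h1, h2⟩ := hbounds y n hn
    have he := Real.exp_pos (birkhoffSum (ofMatrix B).shift g n y)
    rw [mul_zero, neg_zero, Real.exp_zero, one_mul, le_div_iff₀ he, div_le_iff₀ he,
      div_mul_eq_mul_div, one_mul, div_le_iff₀ (hD n hn)]
    exact ⟨by linarith, h2⟩
  refine ⟨g, hGibbs, fun hDlim ν hν => ?_⟩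
  obtain ⟨hνi, P, C, hC, hClim, hνG⟩ := hν
  have := hνi.1
  -- The measure m has pressure 0 for g, so the pressure of ν is nonnegative, as the entropy
  -- argument requires.
  have hP := GibbsBounds.pressure_le hD hC hDlim hClim hGibbs hνG
  have hδ1 : δ₀ < 1 := by linarith
  refine eq_of_transitions hνi hm hq hδ₀ hδ1 (fun z hz => ?_) (fun i a => ?_)
    (fun i E hE => GibbsBounds.measureReal_pull hνi hq hP hC hClim hνG i hE)
    (fun i E hE => GibbsBounds.measureReal_pull hm hq le_rfl hD hDlim hGibbs i hE) hm0
  · rw [pairFun, if_pos rfl]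
    exact hQ0 z hz
  · refine ⟨if i = 0 then 1 - r a else r a, fun z hz => ?_⟩
    rw [pairFun, hQ, firstZeroFun_of_mem hz]

end

end Subshift

/-! ### Ratios in second-order recurrences. -/

section Recurrence

lemma tendsto_ratio_of_geometric {s : ℕ → ℝ} (hs : ∀ n, 0 < s n) {t : ℝ}
    (h : ∀ n, s (n + 2) = t * s (n + 1)) : Tendsto (fun n => s (n + 1) / s n) atTop (𝓝 t) := by
  rw [← tendsto_add_atTop_iff_nat 1]
  refine tendsto_const_nhds.congr fun n => ?_
  rw [h, mul_div_assoc, div_self (hs _).ne', mul_one]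

/-- Positivity forces the common difference b to be nonnegative, and then b / s_n ≤ 1/n. -/
lemma tendsto_ratio_of_arithmetic {s : ℕ → ℝ} (hs : ∀ n, 0 < s n)
    (h : ∀ n, s (n + 2) = 2 * s (n + 1) - s n) :
    Tendsto (fun n => s (n + 1) / s n) atTop (𝓝 1) := by
  set b := s 1 - s 0 with hb
  have hd : ∀ n, s (n + 1) - s n = b := by
    intro n
    induction n with
    | zero => rfl
    | succ n ih => rw [h]; linarith
  have hform : ∀ n : ℕ, s n = s 0 + n * b := by
    intro n
    induction n with
    | zero => simp
    | succ n ih =>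
      have := hd n
      push_cast
      linarith
  have hb0 : 0 ≤ b := by
    by_contra! hneg
    obtain ⟨n, hn⟩ := exists_nat_gt (s 0 / -b)
    rw [div_lt_iff₀ (by linarith)] at hn
    have := hs n
    rw [hform] at this
    linarith
  have h1 : Tendsto (fun n => 1 + b / s n) atTop (𝓝 (1 + 0)) := by
    refine tendsto_const_nhds.add (squeeze_zero' (Eventually.of_forall fun n =>
      div_nonneg hb0 (hs n).le) ?_ tendsto_one_div_atTop_nhds_zero_nat)
    filter_upwards [eventually_gt_atTop 0] with n hn
    have hn' : (0 : ℝ) < n := by exact_mod_cast hn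
    rw [div_le_div_iff₀ (hs n) hn', one_mul, hform n]
    linarith [hs 0]
  rw [add_zero] at h1
  refine h1.congr fun n => ?_
  have := (hs n).ne'
  rw [← hd n]
  field_simp
  ring

/-- The ratio evolves by r ↦ 1 + 1/r with fixed point φ; from the second ratio on, r ≥ 1 and the
distance to φ shrinks by the factor 1/φ at least. -/
lemma tendsto_ratio_of_fibonacci {s : ℕ → ℝ} (hs : ∀ n, 0 < s n)
    (h : ∀ n, s (n + 2) = s (n + 1) + s n) :
    Tendsto (fun n => s (n + 1) / s n) atTop (𝓝 Real.goldenRatio) := by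
  have hφ := Real.one_lt_goldenRatio
  have hφ0 := Real.goldenRatio_pos
  have hφ2 := Real.goldenRatio_sq
  set φ := Real.goldenRatio
  have hrec : ∀ n, s (n + 2) / s (n + 1) - φ =
      (φ - s (n + 1) / s n) * (s n / s (n + 1)) * φ⁻¹ := by
    intro n
    have h0 := (hs n).ne'
    have h1 := (hs (n + 1)).ne'
    rw [h]
    field_simp
    linear_combination (-s (n + 1)) * hφ2
  have hle : ∀ n, s (n + 1) / s (n + 2) ≤ 1 := by
    intro n
    rw [div_le_one (hs _), h]
    linarith [hs n]
  have hbound : ∀ n, |s (n + 2) / s (n + 1) - φ| ≤ φ⁻¹ ^ n * |s 2 / s 1 - φ| := by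
    intro n
    induction n with
    | zero => simp
    | succ n ih =>
      rw [hrec (n + 1), abs_mul, abs_mul, abs_of_pos (div_pos (hs (n + 1)) (hs (n + 1 + 1))),
        abs_of_pos (inv_pos.mpr hφ0), abs_sub_comm, pow_succ]
      calc _ ≤ |s (n + 1 + 1) / s (n + 1) - φ| * 1 * φ⁻¹ := by
            gcongr
            exact hle n
        _ ≤ (φ⁻¹ ^ n * |s 2 / s 1 - φ|) * 1 * φ⁻¹ := by gcongr
        _ = _ := by ring
  rw [← tendsto_add_atTop_iff_nat 1, tendsto_iff_norm_sub_tendsto_zero]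
  have h1 : Tendsto (fun n => φ⁻¹ ^ n * |s 2 / s 1 - φ|) atTop (𝓝 (0 * |s 2 / s 1 - φ|)) :=
    (tendsto_pow_atTop_nhds_zero_of_lt_one (by positivity)
      (inv_lt_one_of_one_lt₀ hφ)).mul_const _
  rw [zero_mul] at h1
  exact squeeze_zero (fun n => norm_nonneg _) hbound h1

/-- The ratios of a positive linear functional of the powers of a two by two matrix of zeros and
ones converge, unless the matrix is a transposition. -/
lemma exists_tendsto_ratio {a b c d : ℝ} (ha : a = 0 ∨ a = 1) (hb : b = 0 ∨ b = 1)
    (hc : c = 0 ∨ c = 1) (hd : d = 0 ∨ d = 1) {U V s : ℕ → ℝ} {u v : ℝ}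
    (hU : ∀ n, U (n + 1) = a * U n + b * V n) (hV : ∀ n, V (n + 1) = c * U n + d * V n)
    (hsUV : ∀ n, s n = u * U n + v * V n) (hs : ∀ n, 0 < s n)
    (hswap : a = 0 → d = 0 → b = 1 → c = 1 → ∀ n, s (n + 1) = s n) :
    ∃ t, Tendsto (fun n => s (n + 1) / s n) atTop (𝓝 t) := by
  -- Cayley–Hamilton for the two by two matrix.
  have hrec : ∀ n, s (n + 2) = (a + d) * s (n + 1) - (a * d - b * c) * s n := by
    intro n
    rw [hsUV, hsUV, hsUV, hU (n + 1), hV (n + 1), hU n, hV n]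
    ring
  have hcases : a * d - b * c = 0 ∨ (a + d = 2 ∧ a * d - b * c = 1) ∨
      (a + d = 1 ∧ a * d - b * c = -1) ∨ (a = 0 ∧ d = 0 ∧ b = 1 ∧ c = 1) := by
    rcases ha with rfl | rfl <;> rcases hb with rfl | rfl <;> rcases hc with rfl | rfl <;>
      rcases hd with rfl | rfl <;> norm_num
  rcases hcases with h | ⟨ht, h⟩ | ⟨ht, h⟩ | ⟨h1, h2, h3, h4⟩
  · exact ⟨a + d, tendsto_ratio_of_geometric hs fun n => by rw [hrec, h]; ring⟩
  · exact ⟨_, tendsto_ratio_of_arithmetic hs fun n => by rw [hrec, ht, h]; ring⟩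
  · exact ⟨_, tendsto_ratio_of_fibonacci hs fun n => by rw [hrec, ht, h]; ring⟩
  · refine ⟨1, tendsto_const_nhds.congr fun n => ?_⟩
    rw [hswap h1 h2 h3 h4, div_self (hs n).ne']

end Recurrence

/-! ### Renewal of the image measure. -/

namespace Subshift

section Fiber

variable {k : ℕ} {A : Matrix (Fin k) (Fin k) ℕ} {Y : Subshift 2} {π : ofMatrix A → Y}
  {φ : Fin k → Fin 2} {μ : Measure (ofMatrix A)} {l : ℝ} {w : Fin k → ℝ}

/-- The mass of the points in the fiber of a set that start with a given symbol. -/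
noncomputable def fiberMass (μ : Measure (ofMatrix A)) (π : ofMatrix A → Y) (E : Set Y)
    (i : Fin k) : ℝ := μ.real (π ⁻¹' E ∩ {x | x.1 0 = i})

lemma measureReal_map_eq_sum_fiberMass [IsFiniteMeasure μ] (hπ : Measurable π) {E : Set Y}
    (hE : MeasurableSet E) : (μ.map π).real E = ∑ i, fiberMass μ π E i := by
  have h : π ⁻¹' E = ⋃ i, (π ⁻¹' E ∩ {x | x.1 0 = i}) := by
    ext x; simp
  rw [map_measureReal_apply hπ hE]
  conv_lhs => rw [h]
  rw [measureReal_iUnion_fintype]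
  · rfl
  · intro i j hij
    exact Set.disjoint_left.mpr fun x hx hx' => hij (hx.2.symm.trans hx'.2)
  · exact fun i => (hπ hE).inter ((ofMatrix A).isClopen_symbol 0 i).isOpen.measurableSet

lemma fiberMass_pull (hπ : IsFactorMap π) (hcode : IsOneBlockCode φ π)
    (hμ : ∀ i C, IsClopen C → μ.real ((ofMatrix A).pull i C) =
      ∑ j, backward A l w i j * μ.real (C ∩ {x | x.1 0 = j}))
    {E : Set Y} (hE : IsClopen E) (s : Fin 2) (i : Fin k) :
    fiberMass μ π (Y.pull s E) i =
      if φ i = s then ∑ j, backward A l w i j * fiberMass μ π E j else 0 := by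
  have hset : π ⁻¹' Y.pull s E ∩ {x | x.1 0 = i} =
      if φ i = s then (ofMatrix A).pull i (π ⁻¹' E) else ∅ := by
    ext x
    simp only [pull, Set.mem_inter_iff, Set.mem_preimage, Set.mem_ofPred_eq, hcode x 0, ← hπ.2.2]
    split_ifs with h
    · constructor
      · rintro ⟨⟨-, h1⟩, h2⟩
        exact ⟨h2, h1⟩
      · rintro ⟨h1, h2⟩
        exact ⟨⟨by rw [h1, h], h2⟩, h1⟩
    · simp only [Set.mem_empty_iff_false, iff_false]
      rintro ⟨⟨h1, -⟩, h2⟩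
      exact h (by rw [← h1, h2])
  rw [fiberMass, hset]
  split_ifs
  · exact hμ i _ (hE.preimage hπ.1)
  · exact measureReal_empty

variable {i₀ : Fin k}

lemma fiberMass_of_subset_zeroSet (hcode : IsOneBlockCode φ π) (hφ : ∀ i, φ i = 0 → i = i₀)
    {E : Set Y} (hE : E ⊆ Y.zeroSet) {i : Fin k} (hi : i ≠ i₀) : fiberMass μ π E i = 0 := by
  have h : π ⁻¹' E ∩ {x | x.1 0 = i} = ∅ := by
    refine Set.eq_empty_of_forall_notMem fun x hx => hi (hφ i ?_)
    have h1 := hE hx.1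
    rw [zeroSet, Set.mem_ofPred_eq, hcode x 0, hx.2] at h1
    exact h1
  rw [fiberMass, h, measureReal_empty]

/-- The image measure renews at a symbol with a single preimage. -/
lemma renewal [IsFiniteMeasure μ] (hπ : IsFactorMap π) (hcode : IsOneBlockCode φ π)
    (hφ : ∀ i, φ i = 0 → i = i₀)
    (hμ : ∀ i C, IsClopen C → μ.real ((ofMatrix A).pull i C) =
      ∑ j, backward A l w i j * μ.real (C ∩ {x | x.1 0 = j}))
    (u : List (Fin 2)) {E : Set Y} (hE : IsClopen E) (hE0 : E ⊆ Y.zeroSet) :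
    (μ.map π).real (Y.pulls u E) * (μ.map π).real Y.zeroSet =
      (μ.map π).real (Y.pulls u Y.zeroSet) * (μ.map π).real E := by
  have hm := hπ.1.measurable
  have hbase : ∀ F : Set Y, IsClopen F → F ⊆ Y.zeroSet →
      (μ.map π).real F = fiberMass μ π F i₀ := by
    intro F hF hF0
    rw [measureReal_map_eq_sum_fiberMass hm hF.isOpen.measurableSet]
    exact Fintype.sum_eq_single _ fun i hi => fiberMass_of_subset_zeroSet hcode hφ hF0 hi
  -- The identity is proved for each starting symbol upstairs, where prepending acts linearly. At
  -- the empty word it holds because only i₀ can lie over 0.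
  have key : ∀ i, fiberMass μ π (Y.pulls u E) i * (μ.map π).real Y.zeroSet =
      fiberMass μ π (Y.pulls u Y.zeroSet) i * (μ.map π).real E := by
    induction u with
    | nil =>
      intro i
      by_cases hi : i = i₀
      · rw [hi, hbase E hE hE0, hbase _ isClopen_zeroSet subset_rfl]
        exact mul_comm _ _
      · rw [pulls_nil, pulls_nil, fiberMass_of_subset_zeroSet hcode hφ hE0 hi,
          fiberMass_of_subset_zeroSet hcode hφ subset_rfl hi, zero_mul, zero_mul]
    | cons s u ih =>
      intro i
      rw [pulls_cons, pulls_cons, fiberMass_pull hπ hcode hμ (Y.isClopen_pulls u hE),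
        fiberMass_pull hπ hcode hμ (Y.isClopen_pulls u isClopen_zeroSet)]
      split_ifs
      · rw [Finset.sum_mul, Finset.sum_mul]
        exact Finset.sum_congr rfl fun j _ => by rw [mul_assoc, ih, mul_assoc]
      · rw [zero_mul, zero_mul]
  rw [measureReal_map_eq_sum_fiberMass hm (Y.isClopen_pulls u hE).isOpen.measurableSet,
    measureReal_map_eq_sum_fiberMass hm (Y.isClopen_pulls u isClopen_zeroSet).isOpen.measurableSet,
    Finset.sum_mul, Finset.sum_mul]
  exact Finset.sum_congr rfl fun i _ => key i

end Fiber

/-! ### Convergence of the ratios of run masses. -/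

section ThreeSymbols

variable {A : Matrix (Fin 3) (Fin 3) ℕ} {B : Matrix (Fin 2) (Fin 2) ℕ}
  {π : ofMatrix A → ofMatrix B} {μ : Measure (ofMatrix A)} {l : ℝ} {w : Fin 3 → ℝ}

/-- The ratios of the masses of the runs converge. -/
lemma exists_tendsto_runMass_ratio [IsProbabilityMeasure μ] (hlw : IsMarkovData A l w)
    (hμ : ∀ i C, IsClopen C → μ.real ((ofMatrix A).pull i C) =
      ∑ j, backward A l w i j * μ.real (C ∩ {x | x.1 0 = j}))
    (hπ : IsFactorMap π) (hcode : IsOneBlockCode ![0, 1, 1] π)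
    (hpos : ∀ a, 0 < runMass (μ.map π) a)
    (hpos' : ∀ a, 0 < (μ.map π).real ((ofMatrix B).pull 0
      ((ofMatrix B).pulls (List.replicate (a + 1) 1) (ofMatrix B).zeroSet))) :
    ∃ θ, Tendsto (fun a => runMass (μ.map π) (a + 1) / runMass (μ.map π) a) atTop (𝓝 θ) := by
  have hm := hπ.1.measurable
  have hl := hlw.pos
  have hw := hlw.pos_vec
  let R : ℕ → Set (ofMatrix B) := fun a =>
    (ofMatrix B).pulls (List.replicate a 1) (ofMatrix B).zeroSet
  have hR : ∀ a, IsClopen (R a) := fun a => isClopen_run a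
  let α : Fin 3 → Fin 3 → ℝ := fun i j => if A i j = 1 then 1 else 0
  have hα : ∀ i j, α i j = 0 ∨ α i j = 1 := by
    intro i j
    simp only [α]
    split_ifs <;> simp
  have hback : ∀ i j, backward A l w i j = α i j * (w i / (l * w j)) := by
    intro i j
    simp only [α, backward]
    split_ifs <;> simp
  -- This scaling removes l and w from the recursion and leaves a matrix of zeros and ones. Starting
  -- at run length 1 removes the symbol 0.
  let W : ℕ → Fin 3 → ℝ := fun a i => l ^ a * fiberMass μ π (R (a + 1)) i / w i
  have hone : ∀ a i, i ≠ 0 → fiberMass μ π (R (a + 1)) i =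
      ∑ j, backward A l w i j * fiberMass μ π (R a) j := by
    intro a i hi
    simp only [R]
    rw [List.replicate_succ, pulls_cons, fiberMass_pull hπ hcode hμ (hR a), if_pos]
    fin_cases i
    · exact absurd rfl hi
    · rfl
    · rfl
  have hR0 : ∀ a, fiberMass μ π (R (a + 1)) 0 = 0 := by
    intro a
    simp only [R]
    rw [List.replicate_succ, pulls_cons, fiberMass_pull hπ hcode hμ (hR a), if_neg]
    simp
  have hrec : ∀ a i, i ≠ 0 → W (a + 1) i = α i 1 * W a 1 + α i 2 * W a 2 := by
    intro a i hi
    simp only [W]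
    rw [hone (a + 1) i hi, Fin.sum_univ_three, hR0, hback i 1, hback i 2]
    have h1 := (hw 1).ne'
    have h2 := (hw 2).ne'
    have h3 := (hw i).ne'
    field_simp
    ring
  have hrun : ∀ a, runMass (μ.map π) (a + 1) =
      fiberMass μ π (R (a + 1)) 1 + fiberMass μ π (R (a + 1)) 2 := by
    intro a
    rw [runMass, measureReal_map_eq_sum_fiberMass hm (hR (a + 1)).isOpen.measurableSet,
      Fin.sum_univ_three]
    change fiberMass μ π (R (a + 1)) 0 + _ + _ = _
    rw [hR0, zero_add]
  let s : ℕ → ℝ := fun a => l ^ a * runMass (μ.map π) (a + 1)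
  have hs : ∀ a, 0 < s a := fun a => mul_pos (pow_pos hl a) (hpos _)
  have hsW : ∀ a, s a = w 1 * W a 1 + w 2 * W a 2 := by
    intro a
    simp only [s, W]
    rw [hrun]
    have h1 := (hw 1).ne'
    have h2 := (hw 2).ne'
    field_simp
  have hW0 : ∀ i, i ≠ 0 → W 0 i = α i 0 * (fiberMass μ π (R 0) 0 / (l * w 0)) := by
    intro i hi
    have h1 : ∀ j, j ≠ 0 → fiberMass μ π (R 0) j = 0 := fun j hj =>
      fiberMass_of_subset_zeroSet (i₀ := 0) hcode (by decide) subset_rfl hj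
    simp only [W]
    rw [zero_add, hone 0 i hi, Fin.sum_univ_three, h1 1 (by decide), h1 2 (by decide), hback]
    have h2 := (hw i).ne'
    have h3 := (hw 0).ne'
    field_simp
    ring
  -- Up to a positive factor this is the mass of the word 0 1^{a+1} 0.
  have hgap : ∀ a, 0 < α 0 1 * W a 1 + α 0 2 * W a 2 := by
    intro a
    have h1 := hpos' a
    rw [measureReal_map_eq_sum_fiberMass hm
      ((ofMatrix B).isClopen_pull 0 (hR (a + 1))).isOpen.measurableSet, Fin.sum_univ_three,
      fiberMass_pull hπ hcode hμ (hR (a + 1)), fiberMass_pull hπ hcode hμ (hR (a + 1)),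
      fiberMass_pull hπ hcode hμ (hR (a + 1)), if_pos (show (![0, 1, 1] : Fin 3 → Fin 2) 0 = 0 from rfl),
      if_neg (show (![0, 1, 1] : Fin 3 → Fin 2) 1 ≠ 0 by decide),
      if_neg (show (![0, 1, 1] : Fin 3 → Fin 2) 2 ≠ 0 by decide),
      add_zero, add_zero, Fin.sum_univ_three, hR0, hback 0 1, hback 0 2] at h1
    have h2 : 0 < l ^ (a + 1) / w 0 := div_pos (pow_pos hl _) (hw 0)
    have h3 := mul_pos h2 h1
    have h4 := (hw 1).ne'
    have h5 := (hw 2).ne'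
    have h6 := (hw 0).ne'
    refine h3.trans_eq ?_
    simp only [W]
    field_simp
    ring
  -- Here W only exchanges its two entries, and an oscillation of period two has to be excluded.
  have hswap : α 1 1 = 0 → α 2 2 = 0 → α 1 2 = 1 → α 2 1 = 1 → ∀ a, s (a + 1) = s a := by
    intro h11 h22 h12 h21
    have hstep1 : ∀ a, W (a + 1) 1 = W a 2 := fun a => by
      rw [hrec a 1 (by decide), h11, h12]; ring
    have hstep2 : ∀ a, W (a + 1) 2 = W a 1 := fun a => by
      rw [hrec a 2 (by decide), h21, h22]; ring
    by_cases hα0 : α 0 1 = 1 ∧ α 0 2 = 1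
    · obtain ⟨h01, h02⟩ := hα0
      have hA : ∀ {i j}, α i j = 1 → A i j = 1 := by
        intro i j h
        by_contra hne
        simp only [α, if_neg hne] at h
        norm_num at h
      obtain ⟨x, hx⟩ : ∃ x : ofMatrix A, x.1 0 = 1 ∨ x.1 0 = 2 := by
        have h1 : (π ⁻¹' R 1).Nonempty := by
          by_contra hne
          have h2 := hpos 1
          rw [runMass, map_measureReal_apply hm (hR 1).isOpen.measurableSet] at h2
          change 0 < μ.real (π ⁻¹' R 1) at h2
          rw [Set.not_nonempty_iff_eq_empty.mp hne, measureReal_empty] at h2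
          exact lt_irrefl _ h2
        obtain ⟨x, hx⟩ := h1
        have h3 : (π x).1 0 = 1 := hx.1
        rw [hcode x 0] at h3
        refine ⟨x, ?_⟩
        generalize x.1 0 = i at h3
        fin_cases i <;> simp_all
      have hocc : (∃ x : ofMatrix A, x.1 0 = 1) ∧ ∃ x : ofMatrix A, x.1 0 = 2 := by
        rcases hx with hx | hx
        · exact ⟨⟨x, hx⟩, exists_symbol_of_transition ⟨x, hx⟩ (hA h21)⟩
        · exact ⟨exists_symbol_of_transition ⟨x, hx⟩ (hA h12), ⟨x, hx⟩⟩
      have heig : ∀ j, (∃ x : ofMatrix A, x.1 0 = j) → ∑ i, α i j * w i = l * w j := by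
        rintro j ⟨x, rfl⟩
        rw [← hlw.sum_eq x]
        refine Finset.sum_congr rfl fun i _ => ?_
        simp only [α]
        split_ifs <;> simp
      have e1 := heig 1 hocc.1
      have e2 := heig 2 hocc.2
      rw [Fin.sum_univ_three] at e1 e2
      -- If 0 precedes both symbols, they have equal columns up to the exchange. The eigenvector
      -- equations then give w 1 = w 2, and the exchange does not affect s.
      have hw12 : w 1 = w 2 := by
        rw [h01, h11, h21] at e1
        rw [h02, h12, h22] at e2
        have h1 : (l + 1) * (w 1 - w 2) = 0 := by linear_combination e2 - e1
        rcases mul_eq_zero.mp h1 with h2 | h2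
        · linarith
        · linarith
      intro a
      rw [hsW, hsW, hstep1, hstep2, hw12]
      ring
    -- If 0 precedes only one of the two symbols, positivity at runs of both parities forces both
    -- entries of W 0 to be positive. Hence both symbols precede 0, and the entries coincide.
    · have g0 := hgap 0
      have g1 := hgap 1
      rw [hstep1, hstep2] at g1
      rw [hW0 1 (by decide), hW0 2 (by decide)] at g0 g1
      have hend : α 1 0 = 1 ∧ α 2 0 = 1 := by
        rcases hα 0 1 with p | p <;> rcases hα 0 2 with q | q <;>
          rcases hα 1 0 with p' | p' <;> rcases hα 2 0 with q' | q' <;>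
          simp_all
      have heq : ∀ a, W a 1 = W a 2 := by
        intro a
        induction a with
        | zero => rw [hW0 1 (by decide), hW0 2 (by decide), hend.1, hend.2]
        | succ a ih => rw [hstep1, hstep2, ih]
      intro a
      rw [hsW, hsW, hstep1, hstep2, heq]
  obtain ⟨t, ht⟩ := exists_tendsto_ratio (hα 1 1) (hα 1 2) (hα 2 1) (hα 2 2)
    (U := fun a => W a 1) (V := fun a => W a 2) (fun a => hrec a 1 (by decide))
    (fun a => hrec a 2 (by decide)) hsW hs hswap
  -- The factor l^a in s accounts for the division by l.
  refine ⟨t / l, (tendsto_add_atTop_iff_nat 1).mp ((ht.div_const l).congr fun a => ?_)⟩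
  simp only [s]
  have h1 := (hpos (a + 1)).ne'
  field_simp
  ring

end ThreeSymbols

end Subshift

/-! ### Conclusion for the image of the measure of maximal entropy. -/

namespace Subshift

lemma IsInvariant.map {k d : ℕ} {X : Subshift k} {Y : Subshift d} {π : X → Y} (hπ : IsFactorMap π)
    {μ : Measure X} (hμ : X.IsInvariant μ) : Y.IsInvariant (μ.map π) := by
  have := hμ.1
  have hm := hπ.1.measurable
  refine ⟨Measure.isProbabilityMeasure_map hm.aemeasurable, Y.measurable_shift, ?_⟩
  rw [Measure.map_map Y.measurable_shift hm,
    show Y.shift ∘ π = π ∘ X.shift from funext fun x => (hπ.2.2 x).symm,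
    ← Measure.map_map hm X.measurable_shift, hμ.2.map_eq]

lemma IsInvariantGibbs.isInvariantWeakGibbs {k : ℕ} {X : Subshift k} {μ : Measure X} {g : X → ℝ}
    (h : X.IsInvariantGibbs μ g) : X.IsInvariantWeakGibbs μ g := by
  obtain ⟨hμ, P, C, hC, hg⟩ := h
  exact ⟨hμ, P, fun _ => C, fun _ _ => hC, tendsto_const_div_atTop_nhds_zero_nat _, hg⟩

section

variable {A : Matrix (Fin 3) (Fin 3) ℕ} {B : Matrix (Fin 2) (Fin 2) ℕ}
  {π : ofMatrix A → ofMatrix B} {μ : Measure (ofMatrix A)}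

/-- If the relative pressure sequence is almost additive up to `b n`, then the image of the
measure of maximal entropy is a Gibbs measure with constants proportional to `exp (b n)`. -/
theorem exists_gibbsBounds_of_relPressureSeq (h : AllowsRuns B) (hX : (ofMatrix A).IsIrreducible)
    (hπ : IsFactorMap π) (hcode : IsOneBlockCode ![0, 1, 1] π)
    (hμ : (ofMatrix A).IsMaximalEntropy μ) {b : ℕ → ℝ}
    (hb : ∀ (y : ofMatrix B) (n p : ℕ), 1 ≤ n → 1 ≤ p →
      relPressureSeq π (fun _ => 0) (n + p) y ≤ Real.exp (b n) * relPressureSeq π (fun _ => 0) n y *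
        relPressureSeq π (fun _ => 0) p ((ofMatrix B).shift^[n] y) ∧
      Real.exp (-b n) * relPressureSeq π (fun _ => 0) n y *
        relPressureSeq π (fun _ => 0) p ((ofMatrix B).shift^[n] y) ≤
          relPressureSeq π (fun _ => 0) (n + p) y) :
    ∃ (K : ℝ) (g : C(ofMatrix B, ℝ)), 0 < K ∧
      (ofMatrix B).GibbsBounds (μ.map π) g 0 (fun n => K * Real.exp (b n)) ∧
      (Tendsto (fun n : ℕ => Real.log (K * Real.exp (b n)) / n) atTop (𝓝 0) →
        ∀ ν, (ofMatrix B).IsInvariantWeakGibbs ν g → ν = μ.map π) := by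
  have := hμ.1.1
  have hm := hπ.1.measurable
  have hinv := hμ.1.map hπ
  have := hinv.1
  obtain ⟨l, w, hlw, hback⟩ := measureReal_pull_of_isMaximalEntropy hX hμ
  obtain ⟨c, C, hc, hC, hcyl⟩ := measureReal_cylinder_bounds hX hlw hback
  have hl := hlw.pos
  have hpos : ∀ y n, 1 ≤ n → 0 < (μ.map π).real ((ofMatrix B).cylinder y n) := by
    intro y n hn
    obtain ⟨x, rfl⟩ := hπ.2.1 y
    rw [map_measureReal_apply hm ((ofMatrix B).measurableSet_cylinder _ n)]
    have h1 : 0 < μ.real ((ofMatrix A).cylinder x n) :=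
      pos_of_mul_pos_right (hc.trans_le (hcyl x n hn).1) (pow_pos hl n).le
    exact h1.trans_le (measureReal_mono fun z hz => hcode.image_mem_cylinder hz)
  have hpos' : ∀ a, 0 < (μ.map π).real ((ofMatrix B).pull 0
      ((ofMatrix B).pulls (List.replicate (a + 1) 1) (ofMatrix B).zeroSet)) := by
    intro a
    -- The run is nonempty, so 0 may be prepended even when 00 is forbidden.
    have h0 : (runPoint h (a + 1)).1 0 = 1 :=
      if_neg (t := (0 : Fin 2)) (Nat.succ_ne_zero a).symm
    rw [← cylinder_runPoint h, pull_cylinder_of_transition _ _ _ (by rw [h0]; exact h.zero_one)]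
    exact hpos _ _ (by omega)
  obtain ⟨θ, hθ⟩ := exists_tendsto_runMass_ratio hlw hback hπ hcode (runMass_pos h hpos) hpos'
  have hK : 0 < max (C / c ^ 2) (C ^ 2 / c) := lt_max_of_lt_left (by positivity)
  obtain ⟨g, hg, huniq⟩ := exists_gibbsBounds h hinv hpos
    (fun u E hE hE0 => renewal (i₀ := 0) hπ hcode (by decide) hback u hE hE0)
    (fun n _ => mul_pos hK (Real.exp_pos _))
    (quasiBernoulli_of_bounds hl hc hC (fun y n hn => relPressureSeq_bounds hcode hm hc hcyl y hn)
      hb) hθ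
  exact ⟨_, g, hK, hg, huniq⟩

lemma almostAdditive_of_isInvariantGibbs (hX : (ofMatrix A).IsIrreducible)
    (hπ : IsFactorMap π) (hcode : IsOneBlockCode ![0, 1, 1] π)
    (hμ : (ofMatrix A).IsMaximalEntropy μ) {g : ofMatrix B → ℝ}
    (hg : (ofMatrix B).IsInvariantGibbs (μ.map π) g) :
    (ofMatrix B).AlmostAdditive (relPressureSeq π fun _ => 0) := by
  have := hμ.1.1
  obtain ⟨l, w, hlw, hback⟩ := measureReal_pull_of_isMaximalEntropy hX hμ
  obtain ⟨c, C, hc, hC, hcyl⟩ := measureReal_cylinder_bounds hX hlw hback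
  obtain ⟨-, P, G, hG, hg⟩ := hg
  exact almostAdditive_of_gibbsBounds hlw.pos hc hC
    (fun y n hn => relPressureSeq_bounds hcode hπ.1.measurable hc hcyl y hn) hG hg

end

end Subshift

theorem corollary4p10
    (A : Matrix (Fin 3) (Fin 3) ℕ) (hA : ∀ i j, A i j = 0 ∨ A i j = 1)
    (B : Matrix (Fin 2) (Fin 2) ℕ) (hB : B = !![1, 1; 1, 1] ∨ B = !![0, 1; 1, 1])
    (X : Subshift 3) (hXA : X = Subshift.ofMatrix A) (hX : X.IsIrreducible)
    (Y : Subshift 2) (hYB : Y = Subshift.ofMatrix B)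
    (π : X → Y) (hπ : Subshift.IsFactorMap π) (hcode : Subshift.IsOneBlockCode ![0, 1, 1] π)
    (μ : Measure X) (hμ : X.IsMaximalEntropy μ) :
    (Y.AlmostAdditive (Subshift.relPressureSeq π (fun _ => 0)) ↔
      ∃ g : C(Y, ℝ), Y.IsInvariantGibbs (μ.map π) g ∧
        ∀ ν : Measure Y, Y.IsInvariantGibbs ν g → ν = μ.map π) ∧
    (Y.WeaklyAlmostAdditive (Subshift.relPressureSeq π (fun _ => 0)) →
      ∃ g : C(Y, ℝ), Y.IsInvariantWeakGibbs (μ.map π) g ∧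
        ∀ ν : Measure Y, Y.IsInvariantWeakGibbs ν g → ν = μ.map π) := by
  subst hXA hYB
  have h : Subshift.AllowsRuns B := by
    rcases hB with rfl | rfl <;> exact ⟨rfl, rfl, rfl⟩
  have hinv := hμ.1.map hπ
  refine ⟨⟨?_, ?_⟩, ?_⟩
  · rintro ⟨b, -, hb⟩
    obtain ⟨K, g, hK, hg, huniq⟩ :=
      Subshift.exists_gibbsBounds_of_relPressureSeq h hX hπ hcode hμ (b := fun _ => b) hb
    exact ⟨g, ⟨hinv, 0, K * Real.exp b, mul_pos hK (Real.exp_pos _), hg⟩, fun ν hν =>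
      huniq (tendsto_const_div_atTop_nhds_zero_nat _) ν hν.isInvariantWeakGibbs⟩
  · rintro ⟨g, hg, -⟩
    exact Subshift.almostAdditive_of_isInvariantGibbs hX hπ hcode hμ hg
  · rintro ⟨b, -, hlim, hb⟩
    obtain ⟨K, g, hK, hg, huniq⟩ :=
      Subshift.exists_gibbsBounds_of_relPressureSeq h hX hπ hcode hμ hb
    have hlog : Tendsto (fun n : ℕ => Real.log (K * Real.exp (b n)) / n) atTop (𝓝 0) := by
      have h1 := (tendsto_const_div_atTop_nhds_zero_nat (Real.log K)).add hlim
      rw [add_zero] at h1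
      refine h1.congr fun n => ?_
      rw [Real.log_mul hK.ne' (Real.exp_ne_zero _), Real.log_exp, add_div]
    exact ⟨g, ⟨hinv, 0, _, fun n _ => mul_pos hK (Real.exp_pos _), hlog, hg⟩, huniq hlog⟩
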